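/- Let $k$ be a field. **Hopf algebroids.** A left bialgebroid $\mathcal U_L=(U,A,s,t,\Delta,\varepsilon)$ over $k$ consists of $k$-algebras $A$, $U$, $k$-algebra homomorphisms $s:A\to U$ and $t:A^{op}\to U$ with commuting images, an $A$-coring structure $\Delta:U\to U\otimes_AU$, $u\mapsto u_{(1)}\otimes u_{(2)}$, $\varepsilon:U\to A$ for the bimodule structure $a\cdot u\cdot b=s(a)t(b)u$, such that $u_{(1)}t(a)\otimes u_{(2)}=u_{(1)}\otimes u_{(2)}s(a)$ for $u\in U$, $a\in A$ (that is, $\Delta$ takes values in the Takeuchi product), $\Delta$ is unital and multiplicative, and $\varepsilon(us(\varepsilon(u')))=\varepsilon(uu')=\varepsilon(ut(\varepsilon(u')))$. A Hopf algebroid $\mathcal U=(\mathcal U_L,S)$ is a left bialgebroid with an involutive anti-automorphism $S$ of the $k$-algebra $U$ such that $S\circ t=s$ and $S(u_{(1)})_{(1)}u_{(2)}\otimes S(u_{(1)})_{(2)}=1\otimes S(u)$, $S(u_{(2)})_{(1)}\otimes S(u_{(2)})_{(2)}u_{(1)}=S(u)\otimes 1$ in $U\otimes_AU$. Tensor products over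 $A^{op}$ are formed with $x\,t(a)\otimes v=x\otimes t(a)v$. The Hopf-Galois map $\beta:U\otimes_{A^{op}}U\to U\otimes_AU$, $u\otimes v\mapsto u_{(1)}\otimes u_{(2)}v$, is then bijective, and one writes $u_+\otimes u_-:=\beta^{-1}(u\otimes1)$. **SAYD modules.** A stable anti-Yetter-Drinfeld (SAYD) module $P$ over $\mathcal U$ is a right $U$-module which is also a left comodule over the $A$-coring $U$ (a left $A$-module with a left $A$-linear, coassociative and counital map $\Delta_P:P\to U\otimes_AP$, $p\mapsto p_{(-1)}\otimes p_{(0)}$, where $t(a)u\otimes p=u\otimes ap$), such that $p\,s(a)t(b)=b\,\varepsilon(p_{(-1)}s(a))\,p_{(0)}$, $\Delta_P(pu)=u_-p_{(-1)}u_{+(1)}\otimes p_{(0)}u_{+(2)}$ and $p_{(0)}p_{(-1)}=p$ for all $p\in P$, $u\in U$, $a,b\in A$. Here $u_{+(1)}\otimes u_{+(2)}\otimes u_-$ is read through the identity $u_{+(1)}\otimes u_{+(2)}\otimes u_-=u_{(1)}\otimes u_{(2)+}\otimes u_{(2)-}$, so that the right hand side of the second condition is $u_{(2)-}p_{(-1)}u_{(1)}\otimes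 p_{(0)}u_{(2)+}$. For an SAYD module $P$, the cyclic module $C_\bullet(\mathcal U;P)$ is $C_n(\mathcal U;P)=P\otimes_{A^{op}}U\otimes_{A^{op}}\cdots\otimes_{A^{op}}U$ ($n$ factors $U$) with $$d_i(p\otimes u^1\otimes\cdots\otimes u^n)=\begin{cases}p\otimes u^1\otimes\cdots\otimes u^{n-1}t(\varepsilon(u^n))&i=0\\ p\otimes\cdots\otimes u^{n-i}u^{n-i+1}\otimes\cdots\otimes u^n&1\le i\le n-1\\ pu^1\otimes u^2\otimes\cdots\otimes u^n&i=n\end{cases}$$ for $n\ge 1$ (for $n=1$ and $i=0$ this means $p\,t(\varepsilon(u^1))$), the degeneracies $s_i$, $0\le i\le n$, inserting a factor $1\in U$: $s_0(p\otimes u^1\otimes\cdots\otimes u^n)=p\otimes u^1\otimes\cdots\otimes u^n\otimes1$, $s_i(p\otimes u^1\otimes\cdots\otimes u^n)=p\otimes\cdots\otimes u^{n-i}\otimes1\otimes u^{n-i+1}\otimes\cdots\otimes u^n$ for $1\le i\le n-1$, $s_n(p\otimes u^1\otimes\cdots\otimes u^n)=p\otimes1\otimes u^1\otimes\cdots\otimes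 u^n$, and the cyclic operators $$t_n(p\otimes u^1\otimes\cdots\otimes u^n)=p_{(0)}u^1_+\otimes u^2_+\otimes\cdots\otimes u^n_+\otimes u^n_-\cdots u^1_-p_{(-1)}$$ (for $n=0$: $t_0(p)=p_{(0)}p_{(-1)}=p$). Its Hochschild homology $HH_\bullet(\mathcal U;P)$ is the homology of the complex with boundary $b=\sum_i(-1)^id_i$, and its cyclic homology $HC_\bullet(\mathcal U;P)$ is the homology of the total complex of the cyclic bicomplex with columns $(C_\bullet,b)$, $(C_\bullet,-b')$ in turn and horizontal maps $1-\lambda$, $N$, where $b'=\sum_{i<n}(-1)^id_i$ on $C_n$, $\lambda=(-1)^nt_n$, $N=\sum_{i=0}^n\lambda^i$. **Measurings.** For a $k$-coalgebra $C$ and $k$-algebras $R,R'$, a measuring is a linear map $\psi:C\to \mathrm{Hom}_k(R,R')$ with $\psi(x)(ab)=\psi(x_{(1)})(a)\psi(x_{(2)})(b)$ and $\psi(x)(1)=\varepsilon_C(x)1$. Let $\mathcal U=(U,A,s,t,\Delta,\varepsilon,S)$ and $\mathcal U'=(U',A',s',t',\Delta',\varepsilon',S')$ be Hopf algebroids, and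 let $C$ be cocommutative. A $C$-measuring from $\mathcal U$ to $\mathcal U'$ is a pair of measurings $\Psi:C\to \mathrm{Hom}_k(U,U')$, $\psi:C\to \mathrm{Hom}_k(A,A')$ such that, for all $x\in C$, $\Psi(x)s=s'\psi(x)$, $\Psi(x)t=t'\psi(x)$, $\Psi(x)S=S'\Psi(x)$, $\psi(x)\varepsilon=\varepsilon'\Psi(x)$ and $\Delta'(\Psi(x)(u))=\Psi(x_{(1)})(u_{(1)})\otimes\Psi(x_{(2)})(u_{(2)})$. Let $P$, $P'$ be SAYD modules over $\mathcal U$, $\mathcal U'$, and let $D$ be a right $C$-comodule with coaction $y\mapsto y_{(0)}\otimes y_{(1)}$. A $(C,\Psi,\psi)$-comodule measuring from $P$ to $P'$ is a linear map $\Omega:D\to \mathrm{Hom}_k(P,P')$ with $\Omega(y)(pu)=\Omega(y_{(0)})(p)\,\Psi(y_{(1)})(u)$ and $\Delta_{P'}(\Omega(y)(p))=\Psi(y_{(1)})(p_{(-1)})\otimes\Omega(y_{(0)})(p_{(0)})$ for all $y\in D$, $p\in P$, $u\in U$. **Proposition.** Let $\mathcal U$, $\mathcal U'$ be Hopf algebroids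 over $k$, $P$, $P'$ SAYD modules over $\mathcal U$ and $\mathcal U'$, $C$ a cocommutative $k$-coalgebra, $(\Psi,\psi)$ a $C$-measuring from $\mathcal U$ to $\mathcal U'$, $D$ a right $C$-comodule and $\Omega$ a $(C,\Psi,\psi)$-comodule measuring from $P$ to $P'$. Then for each $y\in D$ there are (unique) well-defined linear maps $$\underline\Omega_n(y):C_n(\mathcal U;P)\to C_n(\mathcal U';P'),\qquad p\otimes u^1\otimes\cdots\otimes u^n\mapsto \Omega(y_{(0)})(p)\otimes\Psi(y_{(1)})(u^1)\otimes\cdots\otimes\Psi(y_{(n)})(u^n)\qquad(n\ge0),$$ and they form a morphism of cyclic modules $C_\bullet(\mathcal U;P)\to C_\bullet(\mathcal U';P')$, i.e. they commute with all $d_i$, $s_i$ and $t_n$. In particular, they induce maps $HH_n(\mathcal U;P)\to HH_n(\mathcal U';P')$ and $HC_n(\mathcal U;P)\to HC_n(\mathcal U';P')$ for all $n\geq 0$. -/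

import Mathlib

open scoped TensorProduct
open MulOpposite (op)

namespace HopfAlgebroids

/-! ## Tensor products over a (noncommutative) `k`-algebra -/

section Balanced

variable {k A M N X : Type*} [Field k] [AddCommGroup M] [Module k M] [AddCommGroup N] [Module k N]
  [AddCommGroup X] [Module k X]

/-- The subspace of `M ⊗ N` spanned by all `m·a ⊗ n - m ⊗ a·n`, where `r a` is the right action
`m ↦ m·a` and `l a` the left action `n ↦ a·n`. -/
def balRel (r : A → M →ₗ[k] M) (l : A → N →ₗ[k] N) : Submodule k (M ⊗[k] N) :=
  Submodule.span k {z | ∃ a m n, z = r a m ⊗ₜ[k] n - m ⊗ₜ[k] l a n}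

/-- The tensor product `M ⊗_A N`, as a quotient of `M ⊗_k N`. -/
abbrev Bal (r : A → M →ₗ[k] M) (l : A → N →ₗ[k] N) : Type _ := (M ⊗[k] N) ⧸ balRel r l

variable (r : A → M →ₗ[k] M) (l : A → N →ₗ[k] N)

/-- The elementary tensor `m ⊗_A n`, as a bilinear map. -/
def Bal.mk : M →ₗ[k] N →ₗ[k] Bal r l := (TensorProduct.mk k M N).compr₂ (balRel r l).mkQ

lemma Bal.mk_apply (m : M) (n : N) : Bal.mk r l m n = (balRel r l).mkQ (m ⊗ₜ n) := rfl

lemma Bal.mk_bal (a : A) (m : M) (n : N) : Bal.mk r l (r a m) n = Bal.mk r l m (l a n) := by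
  rw [Bal.mk_apply, Bal.mk_apply, ← sub_eq_zero, ← map_sub]
  exact (Submodule.Quotient.mk_eq_zero _).2 (Submodule.subset_span ⟨a, m, n, rfl⟩)

variable {r l}

/-- The map out of `M ⊗_A N` given by a balanced bilinear map. -/
def Bal.lift (φ : M →ₗ[k] N →ₗ[k] X) (h : ∀ a m n, φ (r a m) n = φ m (l a n)) :
    Bal r l →ₗ[k] X :=
  (balRel r l).liftQ (TensorProduct.lift φ) (by
    rw [balRel, Submodule.span_le]
    rintro _ ⟨a, m, n, rfl⟩
    simp [h])

@[simp] lemma Bal.lift_mk (φ : M →ₗ[k] N →ₗ[k] X) (h : ∀ a m n, φ (r a m) n = φ m (l a n))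
    (m : M) (n : N) : Bal.lift φ h (Bal.mk r l m n) = φ m n := by
  simp [Bal.lift, Bal.mk_apply]

lemma Bal.ext {f g : Bal r l →ₗ[k] X} (h : ∀ m n, f (Bal.mk r l m n) = g (Bal.mk r l m n)) :
    f = g := by
  refine Submodule.linearMap_qext _ (TensorProduct.ext' fun m n => h m n)

lemma Bal.induction {p : Bal r l → Prop} (tm : ∀ m n, p (Bal.mk r l m n))
    (add : ∀ x y, p x → p y → p (x + y)) (q : Bal r l) : p q := by
  obtain ⟨z, rfl⟩ := Submodule.mkQ_surjective _ q
  induction z using TensorProduct.induction_on with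
  | zero => simpa using tm 0 0
  | tmul m n => exact tm m n
  | add x y hx hy => simpa using add _ _ hx hy

end Balanced

/-- A `k`-linear choice of representatives for a map into a quotient space. -/
def IsLift {k V W : Type*} [Field k] [AddCommGroup V] [Module k V] [AddCommGroup W] [Module k W]
    {K : Submodule k W} (δ : V →ₗ[k] W ⧸ K) (D : V →ₗ[k] W) : Prop :=
  ∀ v, K.mkQ (D v) = δ v

/-- Over a field, linear choices of representatives exist. -/
lemma exists_isLift {k V W : Type*} [Field k] [AddCommGroup V] [Module k V] [AddCommGroup W]
    [Module k W] {K : Submodule k W} (δ : V →ₗ[k] W ⧸ K) : ∃ D : V →ₗ[k] W, IsLift δ D := by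
  obtain ⟨g, hg⟩ := K.mkQ.exists_rightInverse_of_surjective (by simp)
  exact ⟨g ∘ₗ δ, fun v => LinearMap.congr_fun hg (δ v)⟩

/-! ## `(s,t)`-rings and right modules -/

universe u

/-- A right module over the `k`-algebra `U` (on a `k`-vector space). -/
structure RMod (k : Type*) (U : Type u) [Field k] [Ring U] [Algebra k U] where
  carrier : Type u
  [addCommGroup : AddCommGroup carrier]
  [module : Module k carrier]
  /-- `(p, u) ↦ p u` -/
  ract : carrier →ₗ[k] U →ₗ[k] carrier
  ract_one : ∀ p, ract p 1 = p
  ract_mul : ∀ p u v, ract p (u * v) = ract (ract p u) v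

attribute [instance] RMod.addCommGroup RMod.module

section Main

variable (k A : Type*) (U : Type u) [Field k] [Ring A] [Algebra k A] [Ring U] [Algebra k U]

/-- An `(s,t)`-ring structure on `U` over `A`. -/
structure STRing where
  /-- the source map -/
  s : A →ₐ[k] U
  /-- the target map -/
  t : Aᵐᵒᵖ →ₐ[k] U
  comm : ∀ a b, s a * t (op b) = t (op b) * s a

variable {k A U}

namespace STRing

variable (B : STRing k A U)

/-! ### The tensor product `U ⊗_A U` -/

/-- `U ⊗_A U` for the bimodule structure `a · u · b = s(a) t(b) u`. -/
abbrev Ten : Type _ :=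
  Bal (k := k) (fun a : A => LinearMap.mulLeft k (B.t (op a)))
    (fun a : A => LinearMap.mulLeft k (B.s a))

/-- The class in `U ⊗_A U` of a tensor in `U ⊗_k U`. -/
def cls : U ⊗[k] U →ₗ[k] B.Ten := Submodule.mkQ _

lemma cls_bal (a : A) (u v : U) :
    B.cls ((B.t (op a) * u) ⊗ₜ v) = B.cls (u ⊗ₜ (B.s a * v)) :=
  Bal.mk_bal (k := k) (fun a : A => LinearMap.mulLeft k (B.t (op a)))
    (fun a : A => LinearMap.mulLeft k (B.s a)) a u v

lemma cls_surj (q : B.Ten) : ∃ X, B.cls X = q := Submodule.mkQ_surjective _ q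

lemma ten_induction {p : B.Ten → Prop} (tm : ∀ u v, p (B.cls (u ⊗ₜ v)))
    (add : ∀ x y, p x → p y → p (x + y)) (q : B.Ten) : p q := Bal.induction tm add q

/-- The linear map out of `U ⊗_A U` given by a balanced bilinear map. -/
def tenLift {X : Type*} [AddCommGroup X] [Module k X] (φ : U →ₗ[k] U →ₗ[k] X)
    (h : ∀ a u v, φ (B.t (op a) * u) v = φ u (B.s a * v)) : B.Ten →ₗ[k] X := Bal.lift φ h

lemma tenLift_cls {X : Type*} [AddCommGroup X] [Module k X] (φ : U →ₗ[k] U →ₗ[k] X)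
    (h : ∀ a u v, φ (B.t (op a) * u) v = φ u (B.s a * v)) (z : U ⊗[k] U) :
    B.tenLift φ h (B.cls z) = TensorProduct.lift φ z := rfl

/-- `U ⊗_A U` is a quotient of `U ⊗_k U` by a right ideal; this is the right multiplication
`(U ⊗_A U) × (U ⊗_k U) → U ⊗_A U`. -/
def rmul : B.Ten →ₗ[k] U ⊗[k] U →ₗ[k] B.Ten :=
  Submodule.liftQ _ ((LinearMap.mul k (U ⊗[k] U)).compr₂ B.cls) (by
    refine Submodule.span_le.2 ?_
    rintro _ ⟨a, m, n, rfl⟩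
    rw [SetLike.mem_coe, LinearMap.mem_ker]
    refine TensorProduct.ext' fun x y => ?_
    rw [map_sub, LinearMap.sub_apply, LinearMap.zero_apply, sub_eq_zero]
    change B.cls ((B.t (op a) * m) ⊗ₜ n * x ⊗ₜ y) = B.cls (m ⊗ₜ (B.s a * n) * x ⊗ₜ y)
    rw [Algebra.TensorProduct.tmul_mul_tmul, Algebra.TensorProduct.tmul_mul_tmul, mul_assoc,
      mul_assoc]
    exact Bal.mk_bal _ _ a (m * x) (n * y))

@[simp] lemma rmul_cls (X Z : U ⊗[k] U) : B.rmul (B.cls X) Z = B.cls (X * Z) := rfl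

lemma rmul_rmul (q : B.Ten) (Z W : U ⊗[k] U) : B.rmul (B.rmul q Z) W = B.rmul q (Z * W) := by
  obtain ⟨X, rfl⟩ := B.cls_surj q
  simp [mul_assoc]

/-- `U ⊗_A U` as a right `U`-module through its second factor. -/
abbrev tenR : RMod k U where
  carrier := B.Ten
  ract := B.rmul.compl₂
    (Algebra.TensorProduct.includeRight (R := k) (A := U) (B := U)).toLinearMap
  ract_one q := by
    obtain ⟨X, rfl⟩ := B.cls_surj q
    change B.rmul (B.cls X) (1 ⊗ₜ 1) = B.cls X
    rw [rmul_cls, ← Algebra.TensorProduct.one_def, mul_one]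
  ract_mul q u v := by
    change B.rmul q (1 ⊗ₜ (u * v)) = B.rmul (B.rmul q (1 ⊗ₜ u)) (1 ⊗ₜ v)
    simp [rmul_rmul]

lemma tenR_ract (q : B.Ten) (v : U) : B.tenR.ract q v = B.rmul q (1 ⊗ₜ v) := rfl

/-- For a left `A`-module `N`, the relations defining `U ⊗_A U ⊗_A N` as a quotient of
`U ⊗_k U ⊗_k N`. -/
def rel3 {N : Type*} [AddCommGroup N] [Module k N] (l : A → N →ₗ[k] N) :
    Submodule k (U ⊗[k] (U ⊗[k] N)) :=
  Submodule.span k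
    ({z | ∃ a u v n, z = (B.t (op a) * u) ⊗ₜ[k] (v ⊗ₜ[k] n) - u ⊗ₜ[k] ((B.s a * v) ⊗ₜ[k] n)} ∪
     {z | ∃ a u v n, z = u ⊗ₜ[k] ((B.t (op a) * v) ⊗ₜ[k] n) - u ⊗ₜ[k] (v ⊗ₜ[k] l a n)})

/-- A map on `U ⊗_k U ⊗_k N` that respects the relations of `U ⊗_A U ⊗_A N`. -/
lemma rel3_apply_eq {N X : Type*} [AddCommGroup N] [Module k N] [AddCommGroup X] [Module k X]
    {l : A → N →ₗ[k] N} (φ : U ⊗[k] (U ⊗[k] N) →ₗ[k] X)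
    (h1 : ∀ a u v n, φ ((B.t (op a) * u) ⊗ₜ (v ⊗ₜ n)) = φ (u ⊗ₜ ((B.s a * v) ⊗ₜ n)))
    (h2 : ∀ a u v n, φ (u ⊗ₜ ((B.t (op a) * v) ⊗ₜ n)) = φ (u ⊗ₜ (v ⊗ₜ l a n)))
    {z w : U ⊗[k] (U ⊗[k] N)} (h : (B.rel3 l).mkQ z = (B.rel3 l).mkQ w) : φ z = φ w := by
  have hle : B.rel3 l ≤ LinearMap.ker φ := by
    refine Submodule.span_le.2 ?_
    rintro _ (⟨a, u, v, n, rfl⟩ | ⟨a, u, v, n, rfl⟩)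
    · rw [SetLike.mem_coe, LinearMap.mem_ker, map_sub, h1, sub_self]
    · rw [SetLike.mem_coe, LinearMap.mem_ker, map_sub, h2, sub_self]
  have := hle ((Submodule.Quotient.eq _).1 h)
  rwa [LinearMap.mem_ker, map_sub, sub_eq_zero] at this

/-! ### The functor `M ↦ M ⊗_{A^op} U` on right `U`-modules -/

/-- The vector space `M ⊗_{A^op} U`, where `m t(a) ⊗ u = m ⊗ t(a) u`. -/
abbrev IndCarrier (M : RMod k U) : Type u :=
  Bal (k := k) (fun a : A => M.ract.flip (B.t (op a)))
    (fun a : A => LinearMap.mulLeft k (B.t (op a)))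

/-- The right action of `U` on `M ⊗_{A^op} U` through the second factor. -/
def indRact (M : RMod k U) : B.IndCarrier M →ₗ[k] U →ₗ[k] B.IndCarrier M :=
  Bal.lift (LinearMap.mk₂ k (fun m u => Bal.mk _ _ m ∘ₗ LinearMap.mul k U u)
    (by intros; ext; simp) (by intros; ext; simp) (by intros; ext; simp)
    (by intros; ext; simp)) (by
    intro a m u
    ext v
    simpa [mul_assoc] using Bal.mk_bal (k := k) (fun a : A => M.ract.flip (B.t (op a)))
      (fun a : A => LinearMap.mulLeft k (B.t (op a))) a m (u * v))

lemma indRact_mk (M : RMod k U) (m : M.carrier) (u v : U) :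
    B.indRact M (Bal.mk _ _ m u) v = Bal.mk _ _ m (u * v) := by
  rw [indRact, Bal.lift_mk]
  rfl

/-- The right `U`-module `M ⊗_{A^op} U`. -/
def ind (M : RMod k U) : RMod k U where
  carrier := B.IndCarrier M
  ract := B.indRact M
  ract_one p := by
    induction p using Bal.induction with
    | tm m u => rw [indRact_mk, mul_one]
    | add x y hx hy => rw [map_add, LinearMap.add_apply, hx, hy]
  ract_mul p u v := by
    induction p using Bal.induction with
    | tm m w => rw [indRact_mk, indRact_mk, indRact_mk, mul_assoc]
    | add x y hx hy => simp only [map_add, LinearMap.add_apply, hx, hy]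

/-- The elementary tensor `m ⊗_{A^op} u`. -/
def tm (M : RMod k U) : M.carrier →ₗ[k] U →ₗ[k] (B.ind M).carrier := Bal.mk _ _

lemma tm_bal (M : RMod k U) (a : A) (m : M.carrier) (u : U) :
    B.tm M (M.ract m (B.t (op a))) u = B.tm M m (B.t (op a) * u) :=
  Bal.mk_bal (k := k) (fun a : A => M.ract.flip (B.t (op a)))
    (fun a : A => LinearMap.mulLeft k (B.t (op a))) a m u

@[simp] lemma ract_tm (M : RMod k U) (m : M.carrier) (u v : U) :
    (B.ind M).ract (B.tm M m u) v = B.tm M m (u * v) := B.indRact_mk M m u v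

lemma ind_induction {M : RMod k U} {p : (B.ind M).carrier → Prop} (tm : ∀ m u, p (B.tm M m u))
    (add : ∀ x y, p x → p y → p (x + y)) (q : (B.ind M).carrier) : p q := Bal.induction tm add q

/-- The linear map out of `M ⊗_{A^op} U` given by a balanced bilinear map. -/
def indLift {M : RMod k U} {X : Type*} [AddCommGroup X] [Module k X]
    (φ : M.carrier →ₗ[k] U →ₗ[k] X)
    (h : ∀ a m u, φ (M.ract m (B.t (op a))) u = φ m (B.t (op a) * u)) :
    (B.ind M).carrier →ₗ[k] X := Bal.lift φ h

@[simp] lemma indLift_tm {M : RMod k U} {X : Type*} [AddCommGroup X] [Module k X]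
    (φ : M.carrier →ₗ[k] U →ₗ[k] X)
    (h : ∀ a m u, φ (M.ract m (B.t (op a))) u = φ m (B.t (op a) * u)) (m : M.carrier) (u : U) :
    B.indLift φ h (B.tm M m u) = φ m u := Bal.lift_mk φ h m u

/-- A linear map that commutes with the right action of `A^op` through `t`. -/
structure THom (M N : RMod k U) where
  toMap : M.carrier →ₗ[k] N.carrier
  map_t : ∀ m a, toMap (M.ract m (B.t (op a))) = N.ract (toMap m) (B.t (op a))

/-- `f ⊗_{A^op} id`, as a linear map. -/
def THom.mapFun {B : STRing k A U} {M N : RMod k U} (f : B.THom M N) :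
    (B.ind M).carrier →ₗ[k] (B.ind N).carrier :=
  B.indLift (B.tm N ∘ₗ f.toMap) (by
    intro a m u
    simp only [LinearMap.comp_apply, f.map_t, tm_bal])

@[simp] lemma THom.mapFun_tm {B : STRing k A U} {M N : RMod k U} (f : B.THom M N) (m : M.carrier)
    (u : U) : f.mapFun (B.tm M m u) = B.tm N (f.toMap m) u := by
  rw [THom.mapFun, indLift_tm]
  rfl

lemma THom.mapFun_ract {B : STRing k A U} {M N : RMod k U} (f : B.THom M N)
    (q : (B.ind M).carrier) (v : U) :
    f.mapFun ((B.ind M).ract q v) = (B.ind N).ract (f.mapFun q) v := by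
  induction q using B.ind_induction with
  | tm m u => simp
  | add x y hx hy => simp only [map_add, LinearMap.add_apply, hx, hy]

/-- `f ⊗_{A^op} id`. -/
def THom.map {B : STRing k A U} {M N : RMod k U} (f : B.THom M N) :
    B.THom (B.ind M) (B.ind N) where
  toMap := f.mapFun
  map_t q _ := f.mapFun_ract q _

@[simp] lemma THom.map_toMap {B : STRing k A U} {M N : RMod k U} (f : B.THom M N) :
    f.map.toMap = f.mapFun := rfl

/-- The multiplication `M ⊗_{A^op} U → M`, `m ⊗ u ↦ m u`. -/
def mulFun (M : RMod k U) : (B.ind M).carrier →ₗ[k] M.carrier :=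
  B.indLift M.ract (by intro a m u; rw [M.ract_mul])

@[simp] lemma mulFun_tm (M : RMod k U) (m : M.carrier) (u : U) :
    B.mulFun M (B.tm M m u) = M.ract m u := by
  rw [mulFun, indLift_tm]

lemma mulFun_ract (M : RMod k U) (q : (B.ind M).carrier) (v : U) :
    B.mulFun M ((B.ind M).ract q v) = M.ract (B.mulFun M q) v := by
  induction q using B.ind_induction with
  | tm m u => simp [M.ract_mul]
  | add x y hx hy => simp only [map_add, LinearMap.add_apply, hx, hy]

/-- The multiplication `M ⊗_{A^op} U → M`. -/
def mulMap (M : RMod k U) : B.THom (B.ind M) M where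
  toMap := B.mulFun M
  map_t q _ := B.mulFun_ract M q _

@[simp] lemma mulMap_toMap (M : RMod k U) : (B.mulMap M).toMap = B.mulFun M := rfl

/-- The map `M → M ⊗_{A^op} U`, `m ↦ m ⊗ 1`. -/
def unitMap (M : RMod k U) : B.THom M (B.ind M) where
  toMap := (B.tm M).flip 1
  map_t m a := by simp [tm_bal]

@[simp] lemma unitMap_apply (M : RMod k U) (m : M.carrier) :
    (B.unitMap M).toMap m = B.tm M m 1 := rfl

/-- The map `m ⊗ w ↦ m ⊗ s(a) w` on `M ⊗_{A^op} U`. -/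
def lmulS (M : RMod k U) (a : A) : (B.ind M).carrier →ₗ[k] (B.ind M).carrier :=
  B.indLift ((B.tm M).compl₂ (LinearMap.mulLeft k (B.s a))) (by
    intro b m u
    change B.tm M (M.ract m (B.t (op b))) (B.s a * u) = B.tm M m (B.s a * (B.t (op b) * u))
    rw [B.tm_bal, ← mul_assoc, ← B.comm, mul_assoc])

@[simp] lemma lmulS_tm (M : RMod k U) (a : A) (m : M.carrier) (w : U) :
    B.lmulS M a (B.tm M m w) = B.tm M m (B.s a * w) := B.indLift_tm _ _ m w

lemma lmulS_ract (M : RMod k U) (q : (B.ind M).carrier) (a : A) (w : U) :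
    B.lmulS M a ((B.ind M).ract q w) = (B.ind M).ract (B.lmulS M a q) w := by
  induction q using B.ind_induction with
  | tm m u => simp [mul_assoc]
  | add x y hx hy => simp only [map_add, LinearMap.add_apply, hx, hy]

lemma mapFun_lmulS {M N : RMod k U} (f : B.THom M N) (a : A) (q : (B.ind M).carrier) :
    f.mapFun (B.lmulS M a q) = B.lmulS N a (f.mapFun q) := by
  induction q using B.ind_induction with
  | tm m u => simp
  | add x y hx hy => simp only [map_add, hx, hy]

/-- `U` as a right module over itself. -/
abbrev reg (_ : STRing k A U) : RMod k U where
  carrier := U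
  ract := LinearMap.mul k U
  ract_one := by simp
  ract_mul := by simp [mul_assoc]

end STRing

/-! ## Left bialgebroids and Hopf algebroids -/

variable (k A U)

/-- A left bialgebroid.  Identities that involve representatives of elements of a quotient are
required for all representatives (all choices give the same value, and choices exist). -/
structure LeftBialgebroid extends STRing k A U where
  /-- the coproduct `Δ_L` -/
  comul : U →ₗ[k] toSTRing.Ten
  /-- the counit `ε_L` -/
  counit : U →ₗ[k] A
  /-- `Δ_L` is a map of `(A,A)`-bimodules -/
  comul_bimod : ∀ a b u X, toSTRing.cls X = comul u →
    comul (s a * t (op b) * u) = toSTRing.cls ((s a ⊗ₜ[k] t (op b)) * X)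
  /-- `ε_L` is a map of `(A,A)`-bimodules -/
  counit_bimod : ∀ a b u, counit (s a * t (op b) * u) = a * counit u * b
  /-- `(Δ ⊗ id) Δ = (id ⊗ Δ) Δ` in `U ⊗_A U ⊗_A U` -/
  coassoc : ∀ D, IsLift comul D → ∀ u,
    (toSTRing.rel3 fun a => LinearMap.mulLeft k (s a)).mkQ
        (TensorProduct.assoc k U U U (D.rTensor U (D u))) =
      (toSTRing.rel3 fun a => LinearMap.mulLeft k (s a)).mkQ (D.lTensor U (D u))
  /-- `s(ε(u₍₁₎)) u₍₂₎ = u` -/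
  counit_left : ∀ u X, toSTRing.cls X = comul u →
    TensorProduct.lift ((LinearMap.mul k U) ∘ₗ s.toLinearMap ∘ₗ counit) X = u
  /-- `t(ε(u₍₂₎)) u₍₁₎ = u` -/
  counit_right : ∀ u X, toSTRing.cls X = comul u →
    TensorProduct.lift ((LinearMap.mul k U) ∘ₗ t.toLinearMap ∘ₗ
      (MulOpposite.opLinearEquiv k).toLinearMap ∘ₗ counit).flip X = u
  /-- `Δ_L` takes values in the Takeuchi product:
  `u₍₁₎ t(a) ⊗ u₍₂₎ = u₍₁₎ ⊗ u₍₂₎ s(a)` -/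
  takeuchi : ∀ u a, toSTRing.rmul (comul u) (t (op a) ⊗ₜ 1) = toSTRing.rmul (comul u) (1 ⊗ₜ s a)
  comul_one : comul 1 = toSTRing.cls 1
  /-- `Δ_L` is multiplicative: `Δ(u v) = u₍₁₎ v₍₁₎ ⊗ u₍₂₎ v₍₂₎` -/
  comul_mul : ∀ u v X Y, toSTRing.cls X = comul u → toSTRing.cls Y = comul v →
    comul (u * v) = toSTRing.cls (X * Y)
  counit_mul_s : ∀ u v, counit (u * s (counit v)) = counit (u * v)
  counit_mul_t : ∀ u v, counit (u * t (op (counit v))) = counit (u * v)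

/-- A Hopf algebroid with involutive antipode. -/
structure HopfAlgebroid extends LeftBialgebroid k A U where
  /-- the antipode, a `k`-algebra anti-automorphism -/
  S : U →ₗ[k] U
  S_one : S 1 = 1
  S_mul : ∀ u v, S (u * v) = S v * S u
  S_S : ∀ u, S (S u) = u
  S_t : ∀ a, S (t (op a)) = s a
  /-- `S(u₍₁₎)₍₁₎ u₍₂₎ ⊗ S(u₍₁₎)₍₂₎ = 1 ⊗ S(u)` -/
  antipode_left : ∀ u X, toSTRing.cls X = comul u →
    TensorProduct.lift ((toSTRing.rmul ∘ₗ comul ∘ₗ S).compl₂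
      (Algebra.TensorProduct.includeLeft (R := k) (S := k) (A := U) (B := U)).toLinearMap) X =
        toSTRing.cls (1 ⊗ₜ S u)
  /-- `S(u₍₂₎)₍₁₎ ⊗ S(u₍₂₎)₍₂₎ u₍₁₎ = S(u) ⊗ 1` -/
  antipode_right : ∀ u X, toSTRing.cls X = comul u →
    TensorProduct.lift ((toSTRing.rmul ∘ₗ comul ∘ₗ S).compl₂
      (Algebra.TensorProduct.includeRight (R := k) (A := U) (B := U)).toLinearMap).flip X =
        toSTRing.cls (S u ⊗ₜ 1)

variable {k A U}

namespace LeftBialgebroid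

variable (B : LeftBialgebroid k A U)

lemma comul_s (a : A) : B.comul (B.s a) = B.cls (B.s a ⊗ₜ 1) := by
  have := B.comul_bimod a 1 1 1 B.comul_one.symm
  simpa using this

lemma comul_t (a : A) : B.comul (B.t (op a)) = B.cls (1 ⊗ₜ B.t (op a)) := by
  have := B.comul_bimod 1 a 1 1 B.comul_one.symm
  simpa using this

/-- `(v, w) ↦ u₍₁₎ v ⊗ u₍₂₎ w` on `U ⊗_A U`. -/
def comulL (u : U) : B.Ten →ₗ[k] B.Ten :=
  Submodule.liftQ _ (B.rmul (B.comul u)) (by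
    refine Submodule.span_le.2 ?_
    rintro _ ⟨a, m, n, rfl⟩
    rw [SetLike.mem_coe, LinearMap.mem_ker, map_sub, sub_eq_zero]
    have h1 : (B.t (op a) * m) ⊗ₜ[k] n = (B.t (op a) ⊗ₜ 1) * (m ⊗ₜ n) := by simp
    have h2 : m ⊗ₜ[k] (B.s a * n) = (1 ⊗ₜ B.s a) * (m ⊗ₜ n) := by simp
    change B.rmul (B.comul u) ((B.t (op a) * m) ⊗ₜ n) = B.rmul (B.comul u) (m ⊗ₜ (B.s a * n))
    rw [h1, h2, ← B.rmul_rmul, B.takeuchi, B.rmul_rmul])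

lemma comulL_cls (u : U) (Z : U ⊗[k] U) : B.comulL u (B.cls Z) = B.rmul (B.comul u) Z := rfl

lemma comulL_rmul (u : U) (q : B.Ten) (Z : U ⊗[k] U) :
    B.comulL u (B.rmul q Z) = B.rmul (B.comulL u q) Z := by
  obtain ⟨X, rfl⟩ := B.cls_surj q
  rw [B.rmul_cls, comulL_cls, comulL_cls, B.rmul_rmul]

lemma comul_mul' (u v : U) : B.comul (u * v) = B.comulL u (B.comul v) := by
  obtain ⟨X, hX⟩ := B.cls_surj (B.comul u)
  obtain ⟨Y, hY⟩ := B.cls_surj (B.comul v)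
  rw [B.comul_mul u v X Y hX hY, ← hY, comulL_cls, ← hX, B.rmul_cls]

lemma comul_mul_t (u : U) (a : A) :
    B.comul (u * B.t (op a)) = B.rmul (B.comul u) (1 ⊗ₜ B.t (op a)) := by
  rw [comul_mul', comul_t, comulL_cls]

lemma comul_mul_s (u : U) (a : A) :
    B.comul (u * B.s a) = B.rmul (B.comul u) (B.s a ⊗ₜ 1) := by
  rw [comul_mul', comul_s, comulL_cls]

/-- Left multiplication by `1 ⊗ t(a)` on `U ⊗_A U`. -/
def lmulT (a : A) : B.Ten →ₗ[k] B.Ten := B.comulL (B.t (op a))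

@[simp] lemma lmulT_cls (a : A) (X : U ⊗[k] U) :
    B.lmulT a (B.cls X) = B.cls ((1 ⊗ₜ B.t (op a)) * X) := by
  rw [lmulT, comulL_cls, comul_t, B.rmul_cls]

lemma comul_t_mul (a : A) (u : U) : B.comul (B.t (op a) * u) = B.lmulT a (B.comul u) :=
  B.comul_mul' _ _

/-- `x ⊗ y ↦ s(ε(x)) y` -/
def tenEpsL : B.Ten →ₗ[k] U :=
  B.tenLift ((LinearMap.mul k U) ∘ₗ B.s.toLinearMap ∘ₗ B.counit) (by
    intro a u v
    have := B.counit_bimod 1 a u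
    simp only [map_one, one_mul] at this
    simp [this, mul_assoc])

lemma tenEpsL_comul (u : U) : B.tenEpsL (B.comul u) = u := by
  obtain ⟨X, hX⟩ := B.cls_surj (B.comul u)
  rw [← hX]
  exact B.counit_left u X hX

lemma tenEpsL_rmul (q : B.Ten) (v : U) :
    B.tenEpsL (B.rmul q (1 ⊗ₜ v)) = B.tenEpsL q * v := by
  induction q using B.ten_induction with
  | tm x y => simp [tenEpsL, B.tenLift_cls, mul_assoc]
  | add x y hx hy => simp only [map_add, LinearMap.add_apply, hx, hy, add_mul]

/-- `x ⊗ y ↦ t(ε(y)) x` -/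
def tenEpsR : B.Ten →ₗ[k] U :=
  B.tenLift ((LinearMap.mul k U) ∘ₗ B.t.toLinearMap ∘ₗ
      (MulOpposite.opLinearEquiv k).toLinearMap ∘ₗ B.counit).flip (by
    intro a u v
    have := B.counit_bimod a 1 v
    simp only [MulOpposite.op_one, map_one, mul_one] at this
    simp [this, mul_assoc])

lemma tenEpsR_cls (x y : U) : B.tenEpsR (B.cls (x ⊗ₜ y)) = B.t (op (B.counit y)) * x := rfl

lemma tenEpsR_comul (u : U) : B.tenEpsR (B.comul u) = u := by
  obtain ⟨X, hX⟩ := B.cls_surj (B.comul u)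
  rw [← hX]
  exact B.counit_right u X hX

lemma tenEpsR_rmul_left (q : B.Ten) (v : U) :
    B.tenEpsR (B.rmul q (v ⊗ₜ 1)) = B.tenEpsR q * v := by
  induction q using B.ten_induction with
  | tm x y => simp [tenEpsR_cls, mul_assoc]
  | add x y hx hy => simp only [map_add, LinearMap.add_apply, hx, hy, add_mul]

lemma tenEpsR_rmul_right (q : B.Ten) (v : U) :
    B.tenEpsR (B.rmul q (1 ⊗ₜ v)) = B.tenEpsR (B.rmul q (1 ⊗ₜ B.t (op (B.counit v)))) := by
  induction q using B.ten_induction with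
  | tm x y => simp [tenEpsR_cls, B.counit_mul_t]
  | add x y hx hy => simp only [map_add, LinearMap.add_apply, hx, hy]

lemma t_counit_one : B.t (op (B.counit 1)) = 1 := by
  have h := B.tenEpsR_comul 1
  rw [B.comul_one, Algebra.TensorProduct.one_def, tenEpsR_cls, mul_one] at h
  exact h

/-! ### The Hopf-Galois map -/

/-- The tensor product `U ⊗_{A^op} U`, where `u t(a) ⊗ v = u ⊗ t(a) v`. -/
abbrev HG : Type u := (B.ind B.reg).carrier

/-- The elementary tensor `u ⊗_{A^op} v`. -/
def hg : U →ₗ[k] U →ₗ[k] B.HG := B.tm B.reg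

/-- Right multiplication on the second factor of `U ⊗_{A^op} U`. -/
abbrev hgR : B.HG →ₗ[k] U →ₗ[k] B.HG := (B.ind B.reg).ract

@[simp] lemma hgR_hg (u v w : U) : B.hgR (B.hg u v) w = B.hg u (v * w) := B.ract_tm B.reg u v w

lemma hg_induction {p : B.HG → Prop} (tm : ∀ u v : U, p (B.hg u v))
    (add : ∀ x y, p x → p y → p (x + y)) (h : B.HG) : p h := B.ind_induction tm add h

@[simp] lemma mapFun_hg {M : RMod k U} (f : B.THom B.reg M) (u v : U) :
    f.mapFun (B.hg u v) = B.tm M (f.toMap u) v := f.mapFun_tm (B := B.toSTRing) u v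

lemma hg_bal (a : A) (u v : U) : B.hg (u * B.t (op a)) v = B.hg u (B.t (op a) * v) :=
  B.tm_bal B.reg a u v

/-- The Hopf-Galois map `β : U ⊗_{A^op} U → U ⊗_A U`, `u ⊗ v ↦ u₍₁₎ ⊗ u₍₂₎ v`. -/
def galois : B.HG →ₗ[k] B.Ten :=
  B.indLift (M := B.reg) (B.tenR.ract ∘ₗ B.comul) (by
    intro a u v
    change B.rmul (B.comul (u * B.t (op a))) (1 ⊗ₜ v) =
      B.rmul (B.comul u) (1 ⊗ₜ (B.t (op a) * v))
    rw [comul_mul_t, B.rmul_rmul]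
    simp)

lemma galois_hg (u v : U) : B.galois (B.hg u v) = B.rmul (B.comul u) (1 ⊗ₜ v) :=
  B.indLift_tm (M := B.reg) _ _ u v

lemma galois_hgR (h : B.HG) (v : U) : B.galois (B.hgR h v) = B.rmul (B.galois h) (1 ⊗ₜ v) := by
  induction h using B.hg_induction with
  | tm x y =>
    rw [hgR_hg, galois_hg, galois_hg, B.rmul_rmul]
    simp
  | add x y hx hy => simp only [map_add, LinearMap.add_apply, hx, hy]

/-- `u ↦ t(a) u` -/
def tHom (a : A) : B.THom B.reg B.reg where
  toMap := LinearMap.mulLeft k (B.t (op a))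
  map_t _ _ := (mul_assoc _ _ _).symm

/-- `u ↦ s(a) u` -/
def sHom (a : A) : B.THom B.reg B.reg where
  toMap := LinearMap.mulLeft k (B.s a)
  map_t _ _ := (mul_assoc _ _ _).symm

/-- `u ↦ m u`, as a map `U → M` -/
def actHom (M : RMod k U) (m : M.carrier) : B.THom B.reg M where
  toMap := M.ract m
  map_t u _ := M.ract_mul m u _

/-- `u ↦ m ⊗ u`, as a map `U → M ⊗_{A^op} U` -/
def tmHom (M : RMod k U) (m : M.carrier) : B.THom B.reg (B.ind M) where
  toMap := B.tm M m
  map_t u _ := (B.ract_tm M m u _).symm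

end LeftBialgebroid

namespace HopfAlgebroid

variable (H : HopfAlgebroid k A U)

lemma S_s (a : A) : H.S (H.s a) = H.t (op a) := by rw [← H.S_t, H.S_S]

/-- `x ⊗_A y ↦ S(y) ⊗_{A^op} x`. -/
def twist : H.Ten →ₗ[k] H.HG :=
  H.tenLift (H.hg ∘ₗ H.S).flip (by
    intro a u v
    change H.hg (H.S v) (H.t (op a) * u) = H.hg (H.S (H.s a * v)) u
    rw [H.S_mul, H.S_s]
    exact (H.hg_bal a _ _).symm)

lemma twist_cls (x y : U) : H.twist (H.cls (x ⊗ₜ y)) = H.hg (H.S y) x := rfl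

lemma twist_rmul (q : H.Ten) (v : U) : H.twist (H.rmul q (v ⊗ₜ 1)) = H.hgR (H.twist q) v := by
  induction q using H.ten_induction with
  | tm x y => simp [twist_cls]
  | add x y hx hy => simp only [map_add, LinearMap.add_apply, hx, hy]

/-- The inverse of the Hopf-Galois map. -/
def galoisInv : H.Ten →ₗ[k] H.HG :=
  H.tenLift (H.hgR ∘ₗ H.twist ∘ₗ H.comul ∘ₗ H.S) (by
    intro a u v
    change H.hgR (H.twist (H.comul (H.S (H.t (op a) * u)))) v =
      H.hgR (H.twist (H.comul (H.S u))) (H.s a * v)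
    rw [H.S_mul, H.S_t, H.comul_mul_s, twist_rmul, RMod.ract_mul])

lemma galoisInv_cls (x y : U) :
    H.galoisInv (H.cls (x ⊗ₜ y)) = H.hgR (H.twist (H.comul (H.S x))) y := rfl

lemma galois_twist (u : U) : H.galois (H.twist (H.comul (H.S u))) = H.cls (u ⊗ₜ 1) := by
  obtain ⟨X, hX⟩ := H.cls_surj (H.comul (H.S u))
  have h := H.antipode_right (H.S u) X hX
  rw [H.S_S] at h
  rw [← h, ← hX]
  change (H.galois ∘ₗ H.twist ∘ₗ H.cls) X = _
  congr 1
  refine TensorProduct.ext' fun x y => ?_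
  change H.galois (H.hg (H.S y) x) = _
  rw [H.galois_hg]
  rfl

lemma galoisInv_rmul (q : H.Ten) (v : U) :
    H.galoisInv (H.rmul q (1 ⊗ₜ v)) = H.hgR (H.galoisInv q) v := by
  induction q using H.ten_induction with
  | tm x y =>
    rw [H.rmul_cls, Algebra.TensorProduct.tmul_mul_tmul, galoisInv_cls, galoisInv_cls, mul_one,
      RMod.ract_mul]
  | add x y hx hy => simp only [map_add, LinearMap.add_apply, hx, hy]

lemma galoisInv_comul (u : U) : H.galoisInv (H.comul u) = H.hg u 1 := by
  obtain ⟨X, hX⟩ := H.cls_surj (H.comul u)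
  have h := congrArg H.twist (H.antipode_left u X hX)
  rw [twist_cls, H.S_S] at h
  rw [← h, ← hX]
  change (H.galoisInv ∘ₗ H.cls) X = (H.twist ∘ₗ _) X
  congr 1
  refine TensorProduct.ext' fun x y => ?_
  change H.galoisInv (H.cls (x ⊗ₜ y)) = H.twist (H.rmul (H.comul (H.S x)) (y ⊗ₜ 1))
  rw [galoisInv_cls, twist_rmul]

lemma galoisInv_galois (h : H.HG) : H.galoisInv (H.galois h) = h := by
  induction h using H.hg_induction with
  | tm x y =>
    rw [H.galois_hg, galoisInv_rmul, galoisInv_comul, H.hgR_hg, one_mul]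
  | add x y hx hy => simp only [map_add, hx, hy]

lemma galois_galoisInv (q : H.Ten) : H.galois (H.galoisInv q) = q := by
  induction q using H.ten_induction with
  | tm x y =>
    rw [galoisInv_cls, H.galois_hgR, galois_twist]
    simp
  | add x y hx hy => simp only [map_add, hx, hy]

lemma galois_bijective : Function.Bijective H.galois :=
  ⟨Function.LeftInverse.injective H.galoisInv_galois,
    Function.RightInverse.surjective H.galois_galoisInv⟩

/-- The translation map `u ↦ u₊ ⊗_{A^op} u₋ = β⁻¹(u ⊗_A 1)`. -/
noncomputable def trans : U →ₗ[k] H.HG :=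
  (LinearEquiv.ofBijective H.galois H.galois_bijective).symm.toLinearMap ∘ₗ H.cls ∘ₗ
    (Algebra.TensorProduct.includeLeft (R := k) (S := k) (A := U) (B := U)).toLinearMap

lemma galois_trans (u : U) : H.galois (H.trans u) = H.cls (u ⊗ₜ 1) :=
  (LinearEquiv.ofBijective H.galois H.galois_bijective).apply_symm_apply _

lemma galois_trans_ract (u v : U) : H.galois (H.hgR (H.trans u) v) = H.cls (u ⊗ₜ v) := by
  rw [H.galois_hgR, galois_trans]
  simp

/-! ### Identities for the translation map -/

/-- `t(a) u₊ ⊗ u₋ = u₊ ⊗ u₋ t(a)` -/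
lemma trans_takeuchi (a : A) (u : U) :
    (H.tHom a).mapFun (H.trans u) = H.hgR (H.trans u) (H.t (op a)) := by
  apply H.galois_bijective.1
  have key : ∀ h, H.galois ((H.tHom a).mapFun h) = H.lmulT a (H.galois h) := by
    intro h
    induction h using H.hg_induction with
    | tm x y =>
      rw [H.mapFun_hg]
      change H.galois (H.hg (H.t (op a) * x) y) = H.lmulT a (H.galois (H.hg x y))
      rw [H.galois_hg, H.galois_hg, H.comul_t_mul, LeftBialgebroid.lmulT, H.comulL_rmul]
    | add x y hx hy => simp only [map_add, hx, hy]
  rw [key, galois_trans_ract, galois_trans]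
  simp

/-- `(t(a) u)₊ ⊗ (t(a) u)₋ = u₊ ⊗ u₋ s(a)` -/
lemma trans_t_mul (a : A) (u : U) :
    H.trans (H.t (op a) * u) = H.hgR (H.trans u) (H.s a) := by
  apply H.galois_bijective.1
  rw [galois_trans_ract, galois_trans, H.cls_bal, mul_one]

/-- `(u v)₊ ⊗ (u v)₋ = u₊ v₊ ⊗ v₋ u₋` for `v = t(a)`: `u₊ ⊗ s(a) u₋` -/
lemma trans_mul_t (a : A) (u : U) :
    H.trans (u * H.t (op a)) = H.lmulS H.reg a (H.trans u) := by
  apply H.galois_bijective.1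
  have key : ∀ h, H.galois (H.lmulS H.reg a h) = H.rmul (H.galois h) (H.t (op a) ⊗ₜ 1) := by
    intro h
    induction h using H.hg_induction with
    | tm x y =>
      change H.galois (H.hg x (H.s a * y)) = H.rmul (H.galois (H.hg x y)) (H.t (op a) ⊗ₜ 1)
      have h1 : (1 : U) ⊗ₜ[k] (H.s a * y) = (1 ⊗ₜ H.s a) * (1 ⊗ₜ y) := by simp
      rw [H.galois_hg, H.galois_hg, h1, ← H.rmul_rmul, ← H.takeuchi, H.rmul_rmul, H.rmul_rmul]
      simp
    | add x y hx hy => simp only [map_add, LinearMap.add_apply, hx, hy]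
  rw [key, galois_trans, galois_trans]
  simp

/-- `(s(a) u)₊ ⊗ (s(a) u)₋ = s(a) u₊ ⊗ u₋` -/
lemma trans_s_mul (a : A) (u : U) :
    H.trans (H.s a * u) = (H.sHom a).mapFun (H.trans u) := by
  apply H.galois_bijective.1
  have key : ∀ h, H.galois ((H.sHom a).mapFun h) = H.comulL (H.s a) (H.galois h) := by
    intro h
    induction h using H.hg_induction with
    | tm x y =>
      rw [H.mapFun_hg]
      change H.galois (H.hg (H.s a * x) y) = H.comulL (H.s a) (H.galois (H.hg x y))
      rw [H.galois_hg, H.galois_hg, H.comul_mul', H.comulL_rmul]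
    | add x y hx hy => simp only [map_add, hx, hy]
  rw [key, galois_trans, galois_trans, H.comulL_cls, H.comul_s]
  simp

lemma trans_one : H.trans 1 = H.hg 1 1 := by
  apply H.galois_bijective.1
  rw [galois_trans, H.galois_hg, H.comul_one, H.rmul_cls, one_mul]

lemma trans_s (a : A) : H.trans (H.s a) = H.hg (H.s a) 1 := by
  have := H.trans_s_mul a 1
  rw [mul_one, trans_one, H.mapFun_hg] at this
  rw [this]
  exact congrArg (fun x => H.hg x 1) (mul_one (H.s a))

/-- `u₊ u₋ = s(ε(u))` -/
lemma mulFun_trans (u : U) : H.mulFun H.reg (H.trans u) = H.s (H.counit u) := by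
  have key : ∀ h, H.mulFun H.reg h = H.tenEpsL (H.galois h) := by
    intro h
    induction h using H.hg_induction with
    | tm x y =>
      rw [H.galois_hg, H.tenEpsL_rmul, H.tenEpsL_comul]
      exact H.mulFun_tm H.reg x y
    | add x y hx hy =>
      rw [map_add, map_add, map_add, hx, hy]
  rw [key, galois_trans]
  exact mul_one _

end HopfAlgebroid
namespace STRing.THom

variable {B : STRing k A U} {L M N : RMod k U}

@[simp] lemma mapFun_mapFun_unit (f : B.THom M N) (m : M.carrier) :
    f.mapFun ((B.unitMap M).toMap m) = (B.unitMap N).toMap (f.toMap m) := by simp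

/-- Naturality of the multiplication for `U`-linear maps. -/
lemma mulFun_mapFun (f : B.THom M N) (hf : ∀ m u, f.toMap (M.ract m u) = N.ract (f.toMap m) u)
    (q : (B.ind M).carrier) : B.mulFun N (f.mapFun q) = f.toMap (B.mulFun M q) := by
  induction q using B.ind_induction with
  | tm m u => simp [hf]
  | add x y hx hy => simp only [map_add, hx, hy]

lemma mapFun_comp (f : B.THom M N) (g : B.THom L M) (e : B.THom L N)
    (h : ∀ x, f.toMap (g.toMap x) = e.toMap x) (q : (B.ind L).carrier) :
    f.mapFun (g.mapFun q) = e.mapFun q := by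
  induction q using B.ind_induction with
  | tm m u => simp [h]
  | add x y hx hy => simp only [map_add, hx, hy]

end STRing.THom

namespace HopfAlgebroid

variable (H : HopfAlgebroid k A U)

/-- `(x ⊗ y, m) ↦ m ⊗ x ⊗ y`. -/
def insHG (M : RMod k U) : H.HG →ₗ[k] M.carrier →ₗ[k] (H.ind (H.ind M)).carrier :=
  H.indLift (M := H.reg) (LinearMap.mk₂ k (fun x y => (H.tm (H.ind M)).flip y ∘ₗ (H.tm M).flip x)
    (by intros; ext; simp) (by intros; ext; simp) (by intros; ext; simp)
    (by intros; ext; simp)) (by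
    intro a x y
    ext m
    change H.tm (H.ind M) (H.tm M m (x * H.t (op a))) y =
      H.tm (H.ind M) (H.tm M m x) (H.t (op a) * y)
    rw [← H.tm_bal, H.ract_tm])

lemma insHG_eq (M : RMod k U) (h : H.HG) (m : M.carrier) :
    H.insHG M h m = (H.tmHom M m).mapFun h := by
  induction h using H.hg_induction with
  | tm x y =>
    rw [H.mapFun_hg]
    change H.insHG M (H.tm H.reg x y) m = _
    rw [insHG, H.indLift_tm]
    rfl
  | add x y hx hy => simp only [map_add, LinearMap.add_apply, hx, hy]

lemma insHG_t (M : RMod k U) (h : H.HG) (a : A) (m : M.carrier) :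
    H.insHG M h (M.ract m (H.t (op a))) = H.insHG M ((H.tHom a).mapFun h) m := by
  rw [insHG_eq, insHG_eq]
  symm
  apply STRing.THom.mapFun_comp
  intro x
  exact (H.tm_bal M a m x).symm

/-- `(m ⊗ w, u) ↦ m ⊗ u₊ ⊗ u₋ w`. -/
noncomputable def step (M : RMod k U) :
    (H.ind M).carrier →ₗ[k] U →ₗ[k] (H.ind (H.ind M)).carrier :=
  H.indLift (LinearMap.mk₂ k
    (fun m w => (H.ind (H.ind M)).ract.flip w ∘ₗ (H.insHG M).flip m ∘ₗ H.trans)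
    (by intros; ext; simp) (by intros; ext; simp) (by intros; ext; simp)
    (by intros; ext; simp)) (by
    intro a m w
    ext u
    change (H.ind (H.ind M)).ract (H.insHG M (H.trans u) (M.ract m (H.t (op a)))) w =
      (H.ind (H.ind M)).ract (H.insHG M (H.trans u) m) (H.t (op a) * w)
    rw [H.insHG_t, H.trans_takeuchi, insHG_eq, insHG_eq, STRing.THom.mapFun_ract,
      RMod.ract_mul])

lemma step_tm (M : RMod k U) (m : M.carrier) (w u : U) :
    H.step M (H.tm M m w) u =
      (H.ind (H.ind M)).ract ((H.tmHom M m).mapFun (H.trans u)) w := by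
  rw [step, H.indLift_tm, ← insHG_eq]
  rfl

lemma step_ract (M : RMod k U) (q : (H.ind M).carrier) (u v : U) :
    H.step M ((H.ind M).ract q v) u = (H.ind (H.ind M)).ract (H.step M q u) v := by
  induction q using H.ind_induction with
  | tm m w => rw [H.ract_tm, step_tm, step_tm, RMod.ract_mul]
  | add x y hx hy => simp only [map_add, LinearMap.add_apply, hx, hy]

lemma step_lmulS (M : RMod k U) (q : (H.ind M).carrier) (a : A) (u : U) :
    H.step M (H.lmulS M a q) u = H.step M q (H.t (op a) * u) := by
  induction q using H.ind_induction with
  | tm m w =>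
    rw [H.lmulS_tm, step_tm, step_tm, H.trans_t_mul, STRing.THom.mapFun_ract, RMod.ract_mul]
  | add x y hx hy => simp only [map_add, LinearMap.add_apply, hx, hy]

lemma step_mul_t (M : RMod k U) (q : (H.ind M).carrier) (a : A) (u : U) :
    H.step M q (u * H.t (op a)) = H.lmulS (H.ind M) a (H.step M q u) := by
  induction q using H.ind_induction with
  | tm m w =>
    rw [step_tm, step_tm, H.trans_mul_t, H.mapFun_lmulS, H.lmulS_ract]
  | add x y hx hy => simp only [map_add, LinearMap.add_apply, hx, hy]

/-- Naturality of `step`. -/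
lemma step_mapFun {M N : RMod k U} (f : H.THom M N) (q : (H.ind M).carrier) (u : U) :
    H.step N (f.mapFun q) u = f.map.mapFun (H.step M q u) := by
  induction q using H.ind_induction with
  | tm m w =>
    rw [STRing.THom.mapFun_tm, step_tm, step_tm, STRing.THom.mapFun_ract]
    congr 2
    symm
    apply STRing.THom.mapFun_comp
    intro x
    exact f.mapFun_tm m x
  | add x y hx hy => simp only [map_add, LinearMap.add_apply, hx, hy]

/-- `m ⊗ w ↦ m u₊ ⊗ u₋ w` -/
noncomputable def rot (M : RMod k U) (u : U) : (H.ind M).carrier →ₗ[k] (H.ind M).carrier :=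
  (H.mulMap M).mapFun ∘ₗ (H.step M).flip u

lemma rot_apply (M : RMod k U) (u : U) (q : (H.ind M).carrier) :
    H.rot M u q = (H.mulMap M).mapFun (H.step M q u) := rfl

lemma rot_tm (M : RMod k U) (m : M.carrier) (w u : U) :
    H.rot M u (H.tm M m w) = (H.ind M).ract ((H.actHom M m).mapFun (H.trans u)) w := by
  rw [rot_apply, step_tm, STRing.THom.mapFun_ract]
  congr 2
  apply STRing.THom.mapFun_comp
  intro x
  exact H.mulFun_tm M m x

lemma rot_ract (M : RMod k U) (u v : U) (q : (H.ind M).carrier) :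
    H.rot M u ((H.ind M).ract q v) = (H.ind M).ract (H.rot M u q) v := by
  rw [rot_apply, rot_apply, step_ract, STRing.THom.mapFun_ract]

lemma rot_mapFun {M N : RMod k U} (f : H.THom M N)
    (hf : ∀ m u, f.toMap (M.ract m u) = N.ract (f.toMap m) u) (u : U) (q : (H.ind M).carrier) :
    H.rot N u (f.mapFun q) = f.mapFun (H.rot M u q) := by
  induction q using H.ind_induction with
  | tm m w =>
    rw [STRing.THom.mapFun_tm, rot_tm, rot_tm, STRing.THom.mapFun_ract]
    congr 2
    symm
    apply STRing.THom.mapFun_comp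
    intro x
    exact hf m x
  | add x y hx hy => simp only [map_add, hx, hy]

/-- `(u v)₊ ⊗ (u v)₋ = u₊ v₊ ⊗ v₋ u₋` -/
lemma trans_mul (u v : U) : H.trans (u * v) = H.rot H.reg v (H.trans u) := by
  apply H.galois_bijective.1
  have key1 : ∀ (x : U) (h : H.HG),
      H.galois ((H.actHom H.reg x).mapFun h) = H.comulL x (H.galois h) := by
    intro x h
    induction h using H.hg_induction with
    | tm a b =>
      rw [H.mapFun_hg]
      change H.galois (H.hg (x * a) b) = _
      rw [H.galois_hg, H.galois_hg, H.comul_mul', H.comulL_rmul]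
    | add a b ha hb => simp only [map_add, ha, hb]
  have key : ∀ h, H.galois (H.rot H.reg v h) = H.rmul (H.galois h) (v ⊗ₜ 1) := by
    intro h
    induction h using H.hg_induction with
    | tm x y =>
      change H.galois (H.rot H.reg v (H.tm H.reg x y)) = _
      rw [rot_tm, H.galois_hgR, key1, galois_trans, H.comulL_cls, H.galois_hg, H.rmul_rmul,
        H.rmul_rmul]
      simp
    | add a b ha hb => simp only [map_add, LinearMap.add_apply, ha, hb]
  rw [key, galois_trans, galois_trans]
  simp

lemma rot_mul (M : RMod k U) (u v : U) (q : (H.ind M).carrier) :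
    H.rot M (u * v) q = H.rot M v (H.rot M u q) := by
  induction q using H.ind_induction with
  | tm m w =>
    rw [rot_tm, rot_tm, rot_ract, trans_mul, rot_mapFun]
    intro x y
    exact M.ract_mul m x y
  | add x y hx hy => simp only [map_add, hx, hy]

lemma rot_one (M : RMod k U) (q : (H.ind M).carrier) : H.rot M 1 q = q := by
  induction q using H.ind_induction with
  | tm m w =>
    rw [rot_tm, trans_one, H.mapFun_hg, H.ract_tm, one_mul]
    congr 2
    exact M.ract_one m
  | add x y hx hy => simp only [map_add, hx, hy]

lemma rot_s (M : RMod k U) (a : A) (m : M.carrier) (w : U) :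
    H.rot M (H.s a) (H.tm M m w) = H.tm M (M.ract m (H.s a)) w := by
  rw [rot_tm, trans_s, H.mapFun_hg, H.ract_tm, one_mul]
  rfl

/-- `m ⊗ (v u)₊ ⊗ (v u)₋ w`, computed from `m ⊗ v₊ ⊗ v₋ w`. -/
lemma step_mul (M : RMod k U) (q : (H.ind M).carrier) (v u : U) :
    H.step M q (v * u) = H.rot (H.ind M) u (H.step M q v) := by
  induction q using H.ind_induction with
  | tm m w =>
    rw [step_tm, step_tm, rot_ract, trans_mul, rot_mapFun]
    intro x y
    exact (H.ract_tm M m x y).symm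
  | add x y hx hy => simp only [map_add, LinearMap.add_apply, hx, hy]

lemma step_one (M : RMod k U) (q : (H.ind M).carrier) :
    H.step M q 1 = (H.unitMap M).mapFun q := by
  induction q using H.ind_induction with
  | tm m w =>
    rw [step_tm, trans_one, H.mapFun_hg, H.ract_tm, one_mul, STRing.THom.mapFun_tm]
    rfl
  | add x y hx hy => simp only [map_add, LinearMap.add_apply, hx, hy]

lemma mulFun_step (M : RMod k U) (q : (H.ind M).carrier) (u : U) :
    H.mulFun (H.ind M) (H.step M q u) = H.lmulS M (H.counit u) q := by
  induction q using H.ind_induction with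
  | tm m w =>
    rw [step_tm, H.mulFun_ract, STRing.THom.mulFun_mapFun, mulFun_trans]
    · change (H.ind M).ract (H.tm M m (H.s (H.counit u))) w = _
      rw [H.ract_tm, H.lmulS_tm]
    · intro x y
      exact (H.ract_tm M m x y).symm
  | add x y hx hy => simp only [map_add, LinearMap.add_apply, hx, hy]

end HopfAlgebroid

/-- The map `M ⊗_{A^op} U → M`, `m ⊗ u ↦ m t(ε(u))`. -/
def LeftBialgebroid.epsFun (B : LeftBialgebroid k A U) (M : RMod k U) :
    (B.ind M).carrier →ₗ[k] M.carrier :=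
  B.indLift (M.ract.compl₂ (B.t.toLinearMap ∘ₗ (MulOpposite.opLinearEquiv k).toLinearMap ∘ₗ
    B.counit)) (by
    intro a m u
    have := B.counit_bimod 1 a u
    simp only [map_one, one_mul] at this
    change M.ract (M.ract m (B.t (op a))) (B.t (op (B.counit u))) =
      M.ract m (B.t (op (B.counit (B.t (op a) * u))))
    rw [this, MulOpposite.op_mul, map_mul, M.ract_mul])

@[simp] lemma LeftBialgebroid.epsFun_tm (B : LeftBialgebroid k A U) (M : RMod k U)
    (m : M.carrier) (u : U) :
    B.epsFun M (B.tm M m u) = M.ract m (B.t (op (B.counit u))) := B.indLift_tm _ _ m u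

lemma LeftBialgebroid.epsFun_mapFun (B : LeftBialgebroid k A U) {M N : RMod k U}
    (f : B.THom M N) (q : (B.ind M).carrier) :
    B.epsFun N (f.mapFun q) = f.toMap (B.epsFun M q) := by
  induction q using B.ind_induction with
  | tm m u => simp [f.map_t]
  | add x y hx hy => simp only [map_add, hx, hy]

namespace HopfAlgebroid

variable (H : HopfAlgebroid k A U)

/-- `u₊ t(ε(u₋ w)) = t(ε(w)) u` -/
lemma epsFun_trans (u w : U) :
    H.epsFun H.reg (H.hgR (H.trans u) w) = H.t (op (H.counit w)) * u := by
  have key : ∀ h, H.epsFun H.reg h = H.tenEpsR (H.galois h) := by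
    intro h
    induction h using H.hg_induction with
    | tm x y =>
      rw [H.galois_hg, H.tenEpsR_rmul_right, ← H.comul_mul_t, H.tenEpsR_comul]
      exact H.epsFun_tm H.reg x y
    | add x y hx hy => rw [map_add, map_add, map_add, hx, hy]
  rw [key, galois_trans_ract]
  rfl

lemma epsFun_step (M : RMod k U) (q : (H.ind M).carrier) (u : U) :
    H.epsFun (H.ind M) (H.step M q u) = H.tm M (H.epsFun M q) u := by
  induction q using H.ind_induction with
  | tm m w =>
    rw [step_tm, ← STRing.THom.mapFun_ract, H.epsFun_mapFun, epsFun_trans, H.epsFun_tm,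
      H.tm_bal]
    rfl
  | add x y hx hy => simp only [map_add, LinearMap.add_apply, hx, hy]

/-! ### Coassociativity and the translation map -/

/-- `y ↦ x ⊗_A y`, as a map `U → U ⊗_A U`. -/
def tenHom (x : U) : H.THom H.reg H.tenR where
  toMap := H.cls ∘ₗ TensorProduct.mk k U U x
  map_t u a := by
    change H.cls (x ⊗ₜ (u * H.t (op a))) = H.rmul (H.cls (x ⊗ₜ u)) (1 ⊗ₜ H.t (op a))
    simp

/-- `Δ`, as a map `U → U ⊗_A U`. -/
def comulHom : H.THom H.reg H.tenR where
  toMap := H.comul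
  map_t u a := H.comul_mul_t u a

/-- `x ⊗ h ↦ x ⊗ h`, `U × (U ⊗_{A^op} U) → (U ⊗_A U) ⊗_{A^op} U`. -/
def insTen : U →ₗ[k] H.HG →ₗ[k] (H.ind H.tenR).carrier :=
  LinearMap.mk₂ k (fun x h => (H.tenHom x).mapFun h)
    (by
      intro x y h
      induction h using H.hg_induction with
      | tm u v =>
        rw [H.mapFun_hg, H.mapFun_hg, H.mapFun_hg]
        change H.tm H.tenR (H.cls ((x + y) ⊗ₜ u)) v =
          H.tm H.tenR (H.cls (x ⊗ₜ u)) v + H.tm H.tenR (H.cls (y ⊗ₜ u)) v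
        rw [TensorProduct.add_tmul, map_add, map_add, LinearMap.add_apply]
      | add a b ha hb => rw [map_add, map_add, map_add, ha, hb]; abel)
    (by
      intro c x h
      induction h using H.hg_induction with
      | tm u v =>
        rw [H.mapFun_hg, H.mapFun_hg]
        change H.tm H.tenR (H.cls ((c • x) ⊗ₜ u)) v = c • H.tm H.tenR (H.cls (x ⊗ₜ u)) v
        rw [← TensorProduct.smul_tmul', map_smul, map_smul, LinearMap.smul_apply]
      | add a b ha hb => rw [map_add, map_add, ha, hb, smul_add])
    (by intros; simp) (by intros; simp)

lemma insTen_apply (x : U) (h : H.HG) : H.insTen x h = (H.tenHom x).mapFun h := rfl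

/-- `x ⊗_A y ↦ x ⊗ y₊ ⊗ y₋` -/
noncomputable def tenTrans : H.Ten →ₗ[k] (H.ind H.tenR).carrier :=
  H.tenLift (H.insTen.compl₂ H.trans) (by
    intro a u v
    change (H.tenHom (H.t (op a) * u)).mapFun (H.trans v) =
      (H.tenHom u).mapFun (H.trans (H.s a * v))
    rw [trans_s_mul]
    symm
    apply STRing.THom.mapFun_comp
    intro y
    exact (H.cls_bal a u y).symm)

lemma tenTrans_cls (x y : U) :
    H.tenTrans (H.cls (x ⊗ₜ y)) = (H.tenHom x).mapFun (H.trans y) := by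
  rw [tenTrans, H.tenLift_cls, TensorProduct.lift.tmul]
  rfl

lemma tenTrans_lmulT (a : A) (q : H.Ten) :
    H.tenTrans (H.lmulT a q) = (H.ind H.tenR).ract (H.tenTrans q) (H.s a) := by
  induction q using H.ten_induction with
  | tm x y =>
    rw [H.lmulT_cls, Algebra.TensorProduct.tmul_mul_tmul, one_mul, tenTrans_cls, tenTrans_cls,
      trans_t_mul, STRing.THom.mapFun_ract]
  | add x y hx hy => simp only [map_add, LinearMap.add_apply, hx, hy]

lemma tenTrans_rmul (q : H.Ten) (v : U) :
    H.tenTrans (H.rmul q (1 ⊗ₜ v)) = H.rot H.tenR v (H.tenTrans q) := by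
  induction q using H.ten_induction with
  | tm x y =>
    rw [H.rmul_cls, Algebra.TensorProduct.tmul_mul_tmul, mul_one, tenTrans_cls, tenTrans_cls,
      trans_mul, rot_mapFun]
    intro a b
    change H.cls (x ⊗ₜ (a * b)) = H.rmul (H.cls (x ⊗ₜ a)) (1 ⊗ₜ b)
    simp
  | add x y hx hy => simp only [map_add, LinearMap.add_apply, hx, hy]

/-- `τ(u₍₁₎) u₍₂₎ = u ⊗ 1` -/
lemma trans_comul (u : U) (X : U ⊗[k] U) (hX : H.cls X = H.comul u) :
    TensorProduct.lift (H.hgR ∘ₗ H.trans) X = H.hg u 1 := by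
  apply H.galois_bijective.1
  have key : ∀ X : U ⊗[k] U, H.galois (TensorProduct.lift (H.hgR ∘ₗ H.trans) X) = H.cls X := by
    intro X
    induction X using TensorProduct.induction_on with
    | zero => simp
    | tmul x y => exact H.galois_trans_ract x y
    | add x y hx hy => simp only [map_add, hx, hy]
  rw [key, H.galois_hg, hX, ← Algebra.TensorProduct.one_def]
  obtain ⟨Y, hY⟩ := H.cls_surj (H.comul u)
  rw [← hY, H.rmul_cls, mul_one]

/-- `x ⊗_A y ↦ x₍₁₎ ⊗ x₍₂₎₊ ⊗ x₍₂₎₋ y` -/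
noncomputable def tenL : H.Ten →ₗ[k] (H.ind H.tenR).carrier :=
  H.tenLift ((H.ind H.tenR).ract ∘ₗ H.tenTrans ∘ₗ H.comul) (by
    intro a u v
    change (H.ind H.tenR).ract (H.tenTrans (H.comul (H.t (op a) * u))) v =
      (H.ind H.tenR).ract (H.tenTrans (H.comul u)) (H.s a * v)
    rw [H.comul_t_mul, tenTrans_lmulT, RMod.ract_mul])

lemma tenL_cls (x y : U) :
    H.tenL (H.cls (x ⊗ₜ y)) = (H.ind H.tenR).ract (H.tenTrans (H.comul x)) y := by
  rw [tenL, H.tenLift_cls, TensorProduct.lift.tmul]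
  rfl

lemma tenL_rmul (q : H.Ten) (v : U) :
    H.tenL (H.rmul q (1 ⊗ₜ v)) = (H.ind H.tenR).ract (H.tenL q) v := by
  induction q using H.ten_induction with
  | tm x y =>
    rw [H.rmul_cls, Algebra.TensorProduct.tmul_mul_tmul, mul_one, tenL_cls, tenL_cls,
      RMod.ract_mul]
  | add x y hx hy => simp only [map_add, LinearMap.add_apply, hx, hy]

lemma tenL_comul (u : U) : H.tenL (H.comul u) = H.tm H.tenR (H.comul u) 1 := by
  obtain ⟨D, hD⟩ := exists_isLift H.comul
  let φ : U ⊗[k] (U ⊗[k] U) →ₗ[k] (H.ind H.tenR).carrier :=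
    TensorProduct.lift ((H.ind H.tenR).ract ∘ₗ H.tenTrans ∘ₗ H.cls) ∘ₗ
      (TensorProduct.assoc k U U U).symm.toLinearMap
  have hφ : ∀ x y z, φ (x ⊗ₜ (y ⊗ₜ z)) =
      (H.ind H.tenR).ract (H.tenTrans (H.cls (x ⊗ₜ y))) z := fun _ _ _ => rfl
  have h := H.rel3_apply_eq φ (by
      intro a x y z
      rw [hφ, hφ, H.cls_bal]) (by
      intro a x y z
      rw [hφ, hφ]
      have : H.cls (x ⊗ₜ (H.t (op a) * y)) = H.lmulT a (H.cls (x ⊗ₜ y)) := by simp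
      rw [this, tenTrans_lmulT, ← RMod.ract_mul]
      rfl) (H.coassoc D hD u)
  have h1 : ∀ X : U ⊗[k] U, φ (TensorProduct.assoc k U U U (D.rTensor U X)) =
      H.tenL (H.cls X) := by
    intro X
    induction X using TensorProduct.induction_on with
    | zero => simp
    | tmul x y =>
      rw [tenL_cls, ← hD x]
      change (TensorProduct.lift _ ∘ₗ _) (TensorProduct.assoc k U U U (D x ⊗ₜ y)) = _
      simp
      rfl
    | add x y hx hy => simp only [map_add, hx, hy]
  have h2 : ∀ X : U ⊗[k] U, φ (D.lTensor U X) = H.tm H.tenR (H.cls X) 1 := by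
    intro X
    induction X using TensorProduct.induction_on with
    | zero => simp
    | tmul x y =>
      rw [LinearMap.lTensor_tmul]
      have h3 : ∀ Y, φ (x ⊗ₜ Y) =
          (H.tenHom x).mapFun (TensorProduct.lift (H.hgR ∘ₗ H.trans) Y) := by
        intro Y
        induction Y using TensorProduct.induction_on with
        | zero => simp
        | tmul a b =>
          rw [hφ, tenTrans_cls, ← STRing.THom.mapFun_ract]
          rfl
        | add a b ha hb => rw [TensorProduct.tmul_add, map_add, ha, hb, map_add, map_add]
      rw [h3, trans_comul H y _ (hD y), H.mapFun_hg]
      rfl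
    | add x y hx hy => simp only [map_add, LinearMap.add_apply, hx, hy]
  have hDu : H.cls (D u) = H.comul u := hD u
  rw [h1, h2, hDu] at h
  exact h

/-- `u₊₍₁₎ ⊗ u₊₍₂₎ ⊗ u₋ = u₍₁₎ ⊗ u₍₂₎₊ ⊗ u₍₂₎₋` in `U ⊗_A U ⊗_{A^op} U` -/
lemma comul_trans (u : U) : H.comulHom.mapFun (H.trans u) = H.tenTrans (H.comul u) := by
  have key : ∀ h, H.comulHom.mapFun h = H.tenL (H.galois h) := by
    intro h
    induction h using H.hg_induction with
    | tm x y =>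
      rw [H.mapFun_hg, H.galois_hg, tenL_rmul, tenL_comul, H.ract_tm, one_mul]
      rfl
    | add a b ha hb => simp only [map_add, ha, hb]
  rw [key, galois_trans, tenL_cls, RMod.ract_one]

/-- `u₊ ⊗ u₋` as a sum of `x ⊗ y`: the sum of the `x₊ ⊗ y₊ ⊗ y₋ x₋` is `u₊ ⊗ u₋ ⊗ 1`. -/
noncomputable def double : H.HG →ₗ[k] (H.ind (H.ind H.reg)).carrier :=
  H.indLift (M := H.reg) (H.step H.reg ∘ₗ H.trans) (by
    intro a x y
    change H.step H.reg (H.trans (x * H.t (op a))) y =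
      H.step H.reg (H.trans x) (H.t (op a) * y)
    rw [trans_mul_t, step_lmulS])

lemma double_hg (x y : U) : H.double (H.hg x y) = H.step H.reg (H.trans x) y :=
  H.indLift_tm (M := H.reg) _ _ x y

/-- `β` as a map of right modules, and its inverse. -/
def galoisHom : H.THom (H.ind H.reg) H.tenR where
  toMap := H.galois
  map_t h _ := H.galois_hgR h _

/-- The inverse of `β` as a map of right modules. -/
def galoisInvHom : H.THom H.tenR (H.ind H.reg) where
  toMap := H.galoisInv
  map_t q _ := H.galoisInv_rmul q _

lemma double_trans (u : U) :
    H.double (H.trans u) = H.tm (H.ind H.reg) (H.trans u) 1 := by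
  have hinj : Function.Injective H.galoisHom.mapFun := by
    refine Function.LeftInverse.injective (g := H.galoisInvHom.mapFun) fun q => ?_
    induction q using H.ind_induction with
    | tm m u =>
      rw [STRing.THom.mapFun_tm, STRing.THom.mapFun_tm]
      congr 2
      exact H.galoisInv_galois m
    | add a b ha hb => simp only [map_add, ha, hb]
  apply hinj
  have key1 : ∀ (h : H.HG) (y : U), H.galoisHom.mapFun (H.step H.reg h y) =
      H.rot H.tenR y (H.comulHom.mapFun h) := by
    intro h y
    induction h using H.hg_induction with
    | tm x w =>
      rw [H.mapFun_hg, rot_tm]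
      change H.galoisHom.mapFun (H.step H.reg (H.tm H.reg x w) y) = _
      rw [step_tm, STRing.THom.mapFun_ract]
      congr 2
      apply STRing.THom.mapFun_comp
      intro z
      exact H.galois_hg x z
    | add a b ha hb => simp only [map_add, LinearMap.add_apply, ha, hb]
  have key2 : ∀ h, H.galoisHom.mapFun (H.double h) = H.tenTrans (H.galois h) := by
    intro h
    induction h using H.hg_induction with
    | tm x y => rw [double_hg, key1, comul_trans, ← tenTrans_rmul, H.galois_hg]
    | add a b ha hb => simp only [map_add, ha, hb]
  rw [key2, STRing.THom.mapFun_tm, galois_trans, tenTrans_cls, trans_one, H.mapFun_hg]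
  congr 2
  exact (H.galois_trans u).symm

/-- `(x ⊗ y) ↦ step (step r x) y` -/
noncomputable def stepStep (M : RMod k U) (r : (H.ind M).carrier) :
    H.HG →ₗ[k] (H.ind (H.ind (H.ind M))).carrier :=
  H.indLift (M := H.reg) (H.step (H.ind M) ∘ₗ H.step M r) (by
    intro a x y
    change H.step (H.ind M) (H.step M r (x * H.t (op a))) y =
      H.step (H.ind M) (H.step M r x) (H.t (op a) * y)
    rw [step_mul_t, step_lmulS])

lemma stepStep_hg (M : RMod k U) (r : (H.ind M).carrier) (x y : U) :
    H.stepStep M r (H.hg x y) = H.step (H.ind M) (H.step M r x) y :=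
  H.indLift_tm (M := H.reg) _ _ x y

lemma stepStep_ract (M : RMod k U) (r : (H.ind M).carrier) (h : H.HG) (w : U) :
    H.stepStep M r (H.hgR h w) = H.rot (H.ind (H.ind M)) w (H.stepStep M r h) := by
  induction h using H.hg_induction with
  | tm x y => rw [H.hgR_hg, stepStep_hg, stepStep_hg, step_mul]
  | add a b ha hb => simp only [map_add, LinearMap.add_apply, ha, hb]

/-- `q ↦ step q u` as a map of modules. -/
noncomputable def stepHom (M : RMod k U) (u : U) : H.THom (H.ind M) (H.ind (H.ind M)) where
  toMap := (H.step M).flip u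
  map_t q _ := H.step_ract M q u _

lemma stepStep_trans_one (M : RMod k U) (r : (H.ind M).carrier) (u : U) :
    H.stepStep M r (H.trans u) = (H.stepHom M u).mapFun ((H.unitMap M).mapFun r) := by
  induction r using H.ind_induction with
  | tm m w =>
    have key : ∀ h, H.stepStep M (H.tm M m w) h =
        (H.ind (H.ind (H.ind M))).ract ((H.tmHom M m).map.mapFun (H.double h)) w := by
      intro h
      induction h using H.hg_induction with
      | tm x y => rw [stepStep_hg, step_tm, step_ract, step_mapFun, double_hg]
      | add a b ha hb => simp only [map_add, LinearMap.add_apply, ha, hb]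
    rw [key, double_trans, STRing.THom.mapFun_tm, H.ract_tm, one_mul, STRing.THom.mapFun_tm,
      STRing.THom.mapFun_tm]
    change H.tm _ ((H.tmHom M m).mapFun (H.trans u)) w = H.tm _ (H.step M (H.tm M m 1) u) w
    rw [step_tm, RMod.ract_one]
  | add a b ha hb =>
    have h2 : ∀ h, H.stepStep M (a + b) h = H.stepStep M a h + H.stepStep M b h := by
      intro h
      induction h using H.hg_induction with
      | tm x y => simp only [stepStep_hg, map_add, LinearMap.add_apply]
      | add c d hc hd => rw [map_add, hc, hd, map_add, map_add]; abel
    rw [h2, ha, hb, map_add, map_add]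

/-- `m ⊗ w₊ ⊗ w₋ v`, and then the same with `u₊` and `u₋ w`. -/
lemma stepStep_trans (M : RMod k U) (r : (H.ind M).carrier) (u w : U) :
    H.stepStep M r (H.hgR (H.trans u) w) = (H.stepHom M u).mapFun (H.step M r w) := by
  rw [stepStep_ract, stepStep_trans_one, rot_apply, step_mapFun, step_mapFun]
  generalize H.step M r w = z
  induction z using H.ind_induction with
  | tm q v =>
    rw [STRing.THom.mapFun_tm, STRing.THom.mapFun_tm, STRing.THom.mapFun_tm,
      STRing.THom.mapFun_tm]
    congr 2
    change H.mulFun _ ((H.stepHom M u).mapFun ((H.unitMap M).mapFun q)) = H.step M q u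
    induction q using H.ind_induction with
    | tm m x =>
      rw [STRing.THom.mapFun_tm, STRing.THom.mapFun_tm, H.mulFun_tm]
      change (H.ind (H.ind M)).ract (H.step M (H.tm M m 1) u) x = _
      rw [← step_ract, H.ract_tm, one_mul]
    | add a b ha hb => simp only [map_add, LinearMap.add_apply, ha, hb]
  | add a b ha hb => simp only [map_add, ha, hb]

end HopfAlgebroid

/-! ## Comodules and stable anti-Yetter-Drinfeld modules -/

/-- A left comodule `P` over a left bialgebroid: a left `A`-module with a coassociative and
counital left `A`-linear map `P → U ⊗_A P`, where `t(a) u ⊗_A p = u ⊗_A a p`. -/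
structure LeftComodule (B : LeftBialgebroid k A U) (P : Type*) [AddCommGroup P] [Module k P] where
  /-- the left `A`-module structure `(a, p) ↦ a p` -/
  lact : A →ₐ[k] Module.End k P
  /-- the coaction `Δ_P` -/
  coact : P →ₗ[k] Bal (k := k) (fun a : A => LinearMap.mulLeft k (B.t (op a))) (fun a => lact a)
  /-- `Δ_P(a p) = s(a) p₍₋₁₎ ⊗ p₍₀₎` -/
  coact_lact : ∀ a p X, (balRel _ _).mkQ X = coact p →
    coact (lact a p) = (balRel _ _).mkQ ((LinearMap.mulLeft k (B.s a)).rTensor P X)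
  /-- `(Δ ⊗ id) Δ_P = (id ⊗ Δ_P) Δ_P` in `U ⊗_A U ⊗_A P` -/
  coassoc : ∀ D E, IsLift B.comul D → IsLift coact E → ∀ p,
    (B.rel3 fun a => lact a).mkQ (TensorProduct.assoc k U U P (D.rTensor P (E p))) =
      (B.rel3 fun a => lact a).mkQ (E.lTensor U (E p))
  /-- `ε(p₍₋₁₎) p₍₀₎ = p` -/
  counit : ∀ p X, (balRel _ _).mkQ X = coact p →
    TensorProduct.lift (lact.toLinearMap ∘ₗ B.counit) X = p

/-- A right module and left comodule over a Hopf algebroid such that the two induced right actions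
of `A ⊗ A^op` coincide. -/
structure ModuleComodule (H : HopfAlgebroid k A U) extends RMod k U where
  /-- the left comodule structure -/
  comod : LeftComodule H.toLeftBialgebroid carrier
  /-- `p s(a) t(b) = b ε(p₍₋₁₎ s(a)) p₍₀₎` -/
  compat : ∀ p a b X, (balRel _ _).mkQ X = comod.coact p →
    ract p (H.s a * H.t (op b)) = comod.lact b (TensorProduct.lift
      (comod.lact.toLinearMap ∘ₗ H.counit ∘ₗ LinearMap.mulRight k (H.s a)) X)

namespace ModuleComodule

variable {H : HopfAlgebroid k A U} (P : ModuleComodule H)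

lemma compat_s (p : P.carrier) (a : A) (X : U ⊗[k] P.carrier)
    (hX : (balRel _ _).mkQ X = P.comod.coact p) :
    P.ract p (H.s a) = TensorProduct.lift
      (P.comod.lact.toLinearMap ∘ₗ H.counit ∘ₗ LinearMap.mulRight k (H.s a)) X := by
  have h := P.compat p a 1 X hX
  rwa [MulOpposite.op_one, map_one, mul_one, map_one] at h

lemma ract_t (p : P.carrier) (a : A) : P.ract p (H.t (op a)) = P.comod.lact a p := by
  obtain ⟨X, hX⟩ := Submodule.mkQ_surjective _ (P.comod.coact p)
  have h := P.compat p 1 a X hX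
  have h1 : LinearMap.mulRight k (1 : U) = LinearMap.id := by ext; simp
  rw [map_one, one_mul, h1, LinearMap.comp_id, P.comod.counit p X hX] at h
  exact h

/-- The isomorphism `U ⊗_A P → P ⊗_{A^op} U`, `v ⊗ p ↦ p ⊗ v`. -/
def swap : Bal (k := k) (fun a : A => LinearMap.mulLeft k (H.t (op a)))
    (fun a => P.comod.lact a) →ₗ[k] (H.ind P.toRMod).carrier :=
  Bal.lift (H.tm P.toRMod).flip (by
    intro a v p
    change H.tm P.toRMod p (H.t (op a) * v) = H.tm P.toRMod (P.comod.lact a p) v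
    rw [← P.ract_t, H.tm_bal])

lemma swap_mkQ (X : U ⊗[k] P.carrier) :
    P.swap ((balRel _ _).mkQ X) = TensorProduct.lift (H.tm P.toRMod).flip X := rfl

lemma swap_bijective : Function.Bijective P.swap := by
  let g : (H.ind P.toRMod).carrier →ₗ[k] Bal (k := k)
      (fun a : A => LinearMap.mulLeft k (H.t (op a))) (fun a => P.comod.lact a) :=
    H.indLift (M := P.toRMod) (Bal.mk _ _).flip (by
      intro a p v
      rw [P.ract_t]
      exact (Bal.mk_bal (k := k) (fun a : A => LinearMap.mulLeft k (H.t (op a)))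
        (fun a => P.comod.lact a) a v p).symm)
  have hg : ∀ p v, g (H.tm P.toRMod p v) = Bal.mk _ _ v p :=
    fun p v => H.indLift_tm (M := P.toRMod) _ _ p v
  have hs : ∀ p v, P.swap (Bal.mk _ _ v p) = H.tm P.toRMod p v := by
    intro p v
    rw [swap, Bal.lift_mk]
    rfl
  constructor
  · refine Function.LeftInverse.injective (g := g) fun q => ?_
    induction q using Bal.induction with
    | tm v p => rw [hs, hg]
    | add x y hx hy => rw [map_add, map_add, hx, hy]
  · refine Function.RightInverse.surjective (g := g) fun q => ?_
    induction q using H.ind_induction with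
    | tm v p => rw [hg, hs]
    | add x y hx hy => rw [map_add, map_add, hx, hy]

/-- The coaction, written as `p ↦ p₍₀₎ ⊗ p₍₋₁₎ ∈ P ⊗_{A^op} U`. -/
def coactR : P.carrier →ₗ[k] (H.ind P.toRMod).carrier := P.swap ∘ₗ P.comod.coact

lemma coactR_eq (p : P.carrier) (X : U ⊗[k] P.carrier)
    (hX : (balRel _ _).mkQ X = P.comod.coact p) :
    P.coactR p = TensorProduct.lift (H.tm P.toRMod).flip X := by
  rw [coactR, LinearMap.comp_apply, ← hX, swap_mkQ]

lemma coactR_t (p : P.carrier) (a : A) :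
    P.coactR (P.ract p (H.t (op a))) = H.lmulS P.toRMod a (P.coactR p) := by
  obtain ⟨X, hX⟩ := Submodule.mkQ_surjective _ (P.comod.coact p)
  rw [P.ract_t, P.coactR_eq p X hX, P.coactR_eq _ _ (P.comod.coact_lact a p X hX).symm]
  clear hX
  induction X using TensorProduct.induction_on with
  | zero => simp only [map_zero]
  | tmul v q => exact (H.lmulS_tm P.toRMod a q v).symm
  | add x y hx hy => simp only [map_add, hx, hy]

lemma epsFun_coactR (p : P.carrier) : H.epsFun P.toRMod (P.coactR p) = p := by
  obtain ⟨X, hX⟩ := Submodule.mkQ_surjective _ (P.comod.coact p)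
  rw [P.coactR_eq p X hX]
  refine Eq.trans ?_ (P.comod.counit p X hX)
  clear hX
  induction X using TensorProduct.induction_on with
  | zero => simp only [map_zero]
  | tmul v q => exact (H.epsFun_tm P.toRMod q v).trans (P.ract_t q _)
  | add x y hx hy => simp only [map_add, hx, hy]

/-- `p ↦ p s(a)` -/
def sMap (a : A) : H.THom P.toRMod P.toRMod where
  toMap := P.ract.flip (H.s a)
  map_t p b := by
    change P.ract (P.ract p _) (H.s a) = P.ract (P.ract p (H.s a)) _
    rw [← P.ract_mul, ← P.ract_mul, H.comm]

/-- `(x ⊗ y, q) ↦ q ⊗ t(ε(y s(a))) x` -/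
def epsTen (a : A) : U ⊗[k] (U ⊗[k] P.carrier) →ₗ[k] (H.ind P.toRMod).carrier :=
  TensorProduct.lift (LinearMap.mk₂ k (fun x Y => TensorProduct.lift
      (LinearMap.mk₂ k (fun y q => H.tm P.toRMod q (H.t (op (H.counit (y * H.s a))) * x))
      (by intros; simp [add_mul]) (by intros; simp)
      (by intros; simp) (by intros; simp)) Y)
    (by
      intro x x' Y
      induction Y using TensorProduct.induction_on with
      | zero => simp only [map_zero, add_zero]
      | tmul y q =>
        simp only [TensorProduct.lift.tmul, LinearMap.mk₂_apply, mul_add, map_add]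
      | add c d hc hd => rw [map_add, map_add, map_add, hc, hd]; abel)
    (by
      intro c x Y
      induction Y using TensorProduct.induction_on with
      | zero => simp only [map_zero, smul_zero]
      | tmul y q =>
        simp only [TensorProduct.lift.tmul, LinearMap.mk₂_apply, mul_smul_comm, map_smul]
      | add c d hc hd => rw [map_add, map_add, hc, hd, smul_add])
    (by intros; simp) (by intros; simp))

lemma epsTen_tmul (a : A) (x y : U) (q : P.carrier) :
    P.epsTen a (x ⊗ₜ (y ⊗ₜ q)) = H.tm P.toRMod q (H.t (op (H.counit (y * H.s a))) * x) := rfl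

/-- `p₍₀₎ s(a) ⊗ p₍₋₁₎ = p₍₀₎ ⊗ p₍₋₁₎ t(a)` -/
lemma coactR_takeuchi (p : P.carrier) (a : A) :
    (P.sMap a).mapFun (P.coactR p) = (H.ind P.toRMod).ract (P.coactR p) (H.t (op a)) := by
  obtain ⟨D, hD⟩ := exists_isLift H.comul
  obtain ⟨E, hE⟩ := exists_isLift P.comod.coact
  have hbs : ∀ b y, H.counit (H.s b * y) = b * H.counit y := by
    intro b y
    simpa using H.counit_bimod b 1 y
  have hbt : ∀ b y, H.counit (H.t (op b) * y) = H.counit y * b := by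
    intro b y
    simpa using H.counit_bimod 1 b y
  have h := H.rel3_apply_eq (P.epsTen a) (by
      intro b x y q
      rw [epsTen_tmul, epsTen_tmul, mul_assoc (H.s b), hbs, MulOpposite.op_mul, map_mul H.t,
        mul_assoc]) (by
      intro b x y q
      rw [epsTen_tmul, epsTen_tmul, mul_assoc (H.t _), hbt, MulOpposite.op_mul, map_mul H.t,
        mul_assoc, ← P.ract_t, H.tm_bal]) (P.comod.coassoc D E hD hE p)
  rw [P.coactR_eq p (E p) (hE p)]
  have h1 : ∀ X : U ⊗[k] P.carrier,
      P.epsTen a (TensorProduct.assoc k U U P.carrier (D.rTensor P.carrier X)) =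
      (H.ind P.toRMod).ract (TensorProduct.lift (H.tm P.toRMod).flip X) (H.t (op a)) := by
    intro X
    induction X using TensorProduct.induction_on with
    | zero => simp only [map_zero, LinearMap.zero_apply]
    | tmul v q =>
      have h3 : ∀ Y : U ⊗[k] U, P.epsTen a (TensorProduct.assoc k U U P.carrier (Y ⊗ₜ q)) =
          H.tm P.toRMod q (H.tenEpsR (H.rmul (H.cls Y) (1 ⊗ₜ H.s a))) := by
        intro Y
        induction Y using TensorProduct.induction_on with
        | zero => simp
        | tmul x y =>
          rw [TensorProduct.assoc_tmul, epsTen_tmul, H.rmul_cls,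
            Algebra.TensorProduct.tmul_mul_tmul, mul_one, H.tenEpsR_cls]
        | add c d hc hd =>
          rw [TensorProduct.add_tmul, map_add, map_add, hc, hd]
          simp only [map_add, LinearMap.add_apply]
      have hDv : H.cls (D v) = H.comul v := hD v
      rw [LinearMap.rTensor_tmul, h3, hDv, ← H.takeuchi, H.tenEpsR_rmul_left, H.tenEpsR_comul]
      exact (H.ract_tm P.toRMod q v _).symm
    | add x y hx hy => simp only [map_add, LinearMap.add_apply, hx, hy]
  have h2 : ∀ X : U ⊗[k] P.carrier, P.epsTen a (E.lTensor U X) =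
      (P.sMap a).mapFun (TensorProduct.lift (H.tm P.toRMod).flip X) := by
    intro X
    induction X using TensorProduct.induction_on with
    | zero => simp only [map_zero]
    | tmul v q =>
      have h3 : ∀ Y : U ⊗[k] P.carrier, P.epsTen a (v ⊗ₜ Y) = H.tm P.toRMod (TensorProduct.lift
          (P.comod.lact.toLinearMap ∘ₗ H.counit ∘ₗ LinearMap.mulRight k (H.s a)) Y) v := by
        intro Y
        induction Y using TensorProduct.induction_on with
        | zero => simp
        | tmul y q =>
          rw [epsTen_tmul, ← H.tm_bal, P.ract_t]
          rfl
        | add c d hc hd =>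
          rw [TensorProduct.tmul_add, map_add, hc, hd]
          simp only [map_add, LinearMap.add_apply]
      rw [LinearMap.lTensor_tmul, h3, ← P.compat_s q a (E q) (hE q)]
      exact ((P.sMap a).mapFun_tm q v).symm
    | add x y hx hy => simp only [map_add, hx, hy]
  rw [← h1, ← h2]
  exact h.symm

end ModuleComodule

/-- A stable anti-Yetter-Drinfeld module over a Hopf algebroid.

The anti-Yetter-Drinfeld condition is `Δ_P(p u) = u₋ p₍₋₁₎ u₊₍₁₎ ⊗ p₍₀₎ u₊₍₂₎`.  Since
`u₊₍₁₎ ⊗ u₊₍₂₎ ⊗ u₋ = u₍₁₎ ⊗ u₍₂₎₊ ⊗ u₍₂₎₋` (lemma `comul_trans`), the right hand side means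
`u₍₂₎₋ p₍₋₁₎ u₍₁₎ ⊗ p₍₀₎ u₍₂₎₊`; this is how it is written below, in `P ⊗_{A^op} U ≃ U ⊗_A P`,
with the map `m ⊗ w ↦ m v₊ ⊗ v₋ w`, which is `rot v`. -/
structure SAYDModule (H : HopfAlgebroid k A U) extends ModuleComodule H where
  /-- `(p u)₍₀₎ ⊗ (p u)₍₋₁₎ = p₍₀₎ u₍₂₎₊ ⊗ u₍₂₎₋ p₍₋₁₎ u₍₁₎` -/
  ayd : ∀ p u X, H.cls X = H.comul u →
    toModuleComodule.coactR (ract p u) = TensorProduct.lift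
      ((H.ind toRMod).ract ∘ₗ (H.mulMap toRMod).mapFun ∘ₗ
        H.step toRMod (toModuleComodule.coactR p)).flip X
  /-- stability: `p₍₀₎ p₍₋₁₎ = p` -/
  stable : ∀ p, H.mulFun toRMod (toModuleComodule.coactR p) = p

/-! ## The modules `C_n(U; P)` and their operators -/

namespace STRing

variable (B : STRing k A U)

/-- `C_n = P ⊗_{A^op} U ⊗_{A^op} ⋯ ⊗_{A^op} U` with `n` factors `U` (bracketed to the left), as
a right `U`-module through its last factor. -/
abbrev C (P : RMod k U) : ℕ → RMod k U
  | 0 => P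
  | n + 1 => B.ind (C P n)

/-- The elementary tensor `p ⊗ u¹ ⊗ ⋯ ⊗ uⁿ` in `C_n`. -/
def tprod (P : RMod k U) (p : P.carrier) : (n : ℕ) → (Fin n → U) → (B.C P n).carrier
  | 0, _ => p
  | n + 1, u => B.tm (B.C P n) (tprod P p n (Fin.init u)) (u (Fin.last n))

/-- The face maps `d_{i+1} : C_{n+1} → C_n`, `0 ≤ i ≤ n`: the map `d_1` multiplies the last two
factors, and `d_{i+2} = d_{i+1} ⊗ id`. -/
def dSucc (P : RMod k U) : (n : ℕ) → Fin (n + 1) → B.THom (B.C P (n + 1)) (B.C P n)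
  | 0, _ => B.mulMap (B.C P 0)
  | n + 1, i => Fin.cases (B.mulMap (B.C P (n + 1))) (fun j => (dSucc P n j).map) i

/-- The degeneracy maps `s_i : C_n → C_{n+1}`: the map `s_0` appends `1`, and
`s_{i+1} = s_i ⊗ id`. -/
def degen (P : RMod k U) : (n : ℕ) → Fin (n + 1) → B.THom (B.C P n) (B.C P (n + 1))
  | 0, _ => B.unitMap (B.C P 0)
  | n + 1, i => Fin.cases (B.unitMap (B.C P (n + 1))) (fun j => (degen P n j).map) i

lemma THom.mapFun_comm {B : STRing k A U} {K L M N : RMod k U} (f : B.THom M N) (g : B.THom L M)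
    (e : B.THom K N) (d : B.THom L K) (h : ∀ x, f.toMap (g.toMap x) = e.toMap (d.toMap x))
    (q : (B.ind L).carrier) : f.mapFun (g.mapFun q) = e.mapFun (d.mapFun q) := by
  induction q using B.ind_induction with
  | tm m u => simp [h]
  | add x y hx hy => simp only [map_add, hx, hy]

lemma THom.mapFun_id {B : STRing k A U} {L M : RMod k U} (f : B.THom M L) (g : B.THom L M)
    (h : ∀ x, f.toMap (g.toMap x) = x)
    (q : (B.ind L).carrier) : f.mapFun (g.mapFun q) = q := by
  induction q using B.ind_induction with
  | tm m u => simp [h]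
  | add x y hx hy => simp only [map_add, hx, hy]

variable (P : RMod k U)

lemma dSucc_zero (n : ℕ) : B.dSucc P n 0 = B.mulMap (B.C P n) := by
  cases n <;> rfl

lemma dSucc_succ (n : ℕ) (j : Fin (n + 1)) : B.dSucc P (n + 1) j.succ = (B.dSucc P n j).map := rfl

lemma degen_zero (n : ℕ) : B.degen P n 0 = B.unitMap (B.C P n) := by
  cases n <;> rfl

lemma degen_succ (n : ℕ) (j : Fin (n + 1)) : B.degen P (n + 1) j.succ = (B.degen P n j).map := rfl

lemma dSucc_ract (n : ℕ) (j : Fin (n + 1)) (q : (B.C P (n + 1)).carrier) (v : U) :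
    (B.dSucc P n j).toMap ((B.C P (n + 1)).ract q v) =
      (B.C P n).ract ((B.dSucc P n j).toMap q) v := by
  cases j using Fin.cases with
  | zero =>
    rw [dSucc_zero]
    exact B.mulFun_ract _ q v
  | succ j =>
    cases n with
    | zero => exact j.elim0
    | succ n => exact (B.dSucc P n j).mapFun_ract q v

/-- `d_{i+1} d_{j+2} = d_{j+1} d_{i+1}` for `i ≤ j` -/
lemma dSucc_dSucc (n : ℕ) (i j : Fin (n + 1)) (h : i ≤ j) (q : (B.C P (n + 2)).carrier) :
    (B.dSucc P n i).toMap ((B.dSucc P (n + 1) j.succ).toMap q) =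
      (B.dSucc P n j).toMap ((B.dSucc P (n + 1) i.castSucc).toMap q) := by
  induction n with
  | zero =>
    obtain rfl : i = 0 := Fin.fin_one_eq_zero i
    rw [Fin.castSucc_zero, dSucc_zero, dSucc_zero, dSucc_succ]
    exact THom.mulFun_mapFun _ (B.dSucc_ract P 0 j) q
  | succ n ih =>
    cases i using Fin.cases with
    | zero =>
      rw [Fin.castSucc_zero, dSucc_zero, dSucc_zero, dSucc_succ]
      exact THom.mulFun_mapFun _ (B.dSucc_ract P (n + 1) j) q
    | succ i =>
      cases j using Fin.cases with
      | zero => exact absurd h (by simp)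
      | succ j =>
        rw [← Fin.succ_castSucc, dSucc_succ, dSucc_succ, dSucc_succ, dSucc_succ]
        exact THom.mapFun_comm _ _ _ _ (ih i j (by simpa using h)) q

/-- `s_i s_j = s_{j+1} s_i` for `i ≤ j` -/
lemma degen_degen (n : ℕ) (i j : Fin (n + 1)) (h : i ≤ j) (q : (B.C P n).carrier) :
    (B.degen P (n + 1) i.castSucc).toMap ((B.degen P n j).toMap q) =
      (B.degen P (n + 1) j.succ).toMap ((B.degen P n i).toMap q) := by
  induction n with
  | zero =>
    obtain rfl : i = 0 := Fin.fin_one_eq_zero i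
    rw [Fin.castSucc_zero, degen_zero, degen_zero, degen_succ]
    exact (THom.mapFun_mapFun_unit (B.degen P 0 j) q).symm
  | succ n ih =>
    cases i using Fin.cases with
    | zero =>
      rw [Fin.castSucc_zero, degen_zero, degen_zero, degen_succ]
      exact (THom.mapFun_mapFun_unit (B.degen P (n + 1) j) q).symm
    | succ i =>
      cases j using Fin.cases with
      | zero => exact absurd h (by simp)
      | succ j =>
        rw [← Fin.succ_castSucc, degen_succ, degen_succ, degen_succ, degen_succ]
        exact THom.mapFun_comm _ _ _ _ (ih i j (by simpa using h)) q

/-- `d_{i+1} s_{j+1} = s_j d_{i+1}` for `i < j` -/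
lemma dSucc_degen_lt (n : ℕ) (i j : Fin (n + 1)) (h : i < j) (q : (B.C P (n + 1)).carrier) :
    (B.dSucc P (n + 1) i.castSucc).toMap ((B.degen P (n + 1) j.succ).toMap q) =
      (B.degen P n j).toMap ((B.dSucc P n i).toMap q) := by
  induction n with
  | zero => exact absurd h (by simp [Fin.fin_one_eq_zero i, Fin.fin_one_eq_zero j])
  | succ n ih =>
    cases j using Fin.cases with
    | zero => exact absurd h (by simp)
    | succ j =>
      cases i using Fin.cases with
      | zero =>
        rw [Fin.castSucc_zero, dSucc_zero, dSucc_zero, degen_succ]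
        exact THom.mulFun_mapFun _ (fun m u => THom.mapFun_ract _ m u) q
      | succ i =>
        rw [← Fin.succ_castSucc, dSucc_succ, dSucc_succ, degen_succ, degen_succ]
        exact THom.mapFun_comm _ _ _ _ (ih i j (by simpa using h)) q

/-- `d_{i+1} s_{i+1} = id` -/
lemma dSucc_degen_self (n : ℕ) (i : Fin (n + 1)) (q : (B.C P (n + 1)).carrier) :
    (B.dSucc P (n + 1) i.castSucc).toMap ((B.degen P (n + 1) i.succ).toMap q) = q := by
  have base : ∀ (M : RMod k U) (q : (B.ind M).carrier),
      B.mulFun (B.ind M) ((B.unitMap M).mapFun q) = q := by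
    intro M q
    induction q using B.ind_induction with
    | tm m u => simp
    | add x y hx hy => simp only [map_add, hx, hy]
  induction n with
  | zero =>
    obtain rfl : i = 0 := Fin.fin_one_eq_zero i
    rw [Fin.castSucc_zero, dSucc_zero, degen_succ, degen_zero]
    exact base _ q
  | succ n ih =>
    cases i using Fin.cases with
    | zero =>
      rw [Fin.castSucc_zero, dSucc_zero, degen_succ, degen_zero]
      exact base _ q
    | succ i =>
      rw [← Fin.succ_castSucc, dSucc_succ, degen_succ]
      exact THom.mapFun_id _ _ (ih i) q

/-- `d_{i+1} s_i = id` -/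
lemma dSucc_degen_self' (n : ℕ) (i : Fin (n + 1)) (q : (B.C P n).carrier) :
    (B.dSucc P n i).toMap ((B.degen P n i).toMap q) = q := by
  have base : ∀ (M : RMod k U) (q : M.carrier),
      B.mulFun M ((B.unitMap M).toMap q) = q := by
    intro M q
    rw [unitMap_apply, mulFun_tm, M.ract_one]
  induction n with
  | zero =>
    obtain rfl : i = 0 := Fin.fin_one_eq_zero i
    rw [dSucc_zero, degen_zero]
    exact base _ q
  | succ n ih =>
    cases i using Fin.cases with
    | zero =>
      rw [dSucc_zero, degen_zero]
      exact base _ q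
    | succ i =>
      rw [dSucc_succ, degen_succ]
      exact THom.mapFun_id _ _ (ih i) q

/-- `d_{i+2} s_j = s_j d_{i+1}` for `j ≤ i` -/
lemma dSucc_degen_gt (n : ℕ) (i j : Fin (n + 1)) (h : j ≤ i) (q : (B.C P (n + 1)).carrier) :
    (B.dSucc P (n + 1) i.succ).toMap ((B.degen P (n + 1) j.castSucc).toMap q) =
      (B.degen P n j).toMap ((B.dSucc P n i).toMap q) := by
  induction n with
  | zero =>
    obtain rfl : j = 0 := Fin.fin_one_eq_zero j
    rw [Fin.castSucc_zero, degen_zero, degen_zero, dSucc_succ]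
    exact THom.mapFun_mapFun_unit _ q
  | succ n ih =>
    cases j using Fin.cases with
    | zero =>
      rw [Fin.castSucc_zero, degen_zero, degen_zero, dSucc_succ]
      exact THom.mapFun_mapFun_unit _ q
    | succ j =>
      cases i using Fin.cases with
      | zero => exact absurd h (by simp)
      | succ i =>
        rw [← Fin.succ_castSucc, dSucc_succ, dSucc_succ, degen_succ, degen_succ]
        exact THom.mapFun_comm _ _ _ _ (ih i j (by simpa using h)) q

end STRing

/-- The face maps `d_i : C_{n+1} → C_n`, `0 ≤ i ≤ n + 1`. -/
def LeftBialgebroid.face (B : LeftBialgebroid k A U) (P : RMod k U) (n : ℕ) :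
    Fin (n + 2) → ((B.C P (n + 1)).carrier →ₗ[k] (B.C P n).carrier) :=
  Fin.cases (B.epsFun (B.C P n)) (fun i => (B.dSucc P n i).toMap)

namespace LeftBialgebroid

variable (B : LeftBialgebroid k A U) (P : RMod k U)

lemma face_zero (n : ℕ) : B.face P n 0 = B.epsFun (B.C P n) := rfl

lemma face_succ (n : ℕ) (i : Fin (n + 1)) : B.face P n i.succ = (B.dSucc P n i).toMap := rfl

lemma epsFun_mulFun (M : RMod k U) (q : (B.ind (B.ind M)).carrier) :
    B.epsFun M (B.mulFun (B.ind M) q) = B.epsFun M (B.epsFun (B.ind M) q) := by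
  induction q using B.ind_induction with
  | tm m v =>
    rw [B.mulFun_tm, B.epsFun_tm]
    induction m using B.ind_induction with
    | tm m u => rw [B.ract_tm, B.ract_tm, B.epsFun_tm, B.epsFun_tm, B.counit_mul_t]
    | add x y hx hy => simp only [map_add, LinearMap.add_apply, hx, hy]
  | add x y hx hy => simp only [map_add, hx, hy]

lemma face_face (n : ℕ) (i j : Fin (n + 2)) (h : i ≤ j) (q : (B.C P (n + 2)).carrier) :
    B.face P n i (B.face P (n + 1) j.succ q) =
      B.face P n j (B.face P (n + 1) i.castSucc q) := by
  cases i using Fin.cases with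
  | zero =>
    rw [Fin.castSucc_zero, face_zero, face_zero, face_succ]
    cases j using Fin.cases with
    | zero =>
      rw [face_zero, B.dSucc_zero]
      exact B.epsFun_mulFun _ q
    | succ j =>
      rw [face_succ]
      exact B.epsFun_mapFun _ q
  | succ i =>
    cases j using Fin.cases with
    | zero => exact absurd h (by simp)
    | succ j =>
      rw [← Fin.succ_castSucc, face_succ, face_succ, face_succ, face_succ]
      exact B.dSucc_dSucc P n i j (by simpa using h) q

lemma face_degen_le (n : ℕ) (i : Fin (n + 2)) (j : Fin (n + 1)) (h : i ≤ j.castSucc)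
    (q : (B.C P (n + 1)).carrier) :
    B.face P (n + 1) i.castSucc ((B.degen P (n + 1) j.succ).toMap q) =
      (B.degen P n j).toMap (B.face P n i q) := by
  cases i using Fin.cases with
  | zero =>
    rw [Fin.castSucc_zero, face_zero, face_zero]
    exact B.epsFun_mapFun _ q
  | succ i =>
    rw [← Fin.succ_castSucc, face_succ, face_succ]
    exact B.dSucc_degen_lt P n i j (Nat.lt_of_succ_le (Fin.le_def.1 h)) q

lemma face_degen_self (n : ℕ) (i : Fin (n + 1)) (q : (B.C P n).carrier) :
    B.face P n i.castSucc ((B.degen P n i).toMap q) = q := by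
  cases i using Fin.cases with
  | zero =>
    rw [Fin.castSucc_zero, face_zero, B.degen_zero, B.unitMap_apply, B.epsFun_tm,
      B.t_counit_one, RMod.ract_one]
  | succ i =>
    cases n with
    | zero => exact i.elim0
    | succ n =>
      rw [← Fin.succ_castSucc, face_succ]
      exact B.dSucc_degen_self P n i q

lemma face_degen_self' (n : ℕ) (i : Fin (n + 1)) (q : (B.C P n).carrier) :
    B.face P n i.succ ((B.degen P n i).toMap q) = q := B.dSucc_degen_self' P n i q

lemma face_degen_gt (n : ℕ) (i : Fin (n + 2)) (j : Fin (n + 1)) (h : j.castSucc < i)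
    (q : (B.C P (n + 1)).carrier) :
    B.face P (n + 1) i.succ ((B.degen P (n + 1) j.castSucc).toMap q) =
      (B.degen P n j).toMap (B.face P n i q) := by
  cases i using Fin.cases with
  | zero => exact absurd h (by simp)
  | succ i =>
    exact B.dSucc_degen_gt P n i j (Nat.le_of_lt_succ (Fin.lt_def.1 h)) q

end LeftBialgebroid

/-! ## The cyclic operator -/

namespace SAYDModule

variable {H : HopfAlgebroid k A U} (P : SAYDModule H)

/-- The module `C_n(U; P)`. -/
abbrev Cn (n : ℕ) : RMod k U := H.C P.toRMod n

/-- The map `p ⊗ u¹ ⊗ ⋯ ⊗ uⁿ ↦ p₍₀₎ ⊗ u¹₊ ⊗ ⋯ ⊗ uⁿ₊ ⊗ uⁿ₋ ⋯ u¹₋ p₍₋₁₎`, together with the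
identity that is needed for its recursive definition. -/
noncomputable def rotAux : (n : ℕ) →
    {f : (P.Cn n).carrier →ₗ[k] (H.ind (P.Cn n)).carrier //
      ∀ c a, f ((P.Cn n).ract c (H.t (op a))) = H.lmulS (P.Cn n) a (f c)}
  | 0 => ⟨P.coactR, P.coactR_t⟩
  | n + 1 => ⟨H.indLift (H.step (P.Cn n) ∘ₗ (rotAux n).1) (by
        intro a c u
        change H.step (P.Cn n) ((rotAux n).1 ((P.Cn n).ract c (H.t (op a)))) u =
          H.step (P.Cn n) ((rotAux n).1 c) (H.t (op a) * u)
        rw [(rotAux n).2, H.step_lmulS]), by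
      intro q a
      induction q using H.ind_induction with
      | tm c u =>
        rw [H.ract_tm, H.indLift_tm, H.indLift_tm]
        exact H.step_mul_t _ _ a u
      | add x y hx hy => simp only [map_add, LinearMap.add_apply, hx, hy]⟩

/-- The map `p ⊗ u¹ ⊗ ⋯ ⊗ uⁿ ↦ p₍₀₎ ⊗ u¹₊ ⊗ ⋯ ⊗ uⁿ₊ ⊗ uⁿ₋ ⋯ u¹₋ p₍₋₁₎`. -/
noncomputable def rotMap (n : ℕ) : (P.Cn n).carrier →ₗ[k] (P.Cn (n + 1)).carrier := (P.rotAux n).1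

/-- The cyclic operator
`t_n(p ⊗ u¹ ⊗ ⋯ ⊗ uⁿ) = p₍₀₎ u¹₊ ⊗ u²₊ ⊗ ⋯ ⊗ uⁿ₊ ⊗ uⁿ₋ ⋯ u¹₋ p₍₋₁₎`
(for `n = 0` this is `p ↦ p₍₀₎ p₍₋₁₎ = p`), obtained from `rotMap` by letting the first factor `U`
act on `P`, which is the last face map. -/
noncomputable def cyc (n : ℕ) : (P.Cn n).carrier →ₗ[k] (P.Cn n).carrier :=
  (H.dSucc P.toRMod n (Fin.last n)).toMap ∘ₗ P.rotMap n

lemma rotMap_zero (p : P.carrier) : P.rotMap 0 p = P.coactR p := rfl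

lemma rotMap_succ (n : ℕ) (c : (P.Cn n).carrier) (u : U) :
    P.rotMap (n + 1) (H.tm (P.Cn n) c u) = H.step (P.Cn n) (P.rotMap n c) u := by
  rw [rotMap, rotAux, H.indLift_tm]
  rfl

lemma rotMap_t (n : ℕ) (c : (P.Cn n).carrier) (a : A) :
    P.rotMap n ((P.Cn n).ract c (H.t (op a))) = H.lmulS (P.Cn n) a (P.rotMap n c) :=
  (P.rotAux n).2 c a

lemma dSucc_rotMap (n : ℕ) (i : Fin (n + 1)) (q : (P.Cn (n + 1)).carrier) :
    (H.dSucc P.toRMod (n + 1) i.castSucc).toMap (P.rotMap (n + 1) q) =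
      P.rotMap n (H.face P.toRMod n i.castSucc q) := by
  induction n with
  | zero =>
    obtain rfl : i = 0 := Fin.fin_one_eq_zero i
    induction q using H.ind_induction with
    | tm c u =>
      rw [rotMap_succ, Fin.castSucc_zero, H.dSucc_zero, H.face_zero,
        H.epsFun_tm, rotMap_t]
      exact H.mulFun_step _ _ _
    | add x y hx hy => simp only [map_add, hx, hy]
  | succ n ih =>
    induction q using H.ind_induction with
    | add x y hx hy => simp only [map_add, hx, hy]
    | tm c u =>
      rw [rotMap_succ]
      cases i using Fin.cases with
      | zero =>
        rw [Fin.castSucc_zero, H.dSucc_zero, H.face_zero,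
          H.epsFun_tm, rotMap_t]
        exact H.mulFun_step _ _ _
      | succ i =>
        rw [← Fin.succ_castSucc, H.face_succ, H.dSucc_succ]
        cases i using Fin.cases with
        | zero =>
          rw [Fin.castSucc_zero, H.dSucc_zero]
          change _ = P.rotMap (n + 1) (H.mulFun _ (H.tm _ c u))
          rw [H.mulFun_tm]
          induction c using H.ind_induction with
          | tm c v =>
            rw [H.ract_tm, rotMap_succ, rotMap_succ, H.step_mul]
            rfl
          | add x y hx hy => simp only [map_add, LinearMap.add_apply, hx, hy]
        | succ i =>
          cases n with
          | zero => exact i.elim0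
          | succ n =>
            rw [← Fin.succ_castSucc, H.dSucc_succ]
            change (STRing.THom.map _).mapFun _ =
              P.rotMap (n + 2) (STRing.THom.mapFun _ (H.tm _ c u))
            rw [STRing.THom.mapFun_tm, rotMap_succ, ← H.step_mapFun]
            have h := ih i.succ c
            rw [← Fin.succ_castSucc, H.face_succ] at h
            rw [← h]
            rfl

lemma epsFun_rotMap (n : ℕ) (q : (P.Cn n).carrier) : H.epsFun (P.Cn n) (P.rotMap n q) = q := by
  induction n with
  | zero => exact P.epsFun_coactR q
  | succ n ih =>
    induction q using H.ind_induction with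
    | tm c u => rw [rotMap_succ, H.epsFun_step, ih]
    | add x y hx hy => simp only [map_add, hx, hy]

lemma degen_rotMap (n : ℕ) (j : Fin (n + 1)) (q : (P.Cn n).carrier) :
    (H.degen P.toRMod n j).mapFun (P.rotMap n q) =
      P.rotMap (n + 1) ((H.degen P.toRMod n j).toMap q) := by
  induction n with
  | zero =>
    obtain rfl : j = 0 := Fin.fin_one_eq_zero j
    rw [H.degen_zero, H.unitMap_apply, rotMap_succ, H.step_one]
  | succ n ih =>
    cases j using Fin.cases with
    | zero => rw [H.degen_zero, H.unitMap_apply, rotMap_succ, H.step_one]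
    | succ j =>
      induction q using H.ind_induction with
      | tm c u =>
        rw [H.degen_succ, rotMap_succ, ← H.step_mapFun, ih, ← rotMap_succ]
        exact congrArg _ (STRing.THom.mapFun_tm _ c u).symm
      | add x y hx hy => simp only [map_add, hx, hy]

/-- `(x ⊗ y, q) ↦ q ⊗ x₊ ⊗ x₋ y` -/
noncomputable def transTen :
    U ⊗[k] (U ⊗[k] P.carrier) →ₗ[k] (H.ind (H.ind P.toRMod)).carrier :=
  TensorProduct.lift (H.insHG P.toRMod ∘ₗ TensorProduct.lift (H.hgR ∘ₗ H.trans)) ∘ₗ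
    (TensorProduct.assoc k U U P.carrier).symm.toLinearMap

lemma transTen_tmul (x y : U) (q : P.carrier) :
    P.transTen (x ⊗ₜ (y ⊗ₜ q)) =
      (H.ind (H.ind P.toRMod)).ract ((H.tmHom P.toRMod q).mapFun (H.trans x)) y := by
  change H.insHG P.toRMod (H.hgR (H.trans x) y) q = _
  rw [H.insHG_eq, STRing.THom.mapFun_ract]

lemma rotMap_coactR (p : P.carrier) :
    P.rotMap 1 (P.coactR p) = H.tm (H.ind P.toRMod) (P.coactR p) 1 := by
  obtain ⟨D, hD⟩ := exists_isLift H.comul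
  obtain ⟨E, hE⟩ := exists_isLift P.comod.coact
  have h := H.rel3_apply_eq P.transTen (by
      intro b x y q
      rw [transTen_tmul, transTen_tmul, H.trans_t_mul, STRing.THom.mapFun_ract,
        ← RMod.ract_mul]) (by
      intro b x y q
      rw [transTen_tmul, transTen_tmul, RMod.ract_mul, ← STRing.THom.mapFun_ract,
        ← H.trans_takeuchi, ← P.ract_t]
      congr 1
      rw [← H.insHG_eq, ← H.insHG_eq, ← H.insHG_t]) (P.comod.coassoc D E hD hE p)
  rw [P.coactR_eq p (E p) (hE p)]
  have h1 : ∀ X : U ⊗[k] P.carrier,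
      P.transTen (TensorProduct.assoc k U U P.carrier (D.rTensor P.carrier X)) =
      H.tm (H.ind P.toRMod) (TensorProduct.lift (H.tm P.toRMod).flip X) 1 := by
    intro X
    induction X using TensorProduct.induction_on with
    | zero => simp only [map_zero, LinearMap.zero_apply]
    | tmul v q =>
      rw [LinearMap.rTensor_tmul]
      change TensorProduct.lift _ ((TensorProduct.assoc k U U P.carrier).symm
        (TensorProduct.assoc k U U P.carrier (D v ⊗ₜ q))) = _
      rw [LinearEquiv.symm_apply_apply, TensorProduct.lift.tmul, LinearMap.comp_apply,
        H.trans_comul v (D v) (hD v), H.insHG_eq, H.mapFun_hg]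
      rfl
    | add x y hx hy => simp only [map_add, LinearMap.add_apply, hx, hy]
  have h2 : ∀ X : U ⊗[k] P.carrier, P.transTen (E.lTensor U X) =
      P.rotMap 1 (TensorProduct.lift (H.tm P.toRMod).flip X) := by
    intro X
    induction X using TensorProduct.induction_on with
    | zero => simp only [map_zero]
    | tmul v q =>
      have h3 : ∀ Y : U ⊗[k] P.carrier, P.transTen (v ⊗ₜ Y) =
          H.step P.toRMod (TensorProduct.lift (H.tm P.toRMod).flip Y) v := by
        intro Y
        induction Y using TensorProduct.induction_on with
        | zero => simp
        | tmul y q =>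
          rw [transTen_tmul]
          exact (H.step_tm P.toRMod q y v).symm
        | add c d hc hd =>
          rw [TensorProduct.tmul_add, map_add, hc, hd]
          simp only [map_add, LinearMap.add_apply]
      rw [LinearMap.lTensor_tmul, h3, ← P.coactR_eq q (E q) (hE q)]
      exact (P.rotMap_succ 0 q v).symm
    | add x y hx hy => simp only [map_add, hx, hy]
  rw [← h1, ← h2]
  exact h.symm

lemma rotMap_step (n : ℕ) (r : (P.Cn (n + 1)).carrier) (u : U) :
    P.rotMap (n + 2) (H.step (P.Cn n) r u) =
      (H.stepHom (P.Cn n) u).mapFun (P.rotMap (n + 1) r) := by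
  induction r using H.ind_induction with
  | tm c w =>
    have key : ∀ h : H.HG, P.rotMap (n + 2) ((H.tmHom (P.Cn n) c).mapFun h) =
        H.stepStep (P.Cn n) (P.rotMap n c) h := by
      intro h
      induction h using H.hg_induction with
      | tm x y =>
        rw [H.mapFun_hg, H.stepStep_hg, rotMap_succ, ← rotMap_succ]
        rfl
      | add a b ha hb => simp only [map_add, ha, hb]
    rw [H.step_tm, ← STRing.THom.mapFun_ract, key, H.stepStep_trans, rotMap_succ]
  | add a b ha hb => simp only [map_add, LinearMap.add_apply, ha, hb]

lemma rotMap_rotMap (n : ℕ) (q : (P.Cn n).carrier) :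
    P.rotMap (n + 1) (P.rotMap n q) = H.tm (P.Cn (n + 1)) (P.rotMap n q) 1 := by
  induction n with
  | zero => exact P.rotMap_coactR q
  | succ n ih =>
    induction q using H.ind_induction with
    | tm c u =>
      rw [rotMap_succ, rotMap_step, ih, STRing.THom.mapFun_tm]
      rfl
    | add a b ha hb => simp only [map_add, LinearMap.add_apply, ha, hb]

end SAYDModule

namespace SAYDModule

variable {H : HopfAlgebroid k A U} (P : SAYDModule H)

lemma cyc_apply (n : ℕ) (q : (P.Cn n).carrier) :
    P.cyc n q = (H.dSucc P.toRMod n (Fin.last n)).toMap (P.rotMap n q) := rfl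

lemma face_cyc (n : ℕ) (i : Fin (n + 1)) (q : (P.Cn (n + 1)).carrier) :
    H.face P.toRMod n i.succ (P.cyc (n + 1) q) = P.cyc n (H.face P.toRMod n i.castSucc q) := by
  rw [H.face_succ, cyc_apply, cyc_apply, ← Fin.succ_last,
    H.dSucc_dSucc P.toRMod n i (Fin.last n) (Fin.le_last i), dSucc_rotMap]

lemma face_zero_cyc (n : ℕ) (q : (P.Cn (n + 1)).carrier) :
    H.face P.toRMod n 0 (P.cyc (n + 1) q) = H.face P.toRMod n (Fin.last (n + 1)) q := by
  rw [H.face_zero, cyc_apply, ← Fin.succ_last, H.dSucc_succ, H.face_succ]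
  refine (H.epsFun_mapFun _ _).trans ?_
  rw [epsFun_rotMap]

lemma degen_cyc (n : ℕ) (i : Fin (n + 1)) (q : (P.Cn (n + 1)).carrier) :
    (H.degen P.toRMod (n + 1) i.succ).toMap (P.cyc (n + 1) q) =
      P.cyc (n + 2) ((H.degen P.toRMod (n + 1) i.castSucc).toMap q) := by
  rw [cyc_apply, cyc_apply, ← H.dSucc_degen_gt P.toRMod (n + 1) (Fin.last (n + 1)) i.succ
    (Fin.le_last _), ← Fin.succ_castSucc, H.degen_succ, Fin.succ_last]
  congr 1
  exact P.degen_rotMap (n + 1) i.castSucc q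

lemma cyc_degen_last (n : ℕ) (q : (P.Cn n).carrier) :
    P.cyc (n + 1) ((H.degen P.toRMod n (Fin.last n)).toMap q) = P.rotMap n q := by
  rw [cyc_apply, ← degen_rotMap, ← Fin.succ_last]
  exact STRing.THom.mapFun_id _ _ (H.dSucc_degen_self' P.toRMod n (Fin.last n)) _

lemma degen_zero_cyc (n : ℕ) (q : (P.Cn n).carrier) :
    (H.degen P.toRMod n 0).toMap (P.cyc n q) =
      P.cyc (n + 1) (P.cyc (n + 1) ((H.degen P.toRMod n (Fin.last n)).toMap q)) := by
  rw [cyc_degen_last, cyc_apply, cyc_apply, rotMap_rotMap, H.degen_zero, ← Fin.succ_last]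
  exact (STRing.THom.mapFun_tm _ _ _).symm

/-! ### The identity `t_n^{n+1} = id` -/

lemma cyc_zero (p : (P.Cn 0).carrier) : P.cyc 0 p = p := P.stable p

lemma cyc_one (p : P.carrier) (x : U) :
    P.cyc 1 (H.tm P.toRMod p x) = H.rot P.toRMod x (P.coactR p) := by
  rw [cyc_apply, ← Fin.succ_last]
  exact congrArg _ (P.rotMap_succ 0 p x)

lemma cyc_succ (n : ℕ) (c : (P.Cn (n + 1)).carrier) (x : U) :
    P.cyc (n + 2) (H.tm (P.Cn (n + 1)) c x) = H.step (P.Cn n) (P.cyc (n + 1) c) x := by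
  rw [cyc_apply, cyc_apply, rotMap_succ, ← Fin.succ_last, H.dSucc_succ, ← Fin.succ_last n,
    H.dSucc_succ]
  exact (H.step_mapFun _ _ _).symm

/-- `c ⊗ w ↦ c u₊ ⊗ u₋ w` as a map of right modules. -/
noncomputable def rotHom (H : HopfAlgebroid k A U) (M : RMod k U) (u : U) :
    H.THom (H.ind M) (H.ind M) where
  toMap := H.rot M u
  map_t q _ := H.rot_ract M u _ q

/-- The operator on `C_{n+1}` which inserts `u₊` and `u₋` in two neighbouring factors; the factors
are counted from the right. -/
noncomputable def ins (u : U) : (n : ℕ) → Fin (n + 1) → H.THom (P.Cn (n + 1)) (P.Cn (n + 1))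
  | 0, _ => rotHom H (P.Cn 0) u
  | n + 1, i => Fin.cases (rotHom H (P.Cn (n + 1)) u) (fun j => (ins u n j).map) i

lemma ins_zero (u : U) (n : ℕ) : P.ins u n 0 = rotHom H (P.Cn n) u := by
  cases n <;> rfl

lemma ins_succ (u : U) (n : ℕ) (j : Fin (n + 1)) : P.ins u (n + 1) j.succ = (P.ins u n j).map := rfl

lemma cyc_ract (n : ℕ) (c : (P.Cn (n + 1)).carrier) (u : U) :
    P.cyc (n + 1) ((P.Cn (n + 1)).ract c u) = (P.ins u n 0).toMap (P.cyc (n + 1) c) := by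
  rw [ins_zero]
  change _ = H.rot _ u _
  induction c using H.ind_induction with
  | tm c x =>
    rw [H.ract_tm]
    cases n with
    | zero =>
      refine (P.cyc_one c (x * u)).trans ?_
      rw [H.rot_mul]
      exact congrArg _ (P.cyc_one c x).symm
    | succ n => rw [cyc_succ, cyc_succ, H.step_mul]
  | add a b ha hb => simp only [map_add, LinearMap.add_apply, ha, hb]

lemma cyc_ins (u : U) (n : ℕ) (j : Fin (n + 1)) (c : (P.Cn (n + 2)).carrier) :
    P.cyc (n + 2) ((P.ins u (n + 1) j.castSucc).toMap c) =
      (P.ins u (n + 1) j.succ).toMap (P.cyc (n + 2) c) := by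
  have base : ∀ (n : ℕ) (c : (P.Cn (n + 2)).carrier),
      P.cyc (n + 2) ((P.ins u (n + 1) 0).toMap c) =
        (P.ins u (n + 1) (Fin.succ 0)).toMap (P.cyc (n + 2) c) := by
    intro n c
    rw [ins_succ, ins_zero, ins_zero]
    change P.cyc (n + 2) (H.rot _ u c) = (rotHom H (P.Cn n) u).mapFun _
    induction c using H.ind_induction with
    | tm c x =>
      have key : ∀ h : H.HG, P.cyc (n + 2) ((H.actHom (P.Cn (n + 1)) c).mapFun h) =
          (H.mulMap (P.Cn n)).map.mapFun (H.stepStep (P.Cn n) (P.cyc (n + 1) c) h) := by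
        intro h
        induction h using H.hg_induction with
        | tm y z =>
          rw [H.mapFun_hg, H.stepStep_hg, cyc_succ, ← H.step_mapFun]
          congr 2
          have := P.cyc_ract n c y
          rw [ins_zero] at this
          exact this
        | add a b ha hb => simp only [map_add, ha, hb]
      rw [H.rot_tm, ← STRing.THom.mapFun_ract, key, H.stepStep_trans, cyc_succ]
      exact STRing.THom.mapFun_comp _ _ _ (fun _ => rfl) _
    | add a b ha hb => simp only [map_add, ha, hb]
  induction n with
  | zero =>
    obtain rfl : j = 0 := Fin.fin_one_eq_zero j
    exact base 0 c
  | succ n ih =>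
    cases j using Fin.cases with
    | zero => exact base (n + 1) c
    | succ j =>
      induction c using H.ind_induction with
      | tm c x =>
        rw [← Fin.succ_castSucc, ins_succ, ins_succ]
        change P.cyc (n + 3) (STRing.THom.mapFun _ (H.tm _ c x)) = STRing.THom.mapFun _ _
        rw [STRing.THom.mapFun_tm, cyc_succ, cyc_succ, ih, ins_succ]
        exact H.step_mapFun _ _ _
      | add a b ha hb => simp only [map_add, ha, hb]

lemma coactR_ract_trans (p : P.carrier) (u : U) (f : H.HG →ₗ[k] (H.ind P.toRMod).carrier)
    (hf : ∀ x y, f (H.hg x y) = H.rot P.toRMod y (P.coactR (P.ract p x))) :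
    f (H.trans u) = (H.ind P.toRMod).ract (P.coactR p) u := by
  let g : H.Ten →ₗ[k] (H.ind P.toRMod).carrier := H.tenLift
    ((H.ind P.toRMod).ract ∘ₗ (H.mulMap P.toRMod).mapFun ∘ₗ
        H.step P.toRMod (P.coactR p)).flip (by
      intro a x y
      change (H.ind P.toRMod).ract (H.rot P.toRMod y (P.coactR p)) (H.t (op a) * x) =
        (H.ind P.toRMod).ract (H.rot P.toRMod (H.s a * y) (P.coactR p)) x
      have hs : H.rot P.toRMod (H.s a) (P.coactR p) = (P.sMap a).mapFun (P.coactR p) := by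
        generalize P.coactR p = q
        induction q using H.ind_induction with
        | tm m w =>
          rw [H.rot_s, STRing.THom.mapFun_tm]
          rfl
        | add a b ha hb => simp only [map_add, ha, hb]
      rw [H.rot_mul, hs, P.coactR_takeuchi, H.rot_ract, RMod.ract_mul])
  have hg : ∀ x y, g (H.cls (x ⊗ₜ y)) =
      (H.ind P.toRMod).ract (H.rot P.toRMod y (P.coactR p)) x := by
    intro x y
    rw [H.tenLift_cls]
    rfl
  have hg1 : ∀ X : U ⊗[k] U, g (H.cls X) = TensorProduct.lift
      ((H.ind P.toRMod).ract ∘ₗ (H.mulMap P.toRMod).mapFun ∘ₗ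
        H.step P.toRMod (P.coactR p)).flip X := fun X => H.tenLift_cls _ _ X
  have key2 : ∀ (q : H.Ten) (y : U), g (H.rmul q (1 ⊗ₜ y)) = H.rot P.toRMod y (g q) := by
    intro q y
    induction q using H.ten_induction with
    | tm a b =>
      rw [H.rmul_cls, Algebra.TensorProduct.tmul_mul_tmul, mul_one, hg, hg, H.rot_mul,
        H.rot_ract]
    | add a b ha hb => simp only [map_add, LinearMap.add_apply, ha, hb]
  have key : ∀ h, f h = g (H.galois h) := by
    intro h
    induction h using H.hg_induction with
    | tm x y =>
      obtain ⟨X, hX⟩ := H.cls_surj (H.comul x)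
      rw [hf, H.galois_hg, key2, ← hX, hg1, P.ayd p x X hX]
    | add a b ha hb => simp only [map_add, ha, hb]
  rw [key, H.galois_trans, hg, H.rot_one]

lemma cyc_ins_last (u : U) (n : ℕ) (c : (P.Cn (n + 1)).carrier) :
    P.cyc (n + 1) ((P.ins u n (Fin.last n)).toMap c) =
      (P.Cn (n + 1)).ract (P.cyc (n + 1) c) u := by
  induction n with
  | zero =>
    induction c using H.ind_induction with
    | tm p x =>
      have h := P.coactR_ract_trans p u (P.cyc 1 ∘ₗ (H.actHom P.toRMod p).mapFun) (by
        intro x y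
        rw [LinearMap.comp_apply, H.mapFun_hg]
        exact P.cyc_one _ y)
      have hr : ∀ q : (H.ind P.toRMod).carrier,
          P.cyc 1 ((H.ind P.toRMod).ract q x) = H.rot P.toRMod x (P.cyc 1 q) := by
        intro q
        have := P.cyc_ract 0 q x
        rw [ins_zero] at this
        exact this
      change P.cyc 1 (H.rot P.toRMod u (H.tm P.toRMod p x)) =
        (H.ind P.toRMod).ract (P.cyc 1 (H.tm P.toRMod p x)) u
      rw [H.rot_tm, hr]
      change H.rot P.toRMod x ((P.cyc 1 ∘ₗ (H.actHom P.toRMod p).mapFun) (H.trans u)) = _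
      rw [h, cyc_one, H.rot_ract]
    | add a b ha hb => simp only [map_add, LinearMap.add_apply, ha, hb]
  | succ n ih =>
    induction c using H.ind_induction with
    | tm c x =>
      rw [← Fin.succ_last, ins_succ]
      change P.cyc (n + 2) (STRing.THom.mapFun _ (H.tm _ c x)) = _
      rw [STRing.THom.mapFun_tm, cyc_succ, cyc_succ, ih]
      exact H.step_ract _ _ _ _
    | add a b ha hb => simp only [map_add, LinearMap.add_apply, ha, hb]

lemma cyc_pow_ract (n : ℕ) (c : (P.Cn (n + 1)).carrier) (u : U) :
    (P.cyc (n + 1) ^ (n + 2)) ((P.Cn (n + 1)).ract c u) =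
      (P.Cn (n + 1)).ract ((P.cyc (n + 1) ^ (n + 2)) c) u := by
  have key : ∀ j (hj : j < n + 1), (P.cyc (n + 1) ^ (j + 1)) ((P.Cn (n + 1)).ract c u) =
      (P.ins u n ⟨j, hj⟩).toMap ((P.cyc (n + 1) ^ (j + 1)) c) := by
    intro j
    induction j with
    | zero =>
      intro hj
      rw [pow_one]
      exact P.cyc_ract n c u
    | succ j ih =>
      intro hj
      rw [pow_succ', Module.End.mul_apply, ih (by omega), Module.End.mul_apply]
      cases n with
      | zero => omega
      | succ n => exact P.cyc_ins u n ⟨j, by omega⟩ _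
  rw [pow_succ', Module.End.mul_apply, key n (by omega), Module.End.mul_apply]
  exact P.cyc_ins_last u n _

lemma cyc_pow (n : ℕ) : P.cyc n ^ (n + 1) = 1 := by
  induction n with
  | zero =>
    ext q
    rw [pow_one]
    exact P.cyc_zero q
  | succ n ih =>
    have h0 : ∀ c : (P.Cn n).carrier, (P.cyc (n + 1) ^ (n + 2))
        ((H.degen P.toRMod n 0).toMap c) = (H.degen P.toRMod n 0).toMap c := by
      intro c
      have key : ∀ j (hj : j < n + 1), (P.cyc (n + 1) ^ j) ((H.degen P.toRMod n 0).toMap c) =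
          (H.degen P.toRMod n ⟨j, hj⟩).toMap ((P.cyc n ^ j) c) := by
        intro j
        induction j with
        | zero => intro hj; rfl
        | succ j ih =>
          intro hj
          rw [pow_succ', Module.End.mul_apply, ih (by omega), pow_succ', Module.End.mul_apply]
          cases n with
          | zero => omega
          | succ n => exact (P.degen_cyc n ⟨j, by omega⟩ _).symm
      rw [pow_succ', pow_succ', Module.End.mul_apply, Module.End.mul_apply, key n (by omega)]
      refine (P.degen_zero_cyc n _).symm.trans ?_
      rw [← Module.End.mul_apply, ← pow_succ', ih]
      rfl
    ext q
    rw [Module.End.one_apply]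
    induction q using H.ind_induction with
    | tm c u =>
      have h1 : H.tm (P.Cn n) c u = (P.Cn (n + 1)).ract ((H.degen P.toRMod n 0).toMap c) u := by
        rw [H.degen_zero, H.unitMap_apply, H.ract_tm, one_mul]
      rw [h1, cyc_pow_ract, h0]
    | add a b ha hb => rw [map_add, ha, hb]

end SAYDModule

end Main

/-! ## Cyclic modules, Hochschild homology and cyclic homology -/

/-- A cyclic `k`-vector space. -/
structure CyclicModule (k : Type*) [Field k] where
  X : ℕ → Type u
  [addCommGroup : ∀ n, AddCommGroup (X n)]
  [module : ∀ n, Module k (X n)]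
  /-- the face maps -/
  d : ∀ n, Fin (n + 2) → X (n + 1) →ₗ[k] X n
  /-- the degeneracy maps -/
  s : ∀ n, Fin (n + 1) → X n →ₗ[k] X (n + 1)
  /-- the cyclic operators -/
  t : ∀ n, X n →ₗ[k] X n
  d_d : ∀ n (i j : Fin (n + 2)), i ≤ j → ∀ q,
    d n i (d (n + 1) j.succ q) = d n j (d (n + 1) i.castSucc q)
  s_s : ∀ n (i j : Fin (n + 1)), i ≤ j → ∀ q,
    s (n + 1) i.castSucc (s n j q) = s (n + 1) j.succ (s n i q)
  d_s_of_le : ∀ n (i : Fin (n + 2)) (j : Fin (n + 1)), i ≤ j.castSucc → ∀ q,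
    d (n + 1) i.castSucc (s (n + 1) j.succ q) = s n j (d n i q)
  d_s_castSucc : ∀ n (i : Fin (n + 1)) q, d n i.castSucc (s n i q) = q
  d_s_succ : ∀ n (i : Fin (n + 1)) q, d n i.succ (s n i q) = q
  d_s_of_gt : ∀ n (i : Fin (n + 2)) (j : Fin (n + 1)), j.castSucc < i → ∀ q,
    d (n + 1) i.succ (s (n + 1) j.castSucc q) = s n j (d n i q)
  d_t : ∀ n (i : Fin (n + 1)) q, d n i.succ (t (n + 1) q) = t n (d n i.castSucc q)
  d_zero_t : ∀ n q, d n 0 (t (n + 1) q) = d n (Fin.last (n + 1)) q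
  s_t : ∀ n (i : Fin (n + 1)) q, s (n + 1) i.succ (t (n + 1) q) = t (n + 2) (s (n + 1) i.castSucc q)
  s_zero_t : ∀ n q, s n 0 (t n q) = t (n + 1) (t (n + 1) (s n (Fin.last n) q))
  t_pow : ∀ n, t n ^ (n + 1) = 1

attribute [instance] CyclicModule.addCommGroup CyclicModule.module

/-- A morphism of cyclic modules. -/
@[ext]
structure CyclicModule.Hom {k : Type*} [Field k] (X Y : CyclicModule k) where
  f : ∀ n, X.X n →ₗ[k] Y.X n
  f_d : ∀ n i q, f n (X.d n i q) = Y.d n i (f (n + 1) q)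
  f_s : ∀ n i q, f (n + 1) (X.s n i q) = Y.s n i (f n q)
  f_t : ∀ n q, f n (X.t n q) = Y.t n (f n q)

section Homology

variable {k : Type*} [Field k] {Z Z' : ℕ → Type*} [∀ n, AddCommGroup (Z n)] [∀ n, Module k (Z n)]
  [∀ n, AddCommGroup (Z' n)] [∀ n, Module k (Z' n)]

/-- The cycles of a non-negatively graded chain complex. -/
def cycles (δ : ∀ n, Z (n + 1) →ₗ[k] Z n) : ∀ n, Submodule k (Z n)
  | 0 => ⊤
  | n + 1 => LinearMap.ker (δ n)

/-- The homology (cycles modulo boundaries) of a non-negatively graded chain complex. -/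
abbrev Homology (δ : ∀ n, Z (n + 1) →ₗ[k] Z n) (n : ℕ) : Type _ :=
  cycles δ n ⧸ (LinearMap.range (δ n)).comap (cycles δ n).subtype

/-- The homology class of a cycle. -/
def Homology.mk (δ : ∀ n, Z (n + 1) →ₗ[k] Z n) (n : ℕ) (z : Z n) (hz : z ∈ cycles δ n) :
    Homology δ n := Submodule.Quotient.mk ⟨z, hz⟩

/-- The map `φ` on homology is induced by the map `f` on chains: `f` sends cycles to cycles, and
`φ` sends the class of `z` to the class of `f z`. -/
def IsInduced (δ : ∀ n, Z (n + 1) →ₗ[k] Z n) (δ' : ∀ n, Z' (n + 1) →ₗ[k] Z' n) {n : ℕ}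
    (f : Z n →ₗ[k] Z' n) (φ : Homology δ n →ₗ[k] Homology δ' n) : Prop :=
  ∀ z (hz : z ∈ cycles δ n), ∃ hz' : f z ∈ cycles δ' n,
    φ (Homology.mk δ n z hz) = Homology.mk δ' n (f z) hz'

end Homology

namespace CyclicModule

variable {k : Type*} [Field k] (X : CyclicModule.{u} k)

/-- The Hochschild boundary `b = ∑_{i ≤ n + 1} (-1)^i d_i`. -/
def b (n : ℕ) : X.X (n + 1) →ₗ[k] X.X n := ∑ i : Fin (n + 2), (-1 : k) ^ (i : ℕ) • X.d n i

/-- `b' = ∑_{i ≤ n} (-1)^i d_i`, where the last face is omitted. -/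
def bPrime (n : ℕ) : X.X (n + 1) →ₗ[k] X.X n :=
  ∑ i : Fin (n + 1), (-1 : k) ^ (i : ℕ) • X.d n i.castSucc

/-- The signed cyclic operator `λ = (-1)^n t_n`. -/
def signedT (n : ℕ) : X.X n →ₗ[k] X.X n := (-1 : k) ^ n • X.t n

/-- The norm operator `N = ∑_{i ≤ n} λ^i`. -/
def normOp (n : ℕ) : X.X n →ₗ[k] X.X n := ∑ i : Fin (n + 1), X.signedT n ^ (i : ℕ)

/-- Degree `n` of the total complex of the cyclic bicomplex, which has `X_q` in each position
`(p, q)`, `p, q ≥ 0`. -/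
abbrev Tot (n : ℕ) : Type u := ∀ q : Fin (n + 1), X.X q

/-- The differential of the total complex of the cyclic bicomplex: the columns with `p` even are
the complexes `(X, b)`, those with `p` odd are the complexes `(X, -b')`; the horizontal
differentials are `1 - λ` from odd to even columns, and `N` from even to odd columns. -/
def totD (n : ℕ) : X.Tot (n + 1) →ₗ[k] X.Tot n :=
  LinearMap.pi fun q : Fin (n + 1) =>
    if Even (n - q : ℕ) then
      X.b q ∘ₗ LinearMap.proj (φ := fun q : Fin (n + 2) => X.X q) q.succ +
        (1 - X.signedT q) ∘ₗ LinearMap.proj (φ := fun q : Fin (n + 2) => X.X q) q.castSucc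
    else
      - X.bPrime q ∘ₗ LinearMap.proj (φ := fun q : Fin (n + 2) => X.X q) q.succ +
        X.normOp q ∘ₗ LinearMap.proj (φ := fun q : Fin (n + 2) => X.X q) q.castSucc

/-- The Hochschild homology `HH_n`. -/
abbrev HH (n : ℕ) : Type u := Homology X.b n

/-- The cyclic homology `HC_n`. -/
abbrev HC (n : ℕ) : Type u := Homology X.totD n

end CyclicModule

/-- The map on the total complexes of the cyclic bicomplexes. -/
def CyclicModule.Hom.tot {k : Type*} [Field k] {X Y : CyclicModule k} (F : X.Hom Y) (n : ℕ) :
    X.Tot n →ₗ[k] Y.Tot n :=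
  LinearMap.pi fun q : Fin (n + 1) =>
    F.f q ∘ₗ LinearMap.proj (φ := fun q : Fin (n + 1) => X.X q) q

/-- The cyclic module `C_•(U; P)`. -/
noncomputable def SAYDModule.cyclicModule {k A : Type*} {U : Type u} [Field k] [Ring A]
    [Algebra k A] [Ring U] [Algebra k U] {H : HopfAlgebroid k A U} (P : SAYDModule H) :
    CyclicModule.{u} k where
  X n := (P.Cn n).carrier
  d n i := H.face P.toRMod n i
  s n i := (H.degen P.toRMod n i).toMap
  t n := P.cyc n
  d_d := H.face_face P.toRMod
  s_s := H.degen_degen P.toRMod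
  d_s_of_le := H.face_degen_le P.toRMod
  d_s_castSucc := H.face_degen_self P.toRMod
  d_s_succ := H.face_degen_self' P.toRMod
  d_s_of_gt := H.face_degen_gt P.toRMod
  d_t := P.face_cyc
  d_zero_t := P.face_zero_cyc
  s_t := P.degen_cyc
  s_zero_t := P.degen_zero_cyc
  t_pow := P.cyc_pow

/-! ## Measurings -/

/-- A right comodule over a coalgebra. -/
structure RightComodule (k C D : Type*) [Field k] [AddCommGroup C] [Module k C] [Coalgebra k C]
    [AddCommGroup D] [Module k D] where
  /-- the coaction `y ↦ y₍₀₎ ⊗ y₍₁₎` -/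
  coact : D →ₗ[k] D ⊗[k] C
  coassoc : ∀ y, TensorProduct.assoc k D C C (coact.rTensor C (coact y)) =
    (Coalgebra.comul (R := k) (A := C)).lTensor D (coact y)
  counit : ∀ y, TensorProduct.rid k D ((Coalgebra.counit (R := k) (A := C)).lTensor D (coact y)) = y

section Measuring

variable {k C D A A' U U' : Type*} [Field k] [AddCommGroup C] [Module k C] [Coalgebra k C]
  [AddCommGroup D] [Module k D] [Ring A] [Algebra k A] [Ring A'] [Algebra k A']
  [Ring U] [Algebra k U] [Ring U'] [Algebra k U']

/-- A coalgebra measuring of algebras. -/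
structure IsMeasuring {R R' : Type*} [Ring R] [Algebra k R] [Ring R'] [Algebra k R']
    (ψ : C →ₗ[k] R →ₗ[k] R') : Prop where
  /-- `ψ(x)(a b) = ψ(x₍₁₎)(a) ψ(x₍₂₎)(b)` -/
  map_mul : ∀ x a b, ψ x (a * b) =
    TensorProduct.lift ((LinearMap.mul k R').compl₁₂ (ψ.flip a) (ψ.flip b)) (Coalgebra.comul x)
  map_one : ∀ x, ψ x 1 = Coalgebra.counit (R := k) x • (1 : R')

/-- A measuring of Hopf algebroids. -/
structure IsHopfMeasuring (H : HopfAlgebroid k A U) (H' : HopfAlgebroid k A' U')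
    (Ψ : C →ₗ[k] U →ₗ[k] U') (ψ : C →ₗ[k] A →ₗ[k] A') : Prop where
  measuring : IsMeasuring Ψ
  measuring_base : IsMeasuring ψ
  map_s : ∀ x a, Ψ x (H.s a) = H'.s (ψ x a)
  map_t : ∀ x a, Ψ x (H.t (op a)) = H'.t (op (ψ x a))
  map_S : ∀ x u, Ψ x (H.S u) = H'.S (Ψ x u)
  map_counit : ∀ x u, ψ x (H.counit u) = H'.counit (Ψ x u)
  /-- `Δ'(Ψ(x)(u)) = Ψ(x₍₁₎)(u₍₁₎) ⊗ Ψ(x₍₂₎)(u₍₂₎)` -/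
  map_comul : ∀ x u X, H.cls X = H.comul u → H'.comul (Ψ x u) =
    H'.cls (TensorProduct.homTensorHomMap (RingHom.id k) U U U' U'
      (TensorProduct.map Ψ Ψ (Coalgebra.comul x)) X)

/-- A comodule measuring of stable anti-Yetter-Drinfeld modules over a measuring of Hopf
algebroids. -/
structure IsComoduleMeasuring {H : HopfAlgebroid k A U} {H' : HopfAlgebroid k A' U'}
    (P : SAYDModule H) (P' : SAYDModule H') (ρ : RightComodule k C D)
    (Ψ : C →ₗ[k] U →ₗ[k] U') (Ω : D →ₗ[k] P.carrier →ₗ[k] P'.carrier) : Prop where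
  /-- `Ω(y)(p u) = Ω(y₍₀₎)(p) Ψ(y₍₁₎)(u)` -/
  map_ract : ∀ y p u, Ω y (P.ract p u) =
    TensorProduct.lift (P'.ract.compl₁₂ (Ω.flip p) (Ψ.flip u)) (ρ.coact y)
  /-- `Δ_{P'}(Ω(y)(p)) = Ψ(y₍₁₎)(p₍₋₁₎) ⊗ Ω(y₍₀₎)(p₍₀₎)` -/
  map_coact : ∀ y p X, (balRel _ _).mkQ X = P.comod.coact p → P'.comod.coact (Ω y p) =
    (balRel _ _).mkQ (TensorProduct.homTensorHomMap (RingHom.id k) U P.carrier U' P'.carrier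
      (TensorProduct.map Ψ Ω (TensorProduct.comm k D C (ρ.coact y))) X)

/-- `y ↦ Ω(y₍₀₎)(p) ⊗ Ψ(y₍₁₎)(u¹) ⊗ ⋯ ⊗ Ψ(y₍ₙ₎)(uⁿ) ∈ P' ⊗_{A'^op} U' ⊗_{A'^op} ⋯ ⊗_{A'^op} U'`,
where `y₍₀₎ ⊗ y₍₁₎ ⊗ ⋯ ⊗ y₍ₙ₎` is the iterated coaction. -/
def measuredTensor (B : STRing k A' U') {P : Type*} [AddCommGroup P] [Module k P] (P' : RMod k U')
    (ρ : RightComodule k C D) (Ψ : C →ₗ[k] U →ₗ[k] U') (Ω : D →ₗ[k] P →ₗ[k] P'.carrier) (p : P) :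
    (n : ℕ) → (Fin n → U) → D →ₗ[k] (B.C P' n).carrier
  | 0, _ => Ω.flip p
  | n + 1, u => TensorProduct.lift ((B.tm (B.C P' n)).compl₁₂
      (measuredTensor B P' ρ Ψ Ω p n (Fin.init u)) (Ψ.flip (u (Fin.last n)))) ∘ₗ ρ.coact

end Measuring

end HopfAlgebroids

open scoped TensorProduct
open HopfAlgebroids

namespace HopfAlgebroids

/-! ## Convolution along a coaction -/

namespace RightComodule

/-! The argument keeps the algebraic elements fixed and lets `y` vary. For fixed `p` and `u`, a
measuring is a linear map out of `D` or `C`, and an expression such as `Ω(y₍₀₎)(p) ⊗ Ψ(y₍₁₎)(u)` is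
a convolution of two such maps along the coaction. The axioms of `C` and `D` then become rules for
convolutions: coassociativity moves brackets (`conv_assoc`), the counit removes a factor of the form
`ε_C(x) v` (`conv_counit`), and cocommutativity exchanges two neighbouring legs (`conv_comm`,
`conv_swap`).

Only the product rule `Θ(y)(m u) = Θ(y₍₀₎)(m) Ψ(y₍₁₎)(u)` is needed to pass from a right `U`-module
`M` to `M ⊗_{A^op} U`. The relation `m t(a) ⊗ u = m ⊗ t(a) u` is respected because `t(a)` sits
between the two factors, so its image `t'(ψ(y₍₁₎)(a))` can be moved across the tensor sign of the
target. The result satisfies the same product rule, and iterating from `Ω` gives the maps on all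
`C_n`. Faces and degeneracies are composed of the multiplication, the counit, the unit and the
functor `- ⊗_{A^op} U`, and each of these is compatible with the induced measurings.

The cyclic operator is the substantial point, because it contains the translation map `u ↦ u₊ ⊗ u₋`,
which is defined through the inverse of the Hopf-Galois map `β`. A measuring respects products and
coproducts and therefore intertwines `β` with `β'` (`galois_indMeasuring`). It sends `u ⊗ 1` to
`Ψ(x)(u) ⊗ 1`, so injectivity of `β'` gives compatibility with the translation map
(`indMeasuring_trans`). Up to the last face, `t_n` arises from the coaction of `P` by repeated use
of `(m ⊗ w, u) ↦ m ⊗ u₊ ⊗ u₋ w`. There `u` is the last argument, but its components stand before `w`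
in the output; cocommutativity compensates for this change of order (`indMeasuring_step`).
Cocommutativity is also what makes the measuring of `U ⊗_A U` well defined, since there `A` acts
from the left on both factors.

Uniqueness holds because elementary tensors determine a linear map on `C_n`. The statements on
homology follow from functoriality, applied to the Hochschild complex and to the total complex of
the cyclic bicomplex. -/

/-- A coalgebra as a right comodule over itself. -/
def self (k C : Type*) [Field k] [AddCommGroup C] [Module k C] [Coalgebra k C] :
    RightComodule k C C where
  coact := Coalgebra.comul
  coassoc := Coalgebra.coassoc_apply
  counit y := by simp

section Conv

variable {k C D X Y Z W V V' : Type*} [Field k] [AddCommGroup C] [Module k C] [Coalgebra k C]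
  [AddCommGroup D] [Module k D] [AddCommGroup X] [Module k X] [AddCommGroup Y] [Module k Y]
  [AddCommGroup Z] [Module k Z] [AddCommGroup W] [Module k W] [AddCommGroup V] [Module k V]
  [AddCommGroup V'] [Module k V']

/-- The convolution `y ↦ φ (f y₍₀₎) (g y₍₁₎)`. -/
def conv (ρ : RightComodule k C D) (φ : X →ₗ[k] Y →ₗ[k] Z) :
    (D →ₗ[k] X) →ₗ[k] (C →ₗ[k] Y) →ₗ[k] D →ₗ[k] Z :=
  LinearMap.mk₂ k (fun f g => TensorProduct.lift (φ.compl₁₂ f g) ∘ₗ ρ.coact)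
    (by
      intro f f' g
      rw [← LinearMap.add_comp]
      congr 1
      ext; simp)
    (by
      intro c f g
      rw [← LinearMap.smul_comp]
      congr 1
      ext; simp)
    (by
      intro f g g'
      rw [← LinearMap.add_comp]
      congr 1
      ext; simp)
    (by
      intro c f g
      rw [← LinearMap.smul_comp]
      congr 1
      ext; simp)

lemma conv_apply (ρ : RightComodule k C D) (φ : X →ₗ[k] Y →ₗ[k] Z) (f : D →ₗ[k] X)
    (g : C →ₗ[k] Y) (y : D) :
    ρ.conv φ f g y = TensorProduct.lift (φ.compl₁₂ f g) (ρ.coact y) := rfl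

/-- A convolution sees its three arguments only through the combined pairing on `D × C`. This allows
linear maps such as `s'`, `t'` or the translation map to be moved from the convolved functions into
the pairing. -/
lemma conv_congr (ρ : RightComodule k C D) {X' Y' : Type*} [AddCommGroup X'] [Module k X']
    [AddCommGroup Y'] [Module k Y'] {φ : X →ₗ[k] Y →ₗ[k] Z} {φ' : X' →ₗ[k] Y' →ₗ[k] Z}
    {f : D →ₗ[k] X} {f' : D →ₗ[k] X'} {g : C →ₗ[k] Y} {g' : C →ₗ[k] Y'}
    (h : ∀ d c, φ (f d) (g c) = φ' (f' d) (g' c)) : ρ.conv φ f g = ρ.conv φ' f' g' := by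
  change TensorProduct.lift _ ∘ₗ _ = TensorProduct.lift _ ∘ₗ _
  congr 2
  ext d c
  exact h d c

lemma map_conv (ρ : RightComodule k C D) (F : Z →ₗ[k] W) (φ : X →ₗ[k] Y →ₗ[k] Z)
    (f : D →ₗ[k] X) (g : C →ₗ[k] Y) (y : D) :
    F (ρ.conv φ f g y) = ρ.conv (φ.compr₂ F) f g y := by
  rw [conv_apply, conv_apply]
  induction ρ.coact y using TensorProduct.induction_on with
  | zero => simp
  | tmul d c => simp
  | add a b ha hb => simp only [map_add, ha, hb]

/-- Both sides evaluate one linear map on `D ⊗ C ⊗ C`, the left one at the twice iterated coaction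
of `D`, the right one at the coaction followed by the coproduct of `C`; coassociativity of the
comodule identifies the two tensors. In applications `hφ` is an associativity law or a balancing
relation in the target. -/
lemma conv_assoc (ρ : RightComodule k C D) (φ : V →ₗ[k] Z →ₗ[k] W) (ψ : X →ₗ[k] Y →ₗ[k] V)
    (φ' : X →ₗ[k] V' →ₗ[k] W) (ψ' : Y →ₗ[k] Z →ₗ[k] V')
    (hφ : ∀ x y z, φ (ψ x y) z = φ' x (ψ' y z))
    (f : D →ₗ[k] X) (g : C →ₗ[k] Y) (h : C →ₗ[k] Z) :
    ρ.conv φ (ρ.conv ψ f g) h = ρ.conv φ' f ((self k C).conv ψ' g h) := by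
  -- The common map is `d ⊗ c ⊗ c' ↦ φ' (f d) (ψ' (g c) (h c'))`.
  let L : D ⊗[k] (C ⊗[k] C) →ₗ[k] W :=
    TensorProduct.lift (φ'.compl₁₂ f (TensorProduct.lift (ψ'.compl₁₂ g h)))
  have h1 : ∀ w : D ⊗[k] C, TensorProduct.lift (φ.compl₁₂ (ρ.conv ψ f g) h) w =
      L (TensorProduct.assoc k D C C (ρ.coact.rTensor C w)) := by
    intro w
    induction w using TensorProduct.induction_on with
    | zero => simp only [map_zero]
    | tmul d c =>
      rw [TensorProduct.lift.tmul, LinearMap.compl₁₂_apply, conv_apply, LinearMap.rTensor_tmul]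
      induction ρ.coact d using TensorProduct.induction_on with
      | zero => simp only [map_zero, LinearMap.zero_apply, TensorProduct.zero_tmul]
      | tmul e c' => exact hφ _ _ _
      | add a b ha hb =>
        simp only [map_add, LinearMap.add_apply, TensorProduct.add_tmul, ha, hb]
    | add a b ha hb => simp only [map_add, ha, hb]
  have h2 : ∀ w : D ⊗[k] C,
      TensorProduct.lift (φ'.compl₁₂ f ((self k C).conv ψ' g h)) w =
        L ((Coalgebra.comul (R := k) (A := C)).lTensor D w) := by
    intro w
    induction w using TensorProduct.induction_on with
    | zero => simp only [map_zero]
    | tmul d c => rfl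
    | add a b ha hb => simp only [map_add, ha, hb]
  ext y
  rw [conv_apply, conv_apply, h1, h2, ρ.coassoc]

/-- The second factor contributes only the scalar `ε_C(y₍₁₎)`, and `y₍₀₎ ε_C(y₍₁₎) = y`. -/
lemma conv_counit (ρ : RightComodule k C D) (φ : X →ₗ[k] Y →ₗ[k] Z) (f : D →ₗ[k] X) (v : Y)
    (g : C →ₗ[k] Y) (hg : ∀ x, g x = Coalgebra.counit (R := k) x • v) (y : D) :
    ρ.conv φ f g y = φ (f y) v := by
  have key : ∀ w : D ⊗[k] C, TensorProduct.lift (φ.compl₁₂ f g) w =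
      φ (f (TensorProduct.rid k D ((Coalgebra.counit (R := k) (A := C)).lTensor D w))) v := by
    intro w
    induction w using TensorProduct.induction_on with
    | zero => simp
    | tmul d c => simp [hg]
    | add a b ha hb => simp only [map_add, LinearMap.add_apply, ha, hb]
  rw [conv_apply, key, ρ.counit]

/-- Cocommutativity, in the form in which it is used: `x₍₁₎ ⊗ x₍₂₎` is invariant under the flip. -/
lemma conv_comm [Coalgebra.IsCocomm k C] (φ : X →ₗ[k] Y →ₗ[k] Z) (f : C →ₗ[k] X)
    (g : C →ₗ[k] Y) : (self k C).conv φ f g = (self k C).conv φ.flip g f := by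
  ext x
  rw [conv_apply, conv_apply]
  change TensorProduct.lift _ (Coalgebra.comul x) = TensorProduct.lift _ (Coalgebra.comul x)
  -- Once the flip is inserted on the right, the two sides agree for every tensor in `C ⊗ C`, so
  -- linearity suffices.
  conv_rhs => rw [← Coalgebra.comm_comul k x]
  induction Coalgebra.comul (R := k) x using TensorProduct.induction_on with
  | zero => simp
  | tmul d c => simp
  | add a b ha hb => simp only [map_add, ha, hb]

/-- The legs `y₍₁₎` and `y₍₂₎` may be exchanged: the last two arguments are grouped together by
associativity, swapped by cocommutativity of `C`, and ungrouped again. -/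
lemma conv_swap [Coalgebra.IsCocomm k C] (ρ : RightComodule k C D) (φ : V →ₗ[k] Z →ₗ[k] W)
    (ψ : X →ₗ[k] Y →ₗ[k] V) (φ' : V' →ₗ[k] Y →ₗ[k] W) (ψ' : X →ₗ[k] Z →ₗ[k] V')
    (hφ : ∀ x y z, φ (ψ x y) z = φ' (ψ' x z) y)
    (f : D →ₗ[k] X) (g : C →ₗ[k] Y) (h : C →ₗ[k] Z) :
    ρ.conv φ (ρ.conv ψ f g) h = ρ.conv φ' (ρ.conv ψ' f h) g := by
  -- The trilinear expression `φ (ψ x y) z`, regarded as a pairing of `x` with `y ⊗ z`.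
  let χ : X →ₗ[k] Y ⊗[k] Z →ₗ[k] W :=
    (TensorProduct.lift ((LinearMap.lflip (R := k) (R₀ := k)).toLinearMap ∘ₗ
      LinearMap.llcomp k X V (Z →ₗ[k] W) φ ∘ₗ ψ.flip)).flip
  have hχ : ∀ x y z, φ (ψ x y) z = χ x (TensorProduct.mk k Y Z y z) := fun _ _ _ => rfl
  rw [ρ.conv_assoc φ ψ χ (TensorProduct.mk k Y Z) hχ, conv_comm,
    ← ρ.conv_assoc φ' ψ' χ (TensorProduct.mk k Y Z).flip]
  intro x z y
  exact (hφ x y z).symm.trans (hχ x y z)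

end Conv

end RightComodule

open RightComodule

/-! ## Measurings of right modules -/

section Modules

variable {k C D : Type*} [Field k] [AddCommGroup C] [Module k C] [Coalgebra k C]
  [AddCommGroup D] [Module k D]
variable {A U A' U' : Type*} [Ring A] [Algebra k A] [Ring A'] [Algebra k A']
  [Ring U] [Algebra k U] [Ring U'] [Algebra k U']

/-- A comodule measuring `Θ` of right modules: `Θ(y)(m u) = Θ(y₍₀₎)(m) Ψ(y₍₁₎)(u)`. -/
def IsModuleMeasuring (ρ : RightComodule k C D) (Ψ : C →ₗ[k] U →ₗ[k] U') (M : RMod k U)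
    (M' : RMod k U') (Θ : D →ₗ[k] M.carrier →ₗ[k] M'.carrier) : Prop :=
  ∀ m u, Θ.flip (M.ract m u) = ρ.conv M'.ract (Θ.flip m) (Ψ.flip u)

/-- With the algebra elements fixed and the coalgebra element varying, the product rule becomes an
identity of convolutions, to which the rules above apply. -/
lemma IsMeasuring.flip_mul {R R' : Type*} [Ring R] [Algebra k R] [Ring R'] [Algebra k R']
    {ψ : C →ₗ[k] R →ₗ[k] R'} (h : IsMeasuring ψ) (a b : R) :
    ψ.flip (a * b) = (self k C).conv (LinearMap.mul k R') (ψ.flip a) (ψ.flip b) :=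
  LinearMap.ext fun x => h.map_mul x a b

/-- The case `D = C`, `M = U`. The measuring that it induces on `U ⊗_{A^op} U`, the target of the
translation map, is what the treatment of the cyclic operator requires. -/
lemma IsModuleMeasuring.self {Ψ : C →ₗ[k] U →ₗ[k] U'} (h : IsMeasuring Ψ) (B : STRing k A U)
    (B' : STRing k A' U') : IsModuleMeasuring (self k C) Ψ B.reg B'.reg Ψ := h.flip_mul

/-- A measuring of `(s,t)`-rings. -/
structure IsSTMeasuring (B : STRing k A U) (B' : STRing k A' U')
    (Ψ : C →ₗ[k] U →ₗ[k] U') (ψ : C →ₗ[k] A →ₗ[k] A') : Prop where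
  measuring : IsMeasuring Ψ
  map_s : ∀ x a, Ψ x (B.s a) = B'.s (ψ x a)
  map_t : ∀ x a, Ψ x (B.t (op a)) = B'.t (op (ψ x a))

lemma IsHopfMeasuring.isSTMeasuring {H : HopfAlgebroid k A U} {H' : HopfAlgebroid k A' U'}
    {Ψ : C →ₗ[k] U →ₗ[k] U'} {ψ : C →ₗ[k] A →ₗ[k] A'} (h : IsHopfMeasuring H H' Ψ ψ) :
    IsSTMeasuring H.toSTRing H'.toSTRing Ψ ψ := ⟨h.measuring, h.map_s, h.map_t⟩

/-! ### The measuring induced on `M ⊗_{A^op} U`. -/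

section Ind

variable {B : STRing k A U} {B' : STRing k A' U'} {ρ : RightComodule k C D}
  {Ψ : C →ₗ[k] U →ₗ[k] U'} {ψ : C →ₗ[k] A →ₗ[k] A'} {M : RMod k U} {M' : RMod k U'}
  {Θ : D →ₗ[k] M.carrier →ₗ[k] M'.carrier}

/-- The two sides are `Θ(y₍₀₎)(m) t'(ψ(y₍₁₎)(a)) ⊗ Ψ(y₍₂₎)(u)` and `Θ(y₍₀₎)(m) ⊗ t'(ψ(y₍₁₎)(a))
Ψ(y₍₂₎)(u)`. The legs occur in the same order, so coassociativity and the balancing relation over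
`A'` suffice. -/
lemma conv_tm_balanced (hΨ : IsSTMeasuring B B' Ψ ψ) (hΘ : IsModuleMeasuring ρ Ψ M M' Θ)
    (a : A) (m : M.carrier) (u : U) :
    ρ.conv (B'.tm M') (Θ.flip (M.ract m (B.t (op a)))) (Ψ.flip u) =
      ρ.conv (B'.tm M') (Θ.flip m) (Ψ.flip (B.t (op a) * u)) := by
  rw [hΘ, hΨ.measuring.flip_mul]
  have ht : Ψ.flip (B.t (op a)) = B'.t.toLinearMap ∘ₗ
      (MulOpposite.opLinearEquiv k).toLinearMap ∘ₗ ψ.flip a :=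
    LinearMap.ext fun x => hΨ.map_t x a
  -- The map `t'` is absorbed into the pairing, here and in `h2`. The middle argument then takes
  -- values in `A'`, and the hypothesis of `conv_assoc` becomes the balancing relation.
  have h1 : ρ.conv M'.ract (Θ.flip m) (Ψ.flip (B.t (op a))) =
      ρ.conv (M'.ract.compl₂ (B'.t.toLinearMap ∘ₗ (MulOpposite.opLinearEquiv k).toLinearMap))
        (Θ.flip m) (ψ.flip a) := ρ.conv_congr fun d c => by rw [ht]; rfl
  have h2 : (RightComodule.self k C).conv (LinearMap.mul k U') (Ψ.flip (B.t (op a))) (Ψ.flip u) =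
      (RightComodule.self k C).conv (LinearMap.mul k U' ∘ₗ B'.t.toLinearMap ∘ₗ
        (MulOpposite.opLinearEquiv k).toLinearMap) (ψ.flip a) (Ψ.flip u) :=
    conv_congr _ fun d c => by rw [ht]; rfl
  rw [h1, h2]
  exact ρ.conv_assoc _ _ _ _ (fun x b v => B'.tm_bal M' b x v) _ _ _

/-- The measuring `y ↦ (m ⊗ u ↦ Θ(y₍₀₎)(m) ⊗ Ψ(y₍₁₎)(u))` of `M ⊗_{A^op} U`. -/
def indMeasuring (hΨ : IsSTMeasuring B B' Ψ ψ) (hΘ : IsModuleMeasuring ρ Ψ M M' Θ) :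
    D →ₗ[k] (B.ind M).carrier →ₗ[k] (B'.ind M').carrier :=
  (B.indLift ((ρ.conv (B'.tm M')).compl₁₂ Θ.flip Ψ.flip) (conv_tm_balanced hΨ hΘ)).flip

lemma indMeasuring_tm (hΨ : IsSTMeasuring B B' Ψ ψ) (hΘ : IsModuleMeasuring ρ Ψ M M' Θ)
    (m : M.carrier) (u : U) :
    (indMeasuring hΨ hΘ).flip (B.tm M m u) = ρ.conv (B'.tm M') (Θ.flip m) (Ψ.flip u) :=
  B.indLift_tm _ (conv_tm_balanced hΨ hΘ) m u

/-- The action on `M ⊗_{A^op} U` is multiplication in the last factor, so this is the product rule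
for `Ψ` together with coassociativity. It is what makes the construction iterable. -/
lemma isModuleMeasuring_ind (hΨ : IsSTMeasuring B B' Ψ ψ) (hΘ : IsModuleMeasuring ρ Ψ M M' Θ) :
    IsModuleMeasuring ρ Ψ (B.ind M) (B'.ind M') (indMeasuring hΨ hΘ) := by
  intro q v
  induction q using B.ind_induction with
  | tm m u =>
    rw [B.ract_tm, indMeasuring_tm, indMeasuring_tm, hΨ.measuring.flip_mul]
    exact (ρ.conv_assoc _ _ _ _ (fun x u v => B'.ract_tm M' x u v) _ _ _).symm
  | add x y hx hy => simp only [map_add, LinearMap.add_apply, hx, hy]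

variable {N : RMod k U} {N' : RMod k U'} {Ξ : D →ₗ[k] N.carrier →ₗ[k] N'.carrier}

/-- Naturality of the induced measuring. It carries a compatibility from `f` to `f ⊗ id`, which is
how all faces and degeneracies except the basic ones are built. -/
lemma mapFun_indMeasuring (hΨ : IsSTMeasuring B B' Ψ ψ) (hΘ : IsModuleMeasuring ρ Ψ M M' Θ)
    (hΞ : IsModuleMeasuring ρ Ψ N N' Ξ) (f : B.THom M N) (f' : B'.THom M' N')
    (hf : ∀ y m, Ξ y (f.toMap m) = f'.toMap (Θ y m)) (y : D) (q : (B.ind M).carrier) :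
    indMeasuring hΨ hΞ y (f.mapFun q) = f'.mapFun (indMeasuring hΨ hΘ y q) := by
  induction q using B.ind_induction with
  | tm m u =>
    rw [STRing.THom.mapFun_tm, ← LinearMap.flip_apply, indMeasuring_tm,
      ← LinearMap.flip_apply (indMeasuring hΨ hΘ), indMeasuring_tm, map_conv]
    congr 1
    refine ρ.conv_congr fun d c => ?_
    rw [LinearMap.compr₂_apply, STRing.THom.mapFun_tm, LinearMap.flip_apply, hf]
    rfl
  | add a b ha hb => simp only [map_add, ha, hb]

/-- On `m ⊗ u` this is precisely the product rule for `Θ`. -/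
lemma mulFun_indMeasuring (hΨ : IsSTMeasuring B B' Ψ ψ) (hΘ : IsModuleMeasuring ρ Ψ M M' Θ)
    (y : D) (q : (B.ind M).carrier) :
    Θ y (B.mulFun M q) = B'.mulFun M' (indMeasuring hΨ hΘ y q) := by
  induction q using B.ind_induction with
  | tm m u =>
    rw [STRing.mulFun_tm, ← LinearMap.flip_apply, hΘ,
      ← LinearMap.flip_apply (indMeasuring hΨ hΘ), indMeasuring_tm, map_conv]
    exact LinearMap.congr_fun (ρ.conv_congr fun d c => (B'.mulFun_tm M' _ _).symm) y
  | add a b ha hb => simp only [map_add, ha, hb]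

/-- Since `Ψ(x)(1) = ε_C(x) 1`, the leg attached to the inserted unit is removed by the counit of
the comodule. -/
lemma unitMap_indMeasuring (hΨ : IsSTMeasuring B B' Ψ ψ) (hΘ : IsModuleMeasuring ρ Ψ M M' Θ)
    (y : D) (m : M.carrier) :
    indMeasuring hΨ hΘ y ((B.unitMap M).toMap m) = (B'.unitMap M').toMap (Θ y m) := by
  rw [STRing.unitMap_apply, STRing.unitMap_apply, ← LinearMap.flip_apply, indMeasuring_tm]
  exact ρ.conv_counit _ _ 1 _ hΨ.measuring.map_one y

/-! ### Faces and degeneracies -/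

/-- The measuring `y ↦ (p ⊗ u¹ ⊗ ⋯ ⊗ uⁿ ↦ Ω(y₍₀₎)(p) ⊗ Ψ(y₍₁₎)(u¹) ⊗ ⋯ ⊗ Ψ(y₍ₙ₎)(uⁿ))`. -/
def tensorMeasuring (hΨ : IsSTMeasuring B B' Ψ ψ) (hΘ : IsModuleMeasuring ρ Ψ M M' Θ) : (n : ℕ) →
    {Ξ : D →ₗ[k] (B.C M n).carrier →ₗ[k] (B'.C M' n).carrier //
      IsModuleMeasuring ρ Ψ (B.C M n) (B'.C M' n) Ξ}
  -- The product rule is carried along in the subtype because well-definedness of the next stage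
  -- depends on it.
  | 0 => ⟨Θ, hΘ⟩
  | n + 1 => ⟨indMeasuring hΨ (tensorMeasuring hΨ hΘ n).2,
      isModuleMeasuring_ind hΨ (tensorMeasuring hΨ hΘ n).2⟩

/-- Both sides obey the same recursion: the last factor is measured by `y₍₁₎`, and the remaining
tensor by `y₍₀₎`, to which the coaction is applied again. -/
lemma tensorMeasuring_tprod (hΨ : IsSTMeasuring B B' Ψ ψ) (hΘ : IsModuleMeasuring ρ Ψ M M' Θ)
    (n : ℕ) (m : M.carrier) (u : Fin n → U) :
    (tensorMeasuring hΨ hΘ n).1.flip (B.tprod M m n u) =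
      measuredTensor B' M' ρ Ψ Θ m n u := by
  induction n with
  | zero => rfl
  | succ n ih =>
    refine (indMeasuring_tm hΨ (tensorMeasuring hΨ hΘ n).2 _ _).trans ?_
    rw [ih]
    rfl

lemma tensorMeasuring_dSucc (hΨ : IsSTMeasuring B B' Ψ ψ) (hΘ : IsModuleMeasuring ρ Ψ M M' Θ)
    (n : ℕ) (i : Fin (n + 1)) (y : D) (q : (B.C M (n + 1)).carrier) :
    (tensorMeasuring hΨ hΘ n).1 y ((B.dSucc M n i).toMap q) =
      (B'.dSucc M' n i).toMap ((tensorMeasuring hΨ hΘ (n + 1)).1 y q) := by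
  -- In `d ⊗ id` the map `d` is met by the measuring at `y₍₀₎`, so the induction hypothesis is
  -- needed for all elements of `D`.
  induction n generalizing y with
  | zero =>
    obtain rfl : i = 0 := Fin.fin_one_eq_zero i
    exact mulFun_indMeasuring hΨ (tensorMeasuring hΨ hΘ 0).2 y q
  | succ n ih =>
    cases i using Fin.cases with
    | zero => exact mulFun_indMeasuring hΨ (tensorMeasuring hΨ hΘ (n + 1)).2 y q
    | succ i =>
      exact mapFun_indMeasuring hΨ (tensorMeasuring hΨ hΘ (n + 1)).2 (tensorMeasuring hΨ hΘ n).2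
        _ _ (fun y q => ih i y q) y q

lemma tensorMeasuring_degen (hΨ : IsSTMeasuring B B' Ψ ψ) (hΘ : IsModuleMeasuring ρ Ψ M M' Θ)
    (n : ℕ) (i : Fin (n + 1)) (y : D) (q : (B.C M n).carrier) :
    (tensorMeasuring hΨ hΘ (n + 1)).1 y ((B.degen M n i).toMap q) =
      (B'.degen M' n i).toMap ((tensorMeasuring hΨ hΘ n).1 y q) := by
  induction n generalizing y with
  | zero =>
    obtain rfl : i = 0 := Fin.fin_one_eq_zero i
    exact unitMap_indMeasuring hΨ (tensorMeasuring hΨ hΘ 0).2 y q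
  | succ n ih =>
    cases i using Fin.cases with
    | zero => exact unitMap_indMeasuring hΨ (tensorMeasuring hΨ hΘ (n + 1)).2 y q
    | succ i =>
      exact mapFun_indMeasuring hΨ (tensorMeasuring hΨ hΘ n).2
        (tensorMeasuring hΨ hΘ (n + 1)).2 _ _ (fun y q => ih i y q) y q

end Ind

/-! ### The counit face, and measurings of `M ⊗_{A^op} U ⊗_{A^op} U`. -/

section Hopf

variable {H : HopfAlgebroid k A U} {H' : HopfAlgebroid k A' U'} {ρ : RightComodule k C D}
  {Ψ : C →ₗ[k] U →ₗ[k] U'} {ψ : C →ₗ[k] A →ₗ[k] A'} {M : RMod k U} {M' : RMod k U'}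
  {Θ : D →ₗ[k] M.carrier →ₗ[k] M'.carrier}

/-- The map is `m ⊗ u ↦ m t(ε(u))`, so the product rule for `Θ` reduces the claim to the
compatibility of the measuring with the target map and the counit. -/
lemma epsFun_indMeasuring (h : IsHopfMeasuring H H' Ψ ψ) (hΘ : IsModuleMeasuring ρ Ψ M M' Θ)
    (y : D) (q : (H.ind M).carrier) :
    Θ y (H.epsFun M q) = H'.epsFun M' (indMeasuring h.isSTMeasuring hΘ y q) := by
  induction q using H.ind_induction with
  | tm m u =>
    rw [LeftBialgebroid.epsFun_tm, ← LinearMap.flip_apply, hΘ,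
      ← LinearMap.flip_apply (indMeasuring _ hΘ), indMeasuring_tm, map_conv]
    congr 1
    refine ρ.conv_congr fun d c => ?_
    rw [LinearMap.compr₂_apply, LeftBialgebroid.epsFun_tm]
    change M'.ract _ (Ψ c (H.t (op (H.counit u)))) = M'.ract _ (H'.t (op (H'.counit (Ψ c u))))
    rw [h.map_t, h.map_counit]
  | add a b ha hb => simp only [map_add, ha, hb]

lemma tensorMeasuring_face (h : IsHopfMeasuring H H' Ψ ψ) (hΘ : IsModuleMeasuring ρ Ψ M M' Θ)
    (n : ℕ) (i : Fin (n + 2)) (y : D) (q : (H.C M (n + 1)).carrier) :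
    (tensorMeasuring h.isSTMeasuring hΘ n).1 y (H.face M n i q) =
      H'.face M' n i ((tensorMeasuring h.isSTMeasuring hΘ (n + 1)).1 y q) := by
  cases i using Fin.cases with
  | zero => exact epsFun_indMeasuring h (tensorMeasuring h.isSTMeasuring hΘ n).2 y q
  | succ i => exact tensorMeasuring_dSucc h.isSTMeasuring hΘ n i y q

/-- On `m ⊗ u ⊗ v`, coassociativity turns the grouping `((y₍₀₎, y₍₁₎), y₍₂₎)` into `(y₍₀₎, (y₍₁₎,
y₍₂₎))`. The last two factors are thus measured as one element of `U ⊗_{A^op} U`, which need not be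
an elementary tensor; it will be `u₊ ⊗ u₋`. -/
lemma indMeasuring_insHG (h : IsHopfMeasuring H H' Ψ ψ) (hΘ : IsModuleMeasuring ρ Ψ M M' Θ)
    (m : M.carrier) (q : H.HG) :
    (indMeasuring h.isSTMeasuring (isModuleMeasuring_ind h.isSTMeasuring hΘ)).flip
        ((H.tmHom M m).mapFun q) =
      ρ.conv (H'.insHG M').flip (Θ.flip m) ((indMeasuring h.isSTMeasuring
        (IsModuleMeasuring.self h.measuring H.toSTRing H'.toSTRing)).flip q) := by
  induction q using H.hg_induction with
  | tm u v =>
    rw [H.mapFun_hg, indMeasuring_tm]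
    change ρ.conv _ ((indMeasuring _ hΘ).flip (H.tm M m u)) _ =
      ρ.conv _ _ ((indMeasuring _ _).flip (H.tm H.reg u v))
    rw [indMeasuring_tm, indMeasuring_tm]
    refine ρ.conv_assoc _ _ _ _ (fun x y z => ?_) _ _ _
    change _ = H'.insHG M' (H'.hg y z) x
    rw [H'.insHG_eq, H'.mapFun_hg]
    rfl
  | add a b ha hb => simp only [map_add, ha, hb]

/-! ### The translation map -/

variable [Coalgebra.IsCocomm k C]

/-- The elementary tensor in `U ⊗_A U`, as a bilinear map. -/
def STRing.tenMk (B : STRing k A U) : U →ₗ[k] U →ₗ[k] B.Ten :=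
  (TensorProduct.mk k U U).compr₂ B.cls

/-- In contrast to `⊗_{A^op}`, here the scalar stands to the left of `u` on one side and between `u`
and `v` on the other: `t'(ψ(x₍₁₎)(a)) Ψ(x₍₂₎)(u) ⊗ Ψ(x₍₃₎)(v)` has to equal `Ψ(x₍₁₎)(u) ⊗
s'(ψ(x₍₂₎)(a)) Ψ(x₍₃₎)(v)`. -/
lemma conv_tenMk_balanced {B : STRing k A U} {B' : STRing k A' U'}
    (hΨ : IsSTMeasuring B B' Ψ ψ) (a : A) (u v : U) :
    (self k C).conv B'.tenMk (Ψ.flip (B.t (op a) * u)) (Ψ.flip v) =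
      (self k C).conv B'.tenMk (Ψ.flip u) (Ψ.flip (B.s a * v)) := by
  rw [hΨ.measuring.flip_mul, hΨ.measuring.flip_mul]
  have h1 : (self k C).conv (LinearMap.mul k U') (Ψ.flip (B.t (op a))) (Ψ.flip u) =
      (self k C).conv (LinearMap.mul k U' ∘ₗ B'.t.toLinearMap ∘ₗ
        (MulOpposite.opLinearEquiv k).toLinearMap) (ψ.flip a) (Ψ.flip u) :=
    conv_congr _ fun d c => by rw [LinearMap.flip_apply, hΨ.map_t]; rfl
  have h2 : (self k C).conv (LinearMap.mul k U') (Ψ.flip (B.s a)) (Ψ.flip v) =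
      (self k C).conv (LinearMap.mul k U' ∘ₗ B'.s.toLinearMap) (ψ.flip a) (Ψ.flip v) :=
    conv_congr _ fun d c => by rw [LinearMap.flip_apply, hΨ.map_s]; rfl
  -- Cocommutativity places the leg of `a` after the leg of `u`; then the relation of `U' ⊗_{A'} U'`
  -- applies through associativity.
  rw [h1, h2, conv_comm _ (ψ.flip a)]
  exact conv_assoc _ _ _ _ _ (fun x b w => B'.cls_bal b x w) _ _ _

/-- The measuring `x ↦ (u ⊗ v ↦ Ψ(x₍₁₎)(u) ⊗ Ψ(x₍₂₎)(v))` of `U ⊗_A U`. -/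
def tenMeasuring {B : STRing k A U} {B' : STRing k A' U'} (hΨ : IsSTMeasuring B B' Ψ ψ) :
    C →ₗ[k] B.Ten →ₗ[k] B'.Ten :=
  (B.tenLift (((self k C).conv B'.tenMk).compl₁₂ Ψ.flip Ψ.flip) (conv_tenMk_balanced hΨ)).flip

/-- The defining formula on elementary tensors, as an identity of functions of the coalgebra
element. -/
lemma tenMeasuring_cls {B : STRing k A U} {B' : STRing k A' U'} (hΨ : IsSTMeasuring B B' Ψ ψ)
    (u v : U) : (tenMeasuring hΨ).flip (B.cls (u ⊗ₜ v)) =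
      (self k C).conv B'.tenMk (Ψ.flip u) (Ψ.flip v) := rfl

/-- This links the convolution form to the representative-wise formula in which `IsHopfMeasuring`
expresses compatibility with the coproduct. -/
lemma tenMeasuring_cls_apply {B : STRing k A U} {B' : STRing k A' U'}
    (hΨ : IsSTMeasuring B B' Ψ ψ) (x : C) (X : U ⊗[k] U) :
    tenMeasuring hΨ x (B.cls X) = B'.cls (TensorProduct.homTensorHomMap (RingHom.id k) U U U' U'
      (TensorProduct.map Ψ Ψ (Coalgebra.comul x)) X) := by
  induction X using TensorProduct.induction_on with
  | zero => simp
  | tmul u v =>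
    change (self k C).conv B'.tenMk (Ψ.flip u) (Ψ.flip v) x = _
    rw [conv_apply]
    change TensorProduct.lift _ (Coalgebra.comul x) = _
    induction Coalgebra.comul (R := k) x using TensorProduct.induction_on with
    | zero => simp
    | tmul c d => rfl
    | add a b ha hb => simp only [map_add, LinearMap.add_apply, ha, hb]
  | add a b ha hb => simp only [map_add, ha, hb]

/-- The action multiplies only the second factor, so the product rule for `Ψ` and coassociativity
suffice. This handles the factor `v` in `β(u ⊗ v) = Δ(u) (1 ⊗ v)`. -/
lemma isModuleMeasuring_tenR {B : STRing k A U} {B' : STRing k A' U'}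
    (hΨ : IsSTMeasuring B B' Ψ ψ) :
    IsModuleMeasuring (self k C) Ψ B.tenR B'.tenR (tenMeasuring hΨ) := by
  intro q v
  induction q using B.ten_induction with
  | tm a b =>
    rw [B.tenR_ract, B.rmul_cls, Algebra.TensorProduct.tmul_mul_tmul, mul_one, tenMeasuring_cls,
      tenMeasuring_cls, hΨ.measuring.flip_mul]
    refine (conv_assoc _ _ _ _ _ (fun x y z => ?_) _ _ _).symm
    change B'.rmul (B'.cls (x ⊗ₜ y)) (1 ⊗ₜ z) = B'.cls (x ⊗ₜ (y * z))
    simp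
  | add a b ha hb => simp only [map_add, LinearMap.add_apply, ha, hb]

/-- Since `β(u ⊗ v)` is `Δ(u)` acted on by `v`, the product rule on `U ⊗_A U` and the compatibility
of `Ψ` with coproducts give that measurings intertwine `β` and `β'`. -/
lemma galois_indMeasuring (h : IsHopfMeasuring H H' Ψ ψ) (x : C) (q : H.HG) :
    tenMeasuring h.isSTMeasuring x (H.galois q) =
      H'.galois (indMeasuring h.isSTMeasuring
        (IsModuleMeasuring.self h.measuring H.toSTRing H'.toSTRing) x q) := by
  induction q using H.hg_induction with
  | tm u v =>
    rw [H.galois_hg, ← H.tenR_ract, ← LinearMap.flip_apply, isModuleMeasuring_tenR]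
    change _ = H'.galois ((indMeasuring h.isSTMeasuring
      (IsModuleMeasuring.self h.measuring H.toSTRing H'.toSTRing)).flip (H.tm H.reg u v) x)
    rw [indMeasuring_tm, map_conv]
    congr 1
    refine conv_congr _ fun d c => ?_
    obtain ⟨X, hX⟩ := H.cls_surj (H.comul u)
    have hc : tenMeasuring h.isSTMeasuring d (H.comul u) = H'.comul (Ψ d u) := by
      rw [← hX, tenMeasuring_cls_apply, h.map_comul d u X hX]
    rw [LinearMap.flip_apply, hc]
    exact (H'.galois_hg _ _).symm
  | add a b ha hb => simp only [map_add, ha, hb]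

/-- `Ψ(x)(u)₊ ⊗ Ψ(x)(u)₋ = Ψ(x₍₁₎)(u₊) ⊗ Ψ(x₍₂₎)(u₋)` -/
lemma indMeasuring_trans (h : IsHopfMeasuring H H' Ψ ψ) (u : U) :
    (indMeasuring h.isSTMeasuring
      (IsModuleMeasuring.self h.measuring H.toSTRing H'.toSTRing)).flip (H.trans u) =
        H'.trans ∘ₗ Ψ.flip u := by
  ext x
  -- Both sides are compared after applying `β'`. The right side becomes `Ψ(x)(u) ⊗ 1`. The left
  -- becomes the measuring of `β(u₊ ⊗ u₋) = u ⊗ 1`, that is `Ψ(x₍₁₎)(u) ⊗ Ψ(x₍₂₎)(1)`, which is the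
  -- same by the counit.
  apply H'.galois_bijective.1
  rw [LinearMap.flip_apply, ← galois_indMeasuring h, H.galois_trans, LinearMap.comp_apply,
    H'.galois_trans, ← LinearMap.flip_apply, tenMeasuring_cls]
  exact conv_counit _ _ _ 1 _ h.measuring.map_one x

/-- Measuring `m ⊗ u₊ ⊗ u₋ w` attaches `y₍₁₎` to `u` and `y₍₂₎` to `w`, whereas measuring `m ⊗ w`
first and then inserting `u` attaches them the other way round. The exchange is `conv_swap`. -/
lemma indMeasuring_step (h : IsHopfMeasuring H H' Ψ ψ) (hΘ : IsModuleMeasuring ρ Ψ M M' Θ)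
    (q : (H.ind M).carrier) (u : U) :
    (indMeasuring h.isSTMeasuring (isModuleMeasuring_ind h.isSTMeasuring hΘ)).flip
        (H.step M q u) =
      ρ.conv (H'.step M') ((indMeasuring h.isSTMeasuring hΘ).flip q) (Ψ.flip u) := by
  induction q using H.ind_induction with
  | tm m w =>
    rw [H.step_tm, isModuleMeasuring_ind h.isSTMeasuring
      (isModuleMeasuring_ind h.isSTMeasuring hΘ), indMeasuring_insHG h hΘ, indMeasuring_tm,
      indMeasuring_trans h]
    -- The translation map of the target is absorbed into the pairing, so that `Ψ.flip u` itself is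
    -- the function whose leg is exchanged.
    have h1 : ρ.conv (H'.insHG M').flip (Θ.flip m) (H'.trans ∘ₗ Ψ.flip u) =
        ρ.conv ((H'.insHG M').flip.compl₂ H'.trans) (Θ.flip m) (Ψ.flip u) :=
      ρ.conv_congr fun _ _ => rfl
    rw [h1]
    refine ρ.conv_swap _ _ _ _ (fun x y z => ?_) _ _ _
    rw [H'.step_tm, ← H'.insHG_eq]
    rfl
  | add a b ha hb => simp only [map_add, LinearMap.add_apply, ha, hb]

/-- Compatibility with measurings is inherited from `f` by `c ⊗ u ↦ step (f c) u`. -/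
lemma indMeasuring_of_step (h : IsHopfMeasuring H H' Ψ ψ) (hΘ : IsModuleMeasuring ρ Ψ M M' Θ)
    {f : M.carrier →ₗ[k] (H.ind M).carrier} {f' : M'.carrier →ₗ[k] (H'.ind M').carrier}
    {g : (H.ind M).carrier →ₗ[k] (H.ind (H.ind M)).carrier}
    {g' : (H'.ind M').carrier →ₗ[k] (H'.ind (H'.ind M')).carrier}
    (hg : ∀ m u, g (H.tm M m u) = H.step M (f m) u)
    (hg' : ∀ m u, g' (H'.tm M' m u) = H'.step M' (f' m) u)
    (hf : ∀ y m, indMeasuring h.isSTMeasuring hΘ y (f m) = f' (Θ y m))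
    (y : D) (q : (H.ind M).carrier) :
    indMeasuring h.isSTMeasuring (isModuleMeasuring_ind h.isSTMeasuring hΘ) y (g q) =
      g' (indMeasuring h.isSTMeasuring hΘ y q) := by
  induction q using H.ind_induction with
  | tm m u =>
    rw [hg, ← LinearMap.flip_apply, indMeasuring_step h hΘ,
      ← LinearMap.flip_apply (indMeasuring h.isSTMeasuring hΘ), indMeasuring_tm, map_conv]
    refine LinearMap.congr_fun (ρ.conv_congr fun d x => ?_) y
    rw [LinearMap.compr₂_apply, hg', LinearMap.flip_apply, LinearMap.flip_apply Θ, hf]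
  | add a b ha hb => simp only [map_add, ha, hb]

end Hopf

/-! ### The cyclic operator -/

section SAYD

variable {H : HopfAlgebroid k A U} {H' : HopfAlgebroid k A' U'} {P : SAYDModule H}
  {P' : SAYDModule H'} {ρ : RightComodule k C D} {Ψ : C →ₗ[k] U →ₗ[k] U'}
  {ψ : C →ₗ[k] A →ₗ[k] A'} {Ω : D →ₗ[k] P.carrier →ₗ[k] P'.carrier}

lemma IsComoduleMeasuring.isModuleMeasuring (hΩ : IsComoduleMeasuring P P' ρ Ψ Ω) :
    IsModuleMeasuring ρ Ψ P.toRMod P'.toRMod Ω :=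
  fun p u => LinearMap.ext fun y => hΩ.map_ract y p u

/-- This is the coaction axiom of a comodule measuring, transported along `v ⊗ p ↦ p ⊗ v`. The
transport also undoes the flip of `y₍₀₎` and `y₍₁₎` in that axiom. -/
lemma coactR_indMeasuring (hΨ : IsSTMeasuring H.toSTRing H'.toSTRing Ψ ψ)
    (hΩ : IsComoduleMeasuring P P' ρ Ψ Ω) (y : D) (p : P.carrier) :
    indMeasuring hΨ hΩ.isModuleMeasuring y (P.coactR p) = P'.coactR (Ω y p) := by
  obtain ⟨X, hX⟩ := Submodule.mkQ_surjective _ (P.comod.coact p)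
  rw [P'.coactR_eq _ _ (hΩ.map_coact y p X hX).symm, P.coactR_eq p X hX]
  -- With both coactions replaced by representatives, the identity is linear in `X` and holds for
  -- every `X`; the induction must not carry the constraint on `X`.
  clear hX
  induction X using TensorProduct.induction_on with
  | zero => simp only [map_zero]
  | tmul v q =>
    change (indMeasuring hΨ hΩ.isModuleMeasuring).flip (H.tm P.toRMod q v) y = _
    rw [indMeasuring_tm, conv_apply]
    induction ρ.coact y using TensorProduct.induction_on with
    | zero => simp only [map_zero, LinearMap.zero_apply]
    | tmul d c => rfl
    | add a b ha hb => simp only [map_add, LinearMap.add_apply, ha, hb]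
  | add a b ha hb => simp only [map_add, ha, hb]

variable [Coalgebra.IsCocomm k C]

/-- The map is the coaction for `n = 0`, and each further factor `u` is inserted by `step`;
compatibility therefore propagates from the coaction by induction, with `y` varying since the
earlier factors are met at `y₍₀₎`. -/
lemma tensorMeasuring_rotMap (h : IsHopfMeasuring H H' Ψ ψ)
    (hΩ : IsComoduleMeasuring P P' ρ Ψ Ω) (n : ℕ) (y : D) (q : (P.Cn n).carrier) :
    (tensorMeasuring h.isSTMeasuring hΩ.isModuleMeasuring (n + 1)).1 y (P.rotMap n q) =
      P'.rotMap n ((tensorMeasuring h.isSTMeasuring hΩ.isModuleMeasuring n).1 y q) := by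
  induction n generalizing y with
  | zero => exact coactR_indMeasuring h.isSTMeasuring hΩ y q
  | succ n ih =>
    exact indMeasuring_of_step h (tensorMeasuring h.isSTMeasuring hΩ.isModuleMeasuring n).2
      (P.rotMap_succ n) (P'.rotMap_succ n) ih y q

lemma tensorMeasuring_cyc (h : IsHopfMeasuring H H' Ψ ψ)
    (hΩ : IsComoduleMeasuring P P' ρ Ψ Ω) (n : ℕ) (y : D) (q : (P.Cn n).carrier) :
    (tensorMeasuring h.isSTMeasuring hΩ.isModuleMeasuring n).1 y (P.cyc n q) =
      P'.cyc n ((tensorMeasuring h.isSTMeasuring hΩ.isModuleMeasuring n).1 y q) := by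
  rw [P.cyc_apply, P'.cyc_apply, tensorMeasuring_dSucc, tensorMeasuring_rotMap h hΩ]

/-- The morphism of cyclic modules given by a comodule measuring. -/
noncomputable def cyclicHom (h : IsHopfMeasuring H H' Ψ ψ)
    (hΩ : IsComoduleMeasuring P P' ρ Ψ Ω) (y : D) :
    CyclicModule.Hom P.cyclicModule P'.cyclicModule where
  f n := (tensorMeasuring h.isSTMeasuring hΩ.isModuleMeasuring n).1 y
  f_d n i q := tensorMeasuring_face h hΩ.isModuleMeasuring n i y q
  f_s n i q := tensorMeasuring_degen h.isSTMeasuring hΩ.isModuleMeasuring n i y q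
  f_t n q := tensorMeasuring_cyc h hΩ n y q

end SAYD

/-- Linear maps on `C_n` are determined by their values on elementary tensors. -/
lemma STRing.tprod_ext {X : Type*} [AddCommGroup X] [Module k X] {B : STRing k A U}
    {P : RMod k U} {n : ℕ} {f g : (B.C P n).carrier →ₗ[k] X}
    (h : ∀ p u, f (B.tprod P p n u) = g (B.tprod P p n u)) : f = g := by
  induction n generalizing X with
  | zero => exact LinearMap.ext fun p => h p Fin.elim0
  | succ n ih =>
    -- With the last factor `v` fixed, both maps become linear maps on `C_n`, to which the induction
    -- hypothesis applies; `Fin.snoc u v` restores the full tuple.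
    have key : ((B.tm (B.C P n)).compr₂ f).flip = ((B.tm (B.C P n)).compr₂ g).flip := by
      refine LinearMap.ext fun v => ih fun p u => ?_
      have := h p (Fin.snoc u v)
      rw [tprod, Fin.init_snoc, Fin.snoc_last] at this
      exact this
    refine LinearMap.ext fun q => ?_
    induction q using B.ind_induction with
    | tm m v => exact LinearMap.congr_fun (LinearMap.congr_fun key v) m
    | add a b ha hb => rw [map_add, map_add, ha, hb]

end Modules

/-! ## Induced maps on homology -/

section Homology

variable {k : Type*} [Field k] {Z Z' : ℕ → Type*} [∀ n, AddCommGroup (Z n)] [∀ n, Module k (Z n)]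
  [∀ n, AddCommGroup (Z' n)] [∀ n, Module k (Z' n)]

/-- A chain map preserves cycles and boundaries, so it descends to the quotient. Uniqueness holds
because every homology class is the class of a cycle. -/
lemma existsUnique_isInduced {δ : ∀ n, Z (n + 1) →ₗ[k] Z n} {δ' : ∀ n, Z' (n + 1) →ₗ[k] Z' n}
    (f : ∀ n, Z n →ₗ[k] Z' n) (hf : ∀ n z, f n (δ n z) = δ' n (f (n + 1) z)) (n : ℕ) :
    ∃! φ : Homology δ n →ₗ[k] Homology δ' n, IsInduced δ δ' (f n) φ := by
  have hc : ∀ z ∈ cycles δ n, f n z ∈ cycles δ' n := by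
    intro z hz
    cases n with
    | zero => trivial
    | succ n =>
      have hz' : δ n z = 0 := hz
      change δ' n (f (n + 1) z) = 0
      rw [← hf, hz', map_zero]
  refine ⟨Submodule.mapQ _ _ ((f n).restrict hc) ?_, ?_, ?_⟩
  · rintro ⟨z, hz⟩ ⟨w, hw⟩
    exact ⟨f (n + 1) w, by rw [← hf, hw]; rfl⟩
  · exact fun z hz => ⟨hc z hz, rfl⟩
  · intro φ hφ
    refine Submodule.linearMap_qext _ (LinearMap.ext fun ⟨z, hz⟩ => ?_)
    obtain ⟨_, h⟩ := hφ z hz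
    exact h

end Homology

/-! ### Morphisms of cyclic modules and the differentials of the cyclic bicomplex. -/

namespace CyclicModule.Hom

variable {k : Type*} [Field k] {X Y : CyclicModule k} (F : X.Hom Y)

lemma f_b (n : ℕ) (q : X.X (n + 1)) : F.f n (X.b n q) = Y.b n (F.f (n + 1) q) := by
  simp [CyclicModule.b, LinearMap.sum_apply, map_sum, F.f_d]

lemma f_bPrime (n : ℕ) (q : X.X (n + 1)) :
    F.f n (X.bPrime n q) = Y.bPrime n (F.f (n + 1) q) := by
  simp [CyclicModule.bPrime, LinearMap.sum_apply, map_sum, F.f_d]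

lemma f_signedT (n : ℕ) (q : X.X n) : F.f n (X.signedT n q) = Y.signedT n (F.f n q) := by
  simp [CyclicModule.signedT, F.f_t]

lemma f_signedT_pow (n j : ℕ) (q : X.X n) :
    F.f n ((X.signedT n ^ j) q) = (Y.signedT n ^ j) (F.f n q) := by
  induction j generalizing q with
  | zero => rfl
  | succ j ih => rw [pow_succ, pow_succ, Module.End.mul_apply, Module.End.mul_apply, ih, f_signedT]

lemma f_normOp (n : ℕ) (q : X.X n) : F.f n (X.normOp n q) = Y.normOp n (F.f n q) := by
  simp [CyclicModule.normOp, LinearMap.sum_apply, map_sum, f_signedT_pow]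

/-- Each component of the total differential is a sum of one vertical and one horizontal map, chosen
by the parity of the column; all four candidates are built from faces and cyclic operators. -/
lemma tot_totD (n : ℕ) (z : X.Tot (n + 1)) :
    F.tot n (X.totD n z) = Y.totD n (F.tot (n + 1) z) := by
  funext q
  change F.f q (X.totD n z q) = Y.totD n (F.tot (n + 1) z) q
  rw [CyclicModule.totD, CyclicModule.totD, LinearMap.pi_apply, LinearMap.pi_apply]
  split_ifs
  · simp only [LinearMap.add_apply, LinearMap.comp_apply, map_add, LinearMap.sub_apply, map_sub,
      Module.End.one_apply, LinearMap.proj_apply, f_b, f_signedT]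
    rfl
  · simp only [LinearMap.add_apply, LinearMap.comp_apply, map_add, LinearMap.neg_apply, map_neg,
      LinearMap.proj_apply, f_bPrime, f_normOp]
    rfl

end CyclicModule.Hom

end HopfAlgebroids

/-! ### Existence, uniqueness and the induced maps on homology. -/

theorem proposition6p2 {k : Type*} [Field k] {A U A' U' : Type*}
    [Ring A] [Algebra k A] [Ring U] [Algebra k U] [Ring A'] [Algebra k A'] [Ring U'] [Algebra k U']
    (H : HopfAlgebroid k A U) (H' : HopfAlgebroid k A' U')
    (P : SAYDModule H) (P' : SAYDModule H')
    {C D : Type*} [AddCommGroup C] [Module k C] [Coalgebra k C] [Coalgebra.IsCocomm k C]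
    [AddCommGroup D] [Module k D] (ρ : RightComodule k C D)
    (Ψ : C →ₗ[k] U →ₗ[k] U') (ψ : C →ₗ[k] A →ₗ[k] A') (hΨ : IsHopfMeasuring H H' Ψ ψ)
    (Ω : D →ₗ[k] P.carrier →ₗ[k] P'.carrier) (hΩ : IsComoduleMeasuring P P' ρ Ψ Ω) (y : D) :
    ∃! F : CyclicModule.Hom P.cyclicModule P'.cyclicModule,
      (∀ (n : ℕ) (p : P.carrier) (u : Fin n → U),
        F.f n (H.tprod P.toRMod p n u) = measuredTensor H'.toSTRing P'.toRMod ρ Ψ Ω p n u y) ∧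
      (∀ n : ℕ, ∃! φ : P.cyclicModule.HH n →ₗ[k] P'.cyclicModule.HH n,
        IsInduced P.cyclicModule.b P'.cyclicModule.b (F.f n) φ) ∧
      (∀ n : ℕ, ∃! φ : P.cyclicModule.HC n →ₗ[k] P'.cyclicModule.HC n,
        IsInduced P.cyclicModule.totD P'.cyclicModule.totD (F.tot n) φ) := by
  have hF : ∀ (n : ℕ) (p : P.carrier) (u : Fin n → U),
      (cyclicHom hΨ hΩ y).f n (H.tprod P.toRMod p n u) =
        measuredTensor H'.toSTRing P'.toRMod ρ Ψ Ω p n u y := fun n p u =>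
    LinearMap.congr_fun
      (tensorMeasuring_tprod hΨ.isSTMeasuring hΩ.isModuleMeasuring n p u) y
  refine ⟨cyclicHom hΨ hΩ y, ⟨hF, fun n => ?_, fun n => ?_⟩, fun G hG => ?_⟩
  · exact existsUnique_isInduced (cyclicHom hΨ hΩ y).f (cyclicHom hΨ hΩ y).f_b n
  · exact existsUnique_isInduced (cyclicHom hΨ hΩ y).tot (cyclicHom hΨ hΩ y).tot_totD n
  · refine CyclicModule.Hom.ext (funext fun n => ?_)
    -- The prescribed values on elementary tensors already force equality in every degree.
    exact STRing.tprod_ext fun p u => (hG.1 n p u).trans (hF n p u).symm
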